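/- Let $d\ge 2$, $\alpha\in(0,1)$, $0<\delta<\tfrac12$, $B_0=(1,0,\dots,0)\in\mathbf R^d$. For $s>0$ let $$H(s)\phi(X)=(4\pi s)^{-d/2}\int_{\mathbf R^d}e^{-|X-Y|^2/(4s)}\phi(Y)\,dY .$$ For $\mu_1>0$, $t>0$ define the weights $$f(t)=H(1+2\mu_1t)\phi_1,\quad f_1(t)=H(1+2\mu_1t)\phi_0,\quad f_\pm(t,X)=f(t,X\pm tB_0),$$ $$\phi_1(X)=(x_1^2+x_2^2)^{-\frac{1+\delta}2},\qquad \phi_0(X)=|x_2|^{-\delta}.$$ For a weight $h>0$, $R>0$ and a function $u$ on $\mathbf R^d$ put $$|u|_{0;h}=\sup_X\frac{|u(X)|}{h(X)},\qquad [u]_{\alpha;h}=\sup_{X\ne Y}\frac{|u(X)-u(Y)|}{(h(X)+h(Y))|X-Y|^\alpha},\qquad |u|_{0,\alpha;h}=|u|_{0;h}+[u]_{\alpha;h},$$ $$|u|_{0,\alpha;h,R}=|u|_{0;h}+R^\alpha[u]_{\alpha;h},\qquad |u|_{1,\alpha;h,R}=|u|_{0,\alpha;h}+\max(R,R^{1-\alpha})\,|\nabla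 u|_{0,\alpha;h,R}.$$ Let $R_i=\partial_i(-\Delta)^{-1/2}$ be the Riesz transforms; $R_iR_j=\partial_i\partial_j(-\Delta)^{-1}$ is understood as the singular integral operator $$R_iR_jg(X)=-\,\mathrm{p.v.}\!\int_{\mathbf R^d}\partial_i\partial_jN(X-Y)\,g(Y)\,dY-\frac{\delta_{ij}}{d}\,g(X),$$ where $N$ is the Newton potential, $\Delta N=\delta_0$, and $[u,R_iR_j]g=u\,R_iR_jg-R_iR_j(ug)$. Then there is a constant $C$ depending only on $d,\alpha,\delta$ such that for all $\mu_1>0$, $t>0$, all $i,j,k\in\{1,\dots,d\}$ and either choice of the sign $\pm$ (the same in all places) the following holds for real-valued functions $u,w$ on $\mathbf R^d$. (1) If $u,w$ are differentiable with $|u|_{1,\alpha;f_\pm(t),(1+\mu_1t)^{1/2}}<\infty$ and $|w|_{1,\alpha;f_1(t),(\mu_1t)^{1/2}}<\infty$, then the principal values defining $R_iR_j\partial_kw$ and $R_iR_j(u\,\partial_kw)$ exist at every point, $[u,R_iR_j]\partial_kw$ is differentiable, and $$\big|[u,R_iR_j]\partial_kw\big|_{1,\alpha;f_\pm(t),(\mu_1t)^{1/2}}\le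 C\,|u|_{1,\alpha;f_\pm(t),(1+\mu_1t)^{1/2}}\,|w|_{1,\alpha;f_1(t),(\mu_1t)^{1/2}} .$$ (2) If $|u|_{0,\alpha;f_1(t),(\mu_1t)^{1/2}}<\infty$ and $|w|_{0,\alpha;f_1(t),(\mu_1t)^{1/2}}<\infty$, then the principal value defining $R_iR_j(uw)$ exists at every point and $$|R_iR_j(uw)|_{0,\alpha;f_1(t)}\le C(1+\mu_1t)^{-\frac\delta2}\big(1+(\mu_1t)^{-\frac\alpha2}\big)|u|_{0,\alpha;f_1(t),(\mu_1t)^{1/2}}\,|w|_{0,\alpha;f_1(t),(\mu_1t)^{1/2}} .$$ -/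

import Mathlib

open MeasureTheory Filter Topology
open scoped ENNReal NNReal

namespace WeightedRiesz

noncomputable section

/-- The space `ℝ^d` with `d = n + 2`, so that exactly the dimensions `d ≥ 2` occur. The coordinates
`x_1, x_2` of a point `X` are `X 0, X 1`. -/
abbrev Space (n : ℕ) : Type := EuclideanSpace ℝ (Fin (n + 2))

/-- The `k`-th vector of the standard basis. -/
def basisVec {n : ℕ} (k : Fin (n + 2)) : Space n := EuclideanSpace.single k (1 : ℝ)

/-- The partial derivative `∂_k w`. -/
def partialDeriv {n : ℕ} (k : Fin (n + 2)) (w : Space n → ℝ) (X : Space n) : ℝ :=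
  fderiv ℝ w X (basisVec k)

/-! ### The weight functions -/

/-- The heat operator `H(s)`, `s > 0`:
`H(s) φ (X) = (4 π s)^{-d/2} ∫ exp(-|X - Y|² / (4 s)) φ(Y) dY`. -/
def heatOp {n : ℕ} (s : ℝ) (φ : Space n → ℝ) (X : Space n) : ℝ :=
  (4 * Real.pi * s) ^ (-(((n : ℝ) + 2) / 2)) *
    ∫ Y : Space n, Real.exp (-(‖X - Y‖ ^ 2 / (4 * s))) * φ Y

/-- `φ_0(X) = |x_2|^{-δ}`. -/
def phi0 {n : ℕ} (δ : ℝ) (X : Space n) : ℝ := |X 1| ^ (-δ)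

/-- `φ_1(X) = (x_1² + x_2²)^{-(1+δ)/2}`. -/
def phi1 {n : ℕ} (δ : ℝ) (X : Space n) : ℝ := (X 0 ^ 2 + X 1 ^ 2) ^ (-((1 + δ) / 2))

/-- `f(t) = H(1 + 2 μ₁ t) φ_1`. -/
def weightF {n : ℕ} (δ μ₁ t : ℝ) : Space n → ℝ := heatOp (1 + 2 * μ₁ * t) (phi1 δ)

/-- `f_1(t) = H(1 + 2 μ₁ t) φ_0`. -/
def weightF1 {n : ℕ} (δ μ₁ t : ℝ) : Space n → ℝ := heatOp (1 + 2 * μ₁ * t) (phi0 δ)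

/-- `f_±(t, X) = f(t, X ± t B_0)` with `B_0 = (1, 0, …, 0)`; the sign is `σ = 1` or `σ = -1`. -/
def weightFpm {n : ℕ} (σ δ μ₁ t : ℝ) (X : Space n) : ℝ :=
  weightF δ μ₁ t (X + (σ * t) • basisVec 0)

/-! ### Scaled weighted Hölder norms, with values in `[0, ∞]` -/

section Norms

variable {n : ℕ} {F : Type*} [NormedAddCommGroup F]

/-- `|u|_{0;h} = sup_X |u(X)| / h(X)`. -/
def supNorm (h : Space n → ℝ) (u : Space n → F) : ℝ≥0∞ :=
  ⨆ X, ENNReal.ofReal (‖u X‖ / h X)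

/-- `[u]_{α;h} = sup_{X,Y} |u(X) - u(Y)| / ((h(X) + h(Y)) |X - Y|^α)`
(the diagonal contributes `0`). -/
def holderSeminorm (α : ℝ) (h : Space n → ℝ) (u : Space n → F) : ℝ≥0∞ :=
  ⨆ X, ⨆ Y, ENNReal.ofReal (‖u X - u Y‖ / ((h X + h Y) * ‖X - Y‖ ^ α))

/-- `|u|_{0,α;h} = |u|_{0;h} + [u]_{α;h}`. -/
def norm0 (α : ℝ) (h : Space n → ℝ) (u : Space n → F) : ℝ≥0∞ :=
  supNorm h u + holderSeminorm α h u

/-- `|u|_{0,α;h,R} = |u|_{0;h} + R^α [u]_{α;h}`. -/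
def scaledNorm0 (α : ℝ) (h : Space n → ℝ) (R : ℝ) (u : Space n → F) : ℝ≥0∞ :=
  supNorm h u + ENNReal.ofReal (R ^ α) * holderSeminorm α h u

/-- `|u|_{1,α;h,R} = |u|_{0,α;h} + max(R, R^{1-α}) |∇u|_{0,α;h,R}`, for a differentiable `u`.
The operator norm of the derivative is the Euclidean norm of the gradient. -/
def scaledNorm1 (α : ℝ) (h : Space n → ℝ) (R : ℝ) (u : Space n → ℝ) : ℝ≥0∞ :=
  norm0 α h u + ENNReal.ofReal (max R (R ^ (1 - α))) * scaledNorm0 α h R (fderiv ℝ u)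

end Norms

/-! ### The operators `R_i R_j = ∂_i ∂_j (-Δ)^{-1}` and their commutators -/

/-- The area of the unit sphere of `ℝ^d`, that is `d` times the volume of the unit ball. -/
def sphereArea (n : ℕ) : ℝ :=
  ((n : ℝ) + 2) * (volume (Metric.ball (0 : Space n) 1)).toReal

/-- The Newton potential `N` of `ℝ^d`, normalised by `Δ N = δ_0`: `(2π)^{-1} log |X|` for `d = 2`
and `-|X|^{2-d} / ((d-2) |S^{d-1}|)` for `d ≥ 3`. -/
def newton {n : ℕ} (X : Space n) : ℝ :=
  if n = 0 then Real.log ‖X‖ / sphereArea n else -(1 / (n * sphereArea n * ‖X‖ ^ n))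

/-- The kernel `∂_i ∂_j N`. -/
def kernel {n : ℕ} (i j : Fin (n + 2)) (X : Space n) : ℝ :=
  partialDeriv i (partialDeriv j newton) X

/-- The truncated singular integral `∫_{|X - Y| > ε} ∂_i ∂_j N(X - Y) g(Y) dY`. -/
def truncated {n : ℕ} (i j : Fin (n + 2)) (g : Space n → ℝ) (X : Space n) (ε : ℝ) : ℝ :=
  ∫ Y in {Y : Space n | ε < ‖X - Y‖}, kernel i j (X - Y) * g Y

/-- The principal value `p.v. ∫ ∂_i ∂_j N(X - Y) g(Y) dY` makes sense at every point `X`: all the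
truncated integrals converge absolutely and have a finite limit as `ε → 0+`. -/
def PVExists {n : ℕ} (i j : Fin (n + 2)) (g : Space n → ℝ) : Prop :=
  ∀ X : Space n,
    (∀ ε : ℝ, 0 < ε →
      IntegrableOn (fun Y => kernel i j (X - Y) * g Y) {Y : Space n | ε < ‖X - Y‖}) ∧
    ∃ l : ℝ, Tendsto (truncated i j g X) (𝓝[>] 0) (𝓝 l)

/-- `R_i R_j g`, where `R_i = ∂_i (-Δ)^{-1/2}` is the Riesz transform, so that
`R_i R_j = ∂_i ∂_j (-Δ)^{-1}` is the Calderón–Zygmund operator with symbol `-ξ_i ξ_j / |ξ|²`: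
`R_i R_j g (X) = - p.v. ∫ ∂_i ∂_j N(X - Y) g(Y) dY - (δ_{ij} / d) g(X)`.
To be used for functions `g` with `PVExists i j g`. -/
def rieszRiesz {n : ℕ} (i j : Fin (n + 2)) (g : Space n → ℝ) (X : Space n) : ℝ :=
  -limUnder (𝓝[>] (0 : ℝ)) (truncated i j g X) -
    (if i = j then 1 / ((n : ℝ) + 2) else 0) * g X

/-- The commutator `[u, R_i R_j] g = u R_i R_j g - R_i R_j (u g)`. -/
def rieszCommutator {n : ℕ} (i j : Fin (n + 2)) (u g : Space n → ℝ) (X : Space n) : ℝ :=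
  u X * rieszRiesz i j g X - rieszRiesz i j (fun Y => u Y * g Y) X

end

end WeightedRiesz

open WeightedRiesz

/-!
The scales of the problem are `ρ = √(1 + μ₁ t) ≥ 1` and `R = √(μ₁ t) ≤ ρ`, and every singular
integral is cut into dyadic pieces of scale `τ = 2 ^ k`, `k ∈ ℤ`.

*The weights.* The heat flow at time `1 + 2 μ₁ t ~ ρ²` turns the singular weights `|x_2|^{-δ}` and
`(x_1² + x_2²)^{-(1+δ)/2}` into functions comparable to `(ρ + p)^{-a}`, where `p` is the distance to
the singular set (`exists_heatOp_comparable`). These model weights vary by at most a constant factor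
over distances `ρ`, and for `τ ≥ ρ` the average over a ball of radius `2 τ` of the product of `f_1`
with `f_±` or `f_1` is at most `C ρ^{-δ} (ρ/τ)^{δ/2}` times the value of `f_±`, respectively `f_1`,
at the centre (`exists_setIntegral_weight_le`).

*The pieces.* Away from the origin the kernel `∂_i ∂_j N` is smooth, homogeneous of degree `-d`, and
its integrals against radial functions vanish. Hence it is the sum of the `L¹`-normalised dilates of
one smooth compactly supported function of mean zero, `dyadicKernel i j`, and on Hölder functions
with enough decay the principal value exists and is the sum of the convolutions with these dilates
(`hasSum_scaleOp_and_tendsto_truncated`).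

*The commutator.* Up to the multiples of the identity, which cancel, `[u, R_i R_j] ∂_k w` is the sum
of the commutators of `u` with the dilates. For `τ ≤ ρ` each of them is estimated through the
smoothness of `u` and `w`, and for `τ ≥ ρ` through the averages of the weights, after integrating by
parts to remove the derivative from `w` (`CommData.exists_abs_commOp_le`). The derivative of a
commutator at scale `τ` is `τ⁻¹` times a commutator of the same kind, with a derivative of the
kernel, minus `∂_l u` times a piece of `R_i R_j ∂_k w`, so that the same bounds apply to the
gradient. All bounds have the form `A min ((τ/r)^a, (τ/r)^{-b})` with `a, b > 0` and therefore sum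
to `C A`; Hölder bounds follow by splitting the sum at `τ = |X - Y|`, with the size of the pieces
for small `τ` and their gradients for large `τ` (`exists_abs_sub_le_of_hasSum`). At distances
`|X - Y| ≥ ρ` they are consequences of the pointwise bounds.

*The product.* `R_i R_j (u w)` is treated in the same way, with `|u w| ≤ C f_1²` and the average of
`f_1²` (`ProductData.exists_rieszRiesz_estimate`). The factor `(ρ/R)^α ≤ 1 + R^{-α}` arises because
the Hölder norms of `u` and `w` are at the scale `R`, while the weight varies at the scale `ρ`.
-/

open MeasureTheory Filter Topology
open scoped ENNReal NNReal

namespace WeightedRiesz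

/-! ### Convolutions with products of negative powers of the coordinates -/

lemma rpow_neg_mul_rpow_neg_le_add {a b e p : ℝ} (ha : 0 < a) (hb : 0 < b) (he : 0 ≤ e)
    (hp : 0 ≤ p) : a ^ (-e) * b ^ (-p) ≤ a ^ (-(e + p)) + b ^ (-(e + p)) := by
  rcases le_total a b with hab | hab
  · have h1 : b ^ (-p) ≤ a ^ (-p) := Real.rpow_le_rpow_of_nonpos ha hab (by linarith)
    have h2 : a ^ (-(e + p)) = a ^ (-e) * a ^ (-p) := by rw [← Real.rpow_add ha]; ring_nf
    have h3 : 0 ≤ b ^ (-(e + p)) := by positivity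
    have h4 : 0 ≤ a ^ (-e) := by positivity
    nlinarith [mul_le_mul_of_nonneg_left h1 h4]
  · have h1 : a ^ (-e) ≤ b ^ (-e) := Real.rpow_le_rpow_of_nonpos hb hab (by linarith)
    have h2 : b ^ (-(e + p)) = b ^ (-e) * b ^ (-p) := by rw [← Real.rpow_add hb]; ring_nf
    have h3 : 0 ≤ a ^ (-(e + p)) := by positivity
    have h4 : 0 ≤ b ^ (-p) := by positivity
    nlinarith [mul_le_mul_of_nonneg_right h1 h4]

lemma integrable_one_add_abs_rpow {q : ℝ} (hq : 1 < q) :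
    Integrable (fun y : ℝ => (1 + |y|) ^ (-q)) := by
  have := integrable_one_add_norm (E := ℝ) (μ := volume) (r := q) (by simpa using hq)
  simpa [Real.norm_eq_abs] using this

lemma integrable_indicator_abs_rpow {p : ℝ} (hp : p < 1) :
    Integrable (Set.indicator (Set.Icc (-1 : ℝ) 1) fun y : ℝ => |y| ^ (-p)) := by
  rw [integrable_indicator_iff measurableSet_Icc, integrableOn_Icc_iff_integrableOn_Ioc,
    ← intervalIntegrable_iff_integrableOn_Ioc_of_le (by norm_num)]
  have h : IntervalIntegrable (fun y : ℝ => |y| ^ (-p)) volume 0 1 := by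
    refine (intervalIntegral.intervalIntegrable_rpow' (r := -p) (by linarith)).congr ?_
    intro y hy
    rw [Set.uIoc_of_le zero_le_one] at hy
    simp only [abs_of_pos hy.1]
  have h' : IntervalIntegrable (fun y : ℝ => |y| ^ (-p)) volume (-1) 0 := by
    have := h.comp_mul_left (c := -1)
    simp only [neg_mul, one_mul, abs_neg] at this
    simpa using this.symm
  exact h'.trans h

/-- A convolution estimate on the line, uniform in the position of the two singularities and exact
in the scale `L`. -/
lemma exists_integral_rpow_mul_rpow_le (e p : ℝ) (he : 0 ≤ e) (hp0 : 0 ≤ p) (hp1 : p < 1)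
    (h : 1 < e + p) : ∃ C : ℝ, 0 ≤ C ∧ ∀ L x c : ℝ, 0 < L →
      Integrable (fun y : ℝ => (L + |x - y|) ^ (-e) * |y + c| ^ (-p)) ∧
      ∫ y : ℝ, (L + |x - y|) ^ (-e) * |y + c| ^ (-p) ≤ C * L ^ (1 - e - p) := by
  -- by translation and scaling it suffices to take `L = 1` and `c = 0`
  set A : ℝ → ℝ := Set.indicator (Set.Icc (-1 : ℝ) 1) fun y : ℝ => |y| ^ (-p) with hA
  set B : ℝ → ℝ := fun y => (1 + |y|) ^ (-(e + p)) with hB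
  have hAi : Integrable A := integrable_indicator_abs_rpow hp1
  have hBi : Integrable B := integrable_one_add_abs_rpow h
  have hA0 : ∀ y, 0 ≤ A y := fun y => Set.indicator_nonneg (fun y _ => by positivity) y
  have hB0 : ∀ y, 0 ≤ B y := fun y => by positivity
  have key : ∀ x y : ℝ, (1 + |x - y|) ^ (-e) * |y| ^ (-p) ≤
      A y + 2 ^ p * (B (y - x) + B y) := by
    intro x y
    have h0 : 0 ≤ (2 : ℝ) ^ p * (B (y - x) + B y) := by
      have := hB0 (y - x); have := hB0 y; positivity
    by_cases hy : y ∈ Set.Icc (-1 : ℝ) 1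
    · have h1 : (1 + |x - y|) ^ (-e) ≤ 1 :=
        Real.rpow_le_one_of_one_le_of_nonpos (by linarith [abs_nonneg (x - y)]) (by linarith)
      have h2 : A y = |y| ^ (-p) := Set.indicator_of_mem hy _
      have h3 : 0 ≤ |y| ^ (-p) := by positivity
      nlinarith
    · have hy1 : 1 < |y| := by
        by_contra hc
        exact hy (abs_le.1 (not_lt.1 hc))
      have h1 : |y| ^ (-p) ≤ 2 ^ p * (1 + |y|) ^ (-p) := by
        calc |y| ^ (-p) ≤ ((1 + |y|) / 2) ^ (-p) :=
              Real.rpow_le_rpow_of_nonpos (by positivity) (by linarith) (by linarith)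
          _ = 2 ^ p * (1 + |y|) ^ (-p) := by
              rw [Real.div_rpow (by positivity) (by norm_num), Real.rpow_neg (by norm_num : (0:ℝ) ≤ 2)]
              field_simp
      have h2 := rpow_neg_mul_rpow_neg_le_add (a := 1 + |x - y|) (b := 1 + |y|)
        (by positivity) (by positivity) he hp0
      have h3 : B (y - x) = (1 + |x - y|) ^ (-(e + p)) := by rw [hB]; simp only [abs_sub_comm]
      have h4 : 0 ≤ (1 + |x - y|) ^ (-e) := by positivity
      calc _ ≤ (1 + |x - y|) ^ (-e) * (2 ^ p * (1 + |y|) ^ (-p)) := by gcongr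
        _ = 2 ^ p * ((1 + |x - y|) ^ (-e) * (1 + |y|) ^ (-p)) := by ring
        _ ≤ 2 ^ p * (B (y - x) + B y) := by rw [h3]; gcongr
        _ ≤ _ := by linarith [hA0 y]
  set C := (∫ y, A y) + 2 ^ p * (2 * ∫ y, B y) with hC
  have hdom : ∀ x, Integrable fun y => A y + 2 ^ p * (B (y - x) + B y) := fun x =>
    hAi.add (((hBi.comp_sub_right x).add hBi).const_mul _)
  have hunit : ∀ x, Integrable (fun y : ℝ => (1 + |x - y|) ^ (-e) * |y| ^ (-p)) ∧
      ∫ y : ℝ, (1 + |x - y|) ^ (-e) * |y| ^ (-p) ≤ C := by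
    intro x
    have hi : Integrable (fun y : ℝ => (1 + |x - y|) ^ (-e) * |y| ^ (-p)) := by
      refine (hdom x).mono' (by fun_prop) (Eventually.of_forall fun y => ?_)
      rw [Real.norm_of_nonneg (by positivity)]
      exact key x y
    refine ⟨hi, (integral_mono hi (hdom x) (key x)).trans (le_of_eq ?_)⟩
    have hs : Integrable fun y => B (y - x) + B y := (hBi.comp_sub_right x).add hBi
    rw [integral_add hAi (hs.const_mul _), integral_const_mul,
      integral_add (hBi.comp_sub_right x) hBi, integral_sub_right_eq_self B x, hC]
    ring
  have hC0 : 0 ≤ C := by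
    have h1 : 0 ≤ ∫ y, A y := integral_nonneg hA0
    have h2 : 0 ≤ ∫ y, B y := integral_nonneg hB0
    positivity
  refine ⟨C, hC0, fun L x c hL => ?_⟩
  obtain ⟨h1, h2⟩ := hunit ((x + c) / L)
  set F : ℝ → ℝ := fun z => (1 + |(x + c) / L - z|) ^ (-e) * |z| ^ (-p) with hF
  have hEq : (fun y : ℝ => (L + |x - y|) ^ (-e) * |y + c| ^ (-p)) =
      fun y => L ^ (-e - p) * F ((y + c) / L) := by
    funext y
    have e1 : L + |x - y| = L * (1 + |(x + c) / L - (y + c) / L|) := by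
      rw [← sub_div, abs_div, abs_of_pos hL]; field_simp; ring_nf
    have e2 : |y + c| = L * |(y + c) / L| := by
      rw [abs_div, abs_of_pos hL]; field_simp
    rw [e1, e2, Real.mul_rpow hL.le (by positivity), Real.mul_rpow hL.le (by positivity), hF,
      sub_eq_add_neg (-e) p, Real.rpow_add hL]
    ring
  rw [hEq]
  refine ⟨((h1.comp_div hL.ne').comp_add_right c).const_mul _, ?_⟩
  rw [integral_const_mul, integral_add_right_eq_self (fun y => F (y / L)) c,
    Measure.integral_comp_div F L, abs_of_pos hL, smul_eq_mul]
  have : L ^ (1 - e - p) = L ^ (-e - p) * L := by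
    rw [show 1 - e - p = (-e - p) + 1 by ring, Real.rpow_add_one hL.ne']
  rw [this]
  have : 0 ≤ L ^ (-e - p) * L := by positivity
  nlinarith

/-- Convolution of `(L + |·|)^{-D}` with a product of negative powers of the coordinates: the
kernel is bounded by a product of one-dimensional kernels. -/
lemma exists_integral_kernel_mul_prod_le {n : ℕ} (p : Fin (n + 2) → ℝ) (D : ℝ)
    (hp0 : ∀ i, 0 ≤ p i) (hp1 : ∀ i, p i < 1) (hD : (n : ℝ) + 2 < D + ∑ i, p i) :
    ∃ C : ℝ, 0 ≤ C ∧ ∀ (L : ℝ) (X c : Space n), 0 < L →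
      Integrable (fun Y : Space n => (L + ‖X - Y‖) ^ (-D) * ∏ i, |Y i + c i| ^ (-p i)) ∧
      ∫ Y : Space n, (L + ‖X - Y‖) ^ (-D) * ∏ i, |Y i + c i| ^ (-p i) ≤
        C * L ^ ((n : ℝ) + 2 - D - ∑ i, p i) := by
  -- `D` is distributed over the coordinates so that each one-dimensional kernel is integrable
  set η : ℝ := (D + ∑ i, p i - (n + 2)) / (n + 2) with hη
  have hn : (0 : ℝ) < n + 2 := by positivity
  have hη0 : 0 < η := div_pos (by linarith) hn
  set e : Fin (n + 2) → ℝ := fun i => 1 - p i + η with he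
  have he0 : ∀ i, 0 ≤ e i := fun i => by have := hp1 i; simp only [he]; linarith
  have hsum : ∑ i, e i = D := by
    simp only [he, Finset.sum_add_distrib, Finset.sum_sub_distrib, Finset.sum_const,
      Finset.card_univ, Fintype.card_fin, nsmul_eq_mul, mul_one]
    push_cast
    rw [hη]; field_simp; ring
  choose C hC0 hC using fun i => exists_integral_rpow_mul_rpow_le (e i) (p i) (he0 i) (hp0 i)
    (hp1 i) (by simp only [he]; linarith)
  refine ⟨∏ i, C i, Finset.prod_nonneg fun i _ => hC0 i, fun L X c hL => ?_⟩
  set g : Fin (n + 2) → ℝ → ℝ := fun i y => (L + |X i - y|) ^ (-e i) * |y + c i| ^ (-p i) with hg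
  have hgi : Integrable (fun y : Fin (n + 2) → ℝ => ∏ i, g i (y i)) :=
    Integrable.fintype_prod fun i => (hC i L (X i) (c i) hL).1
  have hgi' : Integrable (fun Y : Space n => ∏ i, g i (Y i)) :=
    (PiLp.volume_preserving_ofLp (Fin (n + 2))).integrable_comp_of_integrable hgi
  have hint : ∫ Y : Space n, ∏ i, g i (Y i) = ∏ i, ∫ y, g i y := by
    rw [← integral_fintype_prod_volume_eq_prod]
    exact (PiLp.volume_preserving_ofLp (Fin (n + 2))).integral_comp
      (MeasurableEquiv.toLp 2 (Fin (n + 2) → ℝ)).symm.measurableEmbedding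
      (fun y => ∏ i, g i (y i))
  have hle : ∀ Y : Space n, (L + ‖X - Y‖) ^ (-D) * ∏ i, |Y i + c i| ^ (-p i) ≤
      ∏ i, g i (Y i) := by
    intro Y
    have h1 : (L + ‖X - Y‖) ^ (-D) ≤ ∏ i, (L + |X i - Y i|) ^ (-e i) := by
      rw [← hsum, ← Finset.sum_neg_distrib, Real.rpow_sum_of_pos (by positivity)]
      refine Finset.prod_le_prod (fun i _ => by positivity) fun i _ => ?_
      refine Real.rpow_le_rpow_of_nonpos (by positivity) ?_ (by linarith [he0 i])
      have := PiLp.norm_apply_le (X - Y) i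
      simpa using this
    simp only [hg, Finset.prod_mul_distrib]
    exact mul_le_mul_of_nonneg_right h1 (Finset.prod_nonneg fun i _ => by positivity)
  have hnn : ∀ Y : Space n, 0 ≤ (L + ‖X - Y‖) ^ (-D) * ∏ i, |Y i + c i| ^ (-p i) := fun Y =>
    mul_nonneg (by positivity) (Finset.prod_nonneg fun i _ => by positivity)
  have hi : Integrable (fun Y : Space n => (L + ‖X - Y‖) ^ (-D) * ∏ i, |Y i + c i| ^ (-p i)) := by
    refine hgi'.mono' ?_ (Eventually.of_forall fun Y => ?_)
    · refine Measurable.aestronglyMeasurable ?_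
      refine Measurable.mul (by fun_prop) (Finset.measurable_prod _ fun i _ => ?_)
      fun_prop
    · rw [Real.norm_of_nonneg (hnn Y)]; exact hle Y
  refine ⟨hi, (integral_mono hi hgi' hle).trans ?_⟩
  rw [hint]
  calc ∏ i, ∫ y, g i y ≤ ∏ i, (C i * L ^ (1 - e i - p i)) :=
        Finset.prod_le_prod (fun i _ => integral_nonneg fun y => by positivity)
          fun i _ => (hC i L (X i) (c i) hL).2
    _ = (∏ i, C i) * L ^ ((n : ℝ) + 2 - D - ∑ i, p i) := by
        rw [Finset.prod_mul_distrib, ← Real.rpow_sum_of_pos hL]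
        congr 2
        simp only [Finset.sum_sub_distrib, hsum]
        simp

/-! ### The model weights -/

/-- The weight `(ρ + p)^{-a}`, where `p ≥ 0` is a `1`-Lipschitz function, in practice the distance
to a subspace. -/
noncomputable def modelWeight {n : ℕ} (p : Space n → ℝ) (a ρ : ℝ) (X : Space n) : ℝ :=
  (ρ + p X) ^ (-a)

/-- Nonnegative functions with Lipschitz constant `1`. -/
structure IsDistLike {n : ℕ} (p : Space n → ℝ) : Prop where
  nonneg : ∀ X, 0 ≤ p X
  le_add : ∀ X Y, p X ≤ p Y + ‖X - Y‖
  measurable : Measurable p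

section Model

variable {n : ℕ} {p : Space n → ℝ} {a ρ : ℝ}

lemma modelWeight_pos (hp : IsDistLike p) (hρ : 0 < ρ) (X : Space n) :
    0 < modelWeight p a ρ X :=
  Real.rpow_pos_of_pos (by linarith [hp.nonneg X]) _

lemma measurable_modelWeight (hp : IsDistLike p) : Measurable (modelWeight p a ρ) := by
  have := hp.measurable
  unfold modelWeight
  fun_prop

lemma modelWeight_le (hp : IsDistLike p) (ha : 0 ≤ a) (hρ : 0 < ρ) (X : Space n) :
    modelWeight p a ρ X ≤ ρ ^ (-a) :=
  Real.rpow_le_rpow_of_nonpos hρ (by linarith [hp.nonneg X]) (by linarith)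

lemma modelWeight_le_one (hp : IsDistLike p) (ha : 0 ≤ a) (hρ : 1 ≤ ρ) (X : Space n) :
    modelWeight p a ρ X ≤ 1 :=
  Real.rpow_le_one_of_one_le_of_nonpos (by linarith [hp.nonneg X]) (by linarith)

lemma rpow_neg_le_of_le_mul {x y c : ℝ} (hx : 0 < x) (hc : 0 < c) (ha : 0 ≤ a) (h : x ≤ c * y) :
    y ^ (-a) ≤ c ^ a * x ^ (-a) := by
  have hy : 0 < y := by
    by_contra hy
    nlinarith [not_lt.1 hy]
  calc y ^ (-a) ≤ (x / c) ^ (-a) :=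
        Real.rpow_le_rpow_of_nonpos (by positivity) (by rw [div_le_iff₀ hc]; linarith) (by linarith)
    _ = c ^ a * x ^ (-a) := by
        rw [Real.div_rpow hx.le hc.le, Real.rpow_neg hc.le]
        field_simp

/-- The weight is slowly varying at the scale `ρ`. -/
lemma modelWeight_le_of_near (hp : IsDistLike p) (ha : 0 ≤ a) (hρ : 0 < ρ) {X Y : Space n}
    (h : ‖X - Y‖ ≤ 2 * ρ) : modelWeight p a ρ Y ≤ 3 ^ a * modelWeight p a ρ X :=
  rpow_neg_le_of_le_mul (by linarith [hp.nonneg X]) (by norm_num) ha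
    (by linarith [hp.le_add X Y, hp.nonneg Y])

/-- Either `p Y` is at least half of `ρ + p X`, or `Y` is at distance at least comparable to
`ρ + p X` from `X`, up to `ρ`. -/
lemma half_le_or_add_le (hp : IsDistLike p) (hρ : 0 < ρ) (X Y : Space n) :
    (ρ + p X) ≤ 2 * p Y ∨ (ρ + p X) + ‖X - Y‖ ≤ 3 * (ρ + ‖X - Y‖) := by
  by_cases h : (ρ + p X) ≤ 2 * p Y
  · exact Or.inl h
  · right
    linarith [hp.le_add X Y, norm_nonneg (X - Y)]

end Model

lemma ae_coord_ne {n : ℕ} (i : Fin (n + 2)) (c : ℝ) : ∀ᵐ Y : Space n, Y i ≠ c := by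
  have h : ∀ᵐ y : Fin (n + 2) → ℝ, y i ≠ c := by
    rw [ae_iff]
    simpa [volume_pi] using
      Measure.pi_hyperplane (fun _ : Fin (n + 2) => (volume : Measure ℝ)) i c
  exact (PiLp.volume_preserving_ofLp (Fin (n + 2))).quasiMeasurePreserving.ae h

/-- The exponents `(p₀, p₁, 0, …, 0)`. -/
def twoExponents (n : ℕ) (p₀ p₁ : ℝ) : Fin (n + 2) → ℝ :=
  Fin.cons p₀ (Fin.cons p₁ fun _ => 0)

lemma sum_twoExponents (n : ℕ) (p₀ p₁ : ℝ) : ∑ i, twoExponents n p₀ p₁ i = p₀ + p₁ := by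
  simp [twoExponents, Fin.sum_univ_succ]

lemma prod_twoExponents (n : ℕ) (p₀ p₁ : ℝ) (Y : Fin (n + 2) → ℝ) :
    ∏ i, |Y i| ^ (-twoExponents n p₀ p₁ i) = |Y 0| ^ (-p₀) * |Y 1| ^ (-p₁) := by
  simp [twoExponents, Fin.prod_univ_succ]

lemma forall_twoExponents {n : ℕ} {p₀ p₁ : ℝ} {P : ℝ → Prop} (h0 : P p₀) (h1 : P p₁) (h : P 0)
    (i : Fin (n + 2)) : P (twoExponents n p₀ p₁ i) := by
  refine Fin.cases h0 (fun i => Fin.cases h1 (fun i => ?_) i) i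
  simpa [twoExponents] using h

/-- `exists_integral_kernel_mul_prod_le` for two coordinates. -/
lemma exists_integral_kernel_mul_le (n : ℕ) (p₀ p₁ D : ℝ) (h0 : 0 ≤ p₀) (h0' : p₀ < 1)
    (h1 : 0 ≤ p₁) (h1' : p₁ < 1) (hD : (n : ℝ) + 2 < D + (p₀ + p₁)) :
    ∃ C : ℝ, 0 ≤ C ∧ ∀ (L : ℝ) (X c : Space n), 0 < L →
      Integrable (fun Y : Space n =>
        (L + ‖X - Y‖) ^ (-D) * (|Y 0 + c 0| ^ (-p₀) * |Y 1 + c 1| ^ (-p₁))) ∧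
      ∫ Y : Space n, (L + ‖X - Y‖) ^ (-D) * (|Y 0 + c 0| ^ (-p₀) * |Y 1 + c 1| ^ (-p₁)) ≤
        C * L ^ ((n : ℝ) + 2 - D - (p₀ + p₁)) := by
  obtain ⟨C, hC0, hC⟩ := exists_integral_kernel_mul_prod_le (twoExponents n p₀ p₁) D
    (forall_twoExponents h0 h1 le_rfl)
    (forall_twoExponents (P := fun x => x < 1) h0' h1' zero_lt_one)
    (by rwa [sum_twoExponents])
  refine ⟨C, hC0, fun L X c hL => ?_⟩
  have := hC L X c hL
  simp only [sum_twoExponents] at this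
  simpa only [prod_twoExponents n p₀ p₁ (fun i => _ + c i)] using this

lemma exists_integral_kernel_le (n : ℕ) (D : ℝ) (hD : (n : ℝ) + 2 < D) :
    ∃ C : ℝ, 0 ≤ C ∧ ∀ (L : ℝ) (X : Space n), 0 < L →
      Integrable (fun Y : Space n => (L + ‖X - Y‖) ^ (-D)) ∧
      ∫ Y : Space n, (L + ‖X - Y‖) ^ (-D) ≤ C * L ^ ((n : ℝ) + 2 - D) := by
  obtain ⟨C, hC0, hC⟩ := exists_integral_kernel_mul_le n 0 0 D le_rfl zero_lt_one le_rfl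
    zero_lt_one (by linarith)
  refine ⟨C, hC0, fun L X hL => ?_⟩
  simpa using hC L X 0 hL

/-! ### The heat flow of a power of a distance -/

section Heat

variable {n : ℕ}

lemma heatKernel_le {ρ s r : ℝ} (hρ : 0 < ρ) (hs : ρ ^ 2 ≤ s) (hs' : s ≤ 2 * ρ ^ 2) (hr : 0 ≤ r) :
    (4 * Real.pi * s) ^ (-(((n : ℝ) + 2) / 2)) * Real.exp (-(r ^ 2 / (4 * s))) ≤
      ((n + 3).factorial * Real.exp 3) * (ρ * (ρ + r) ^ (-((n : ℝ) + 3))) := by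
  have hs0 : 0 < s := lt_of_lt_of_le (by positivity) hs
  set q := r / ρ with hq
  have hq0 : 0 ≤ q := by positivity
  have h1 : (4 * Real.pi * s) ^ (-(((n : ℝ) + 2) / 2)) ≤ ρ ^ (-((n : ℝ) + 2)) := by
    calc (4 * Real.pi * s) ^ (-(((n : ℝ) + 2) / 2)) ≤ (ρ ^ 2) ^ (-(((n : ℝ) + 2) / 2)) := by
          refine Real.rpow_le_rpow_of_nonpos (by positivity) ?_ ?_
          · nlinarith [Real.pi_gt_three]
          · have : (0 : ℝ) ≤ ((n : ℝ) + 2) / 2 := by positivity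
            linarith
      _ = ρ ^ (-((n : ℝ) + 2)) := by
          rw [← Real.rpow_natCast, ← Real.rpow_mul hρ.le]
          congr 1
          push_cast; ring
  have h2 : Real.exp (-(r ^ 2 / (4 * s))) ≤ Real.exp (-(q ^ 2 / 8)) := by
    rw [Real.exp_le_exp, neg_le_neg_iff, hq, div_pow, div_div]
    exact div_le_div_of_nonneg_left (by positivity) (by positivity) (by linarith)
  have h3 : Real.exp (-(q ^ 2 / 8)) ≤ ((n + 3).factorial * Real.exp 3) *
      (1 + q) ^ (-((n : ℝ) + 3)) := by
    have e1 : (1 + q) ^ (n + 3) / (n + 3).factorial ≤ Real.exp (1 + q) :=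
      Real.pow_div_factorial_le_exp _ (by positivity) _
    have e2 : (1 + q) ^ (-((n : ℝ) + 3)) = ((1 + q) ^ (n + 3))⁻¹ := by
      rw [Real.rpow_neg (by positivity)]
      congr 1
      exact_mod_cast Real.rpow_natCast (1 + q) (n + 3)
    rw [e2, ← div_eq_mul_inv, le_div_iff₀ (by positivity)]
    rw [div_le_iff₀ (by positivity)] at e1
    calc Real.exp (-(q ^ 2 / 8)) * (1 + q) ^ (n + 3)
        ≤ Real.exp (-(q ^ 2 / 8)) * (Real.exp (1 + q) * (n + 3).factorial) := by gcongr
      _ = (n + 3).factorial * Real.exp (-(q ^ 2 / 8) + (1 + q)) := by rw [Real.exp_add (-(q ^ 2 / 8)) (1 + q)]; ac_rfl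
      _ ≤ (n + 3).factorial * Real.exp 3 := by
          gcongr
          nlinarith [sq_nonneg (q - 4)]
  have h4 : ρ * (ρ + r) ^ (-((n : ℝ) + 3)) = ρ ^ (-((n : ℝ) + 2)) * (1 + q) ^ (-((n : ℝ) + 3)) := by
    have : ρ + r = ρ * (1 + q) := by rw [hq]; field_simp
    rw [this, Real.mul_rpow hρ.le (by positivity), ← mul_assoc]
    congr 1
    rw [show -((n : ℝ) + 2) = 1 + -((n : ℝ) + 3) by ring, Real.rpow_add hρ, Real.rpow_one]
  rw [h4]
  calc _ ≤ ρ ^ (-((n : ℝ) + 2)) * (((n + 3).factorial * Real.exp 3) *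
      (1 + q) ^ (-((n : ℝ) + 3))) := by
        gcongr
        exact h2.trans h3
    _ = _ := by ring

lemma le_heatKernel {ρ s r : ℝ} (hρ : 0 < ρ) (hs : ρ ^ 2 ≤ s) (hs' : s ≤ 2 * ρ ^ 2) (hr : 0 ≤ r)
    (hr' : r ≤ ρ) : (8 * Real.pi) ^ (-(((n : ℝ) + 2) / 2)) * Real.exp (-1) * ρ ^ (-((n : ℝ) + 2)) ≤
      (4 * Real.pi * s) ^ (-(((n : ℝ) + 2) / 2)) * Real.exp (-(r ^ 2 / (4 * s))) := by
  have hs0 : 0 < s := lt_of_lt_of_le (by positivity) hs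
  have hpi := Real.pi_pos
  have h1 : (8 * Real.pi) ^ (-(((n : ℝ) + 2) / 2)) * ρ ^ (-((n : ℝ) + 2)) ≤
      (4 * Real.pi * s) ^ (-(((n : ℝ) + 2) / 2)) := by
    calc _ = (8 * Real.pi * ρ ^ 2) ^ (-(((n : ℝ) + 2) / 2)) := by
          rw [Real.mul_rpow (by positivity : (0 : ℝ) ≤ 8 * Real.pi) (sq_nonneg ρ),
            ← Real.rpow_natCast ρ 2, ← Real.rpow_mul hρ.le]
          congr 2
          push_cast; ring
      _ ≤ _ := by
          refine Real.rpow_le_rpow_of_nonpos (by positivity) ?_ ?_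
          · nlinarith
          · have : (0 : ℝ) ≤ ((n : ℝ) + 2) / 2 := by positivity
            linarith
  have h2 : Real.exp (-1) ≤ Real.exp (-(r ^ 2 / (4 * s))) := by
    rw [Real.exp_le_exp, neg_le_neg_iff, div_le_one (by positivity)]
    nlinarith
  calc _ = (8 * Real.pi) ^ (-(((n : ℝ) + 2) / 2)) * ρ ^ (-((n : ℝ) + 2)) * Real.exp (-1) := by ring
    _ ≤ _ := by gcongr

/-- The heat flow at time `s ~ ρ²` turns the singular weight `p^{-a}` into a function comparable to
`(ρ + p)^{-a}`. -/
lemma exists_heatOp_comparable {p : Space n → ℝ} (hp : IsDistLike p) {a p₀ p₁ : ℝ} (h0 : 0 ≤ p₀)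
    (h0' : p₀ < 1) (h1 : 0 ≤ p₁) (h1' : p₁ < 1) (ha : a = p₀ + p₁) {φ : Space n → ℝ}
    (hφ : ∀ X, φ X = p X ^ (-a)) (hpos : ∀ᵐ X, 0 < p X)
    (hle : ∀ᵐ X : Space n, φ X ≤ |X 0| ^ (-p₀) * |X 1| ^ (-p₁)) :
    ∃ c C : ℝ, 0 < c ∧ 0 < C ∧ ∀ ρ s : ℝ, 0 < ρ → ρ ^ 2 ≤ s → s ≤ 2 * ρ ^ 2 → ∀ X,
      c * modelWeight p a ρ X ≤ heatOp s φ X ∧ heatOp s φ X ≤ C * modelWeight p a ρ X := by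
  have ha0 : 0 ≤ a := by linarith
  obtain ⟨C₁, hC₁, H₁⟩ := exists_integral_kernel_le n (n + 3) (by linarith)
  obtain ⟨C₂, hC₂, H₂⟩ := exists_integral_kernel_mul_le n p₀ p₁ (n + 3) h0 h0' h1 h1'
    (by linarith)
  set G : ℝ := (n + 3).factorial * Real.exp 3 with hG
  have hG0 : 0 < G := by positivity
  set v : ℝ := (volume (Metric.ball (0 : Space n) 1)).toReal with hv
  have hv0 : 0 < v := ENNReal.toReal_pos (Metric.measure_ball_pos _ _ one_pos).ne'
    measure_ball_lt_top.ne
  have hpi := Real.pi_pos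
  set c : ℝ := (8 * Real.pi) ^ (-(((n : ℝ) + 2) / 2)) * Real.exp (-1) with hc
  have hc0 : 0 < c := by positivity
  have hφ0 : ∀ X, 0 ≤ φ X := fun X => by rw [hφ]; exact Real.rpow_nonneg (hp.nonneg X) _
  have hφm : Measurable φ := by
    have : φ = fun X => p X ^ (-a) := funext hφ
    rw [this]; have := hp.measurable; fun_prop
  refine ⟨c * v, G * (2 ^ a * C₁ + 3 ^ ((n : ℝ) + 3) * C₂) + 1, by positivity, by positivity,
    fun ρ s hρ hs hs' X => ?_⟩
  have hs0 : 0 < s := lt_of_lt_of_le (by positivity) hs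
  set L := ρ + p X with hL
  have hL0 : 0 < L := by have := hp.nonneg X; positivity
  set k : Space n → ℝ := fun Y => (4 * Real.pi * s) ^ (-(((n : ℝ) + 2) / 2)) *
    Real.exp (-(‖X - Y‖ ^ 2 / (4 * s))) with hk
  have hk0 : ∀ Y, 0 ≤ k Y := fun Y => by positivity
  have hheat : heatOp s φ X = ∫ Y, k Y * φ Y := by
    rw [heatOp, ← integral_const_mul]
    simp only [hk, mul_assoc]
  obtain ⟨I₁, J₁⟩ := H₁ ρ X hρ
  obtain ⟨I₂, J₂⟩ := H₂ L X 0 hL0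
  simp only [PiLp.zero_apply, add_zero] at I₂ J₂
  set dom : Space n → ℝ := fun Y => G * ((2 ^ a * L ^ (-a) * ρ) * (ρ + ‖X - Y‖) ^ (-((n : ℝ) + 3)) +
    (3 ^ ((n : ℝ) + 3) * L) * ((L + ‖X - Y‖) ^ (-((n : ℝ) + 3)) *
      (|Y 0| ^ (-p₀) * |Y 1| ^ (-p₁)))) with hdom
  have hdomi : Integrable dom := ((I₁.const_mul _).add (I₂.const_mul _)).const_mul _
  have hbound : ∀ᵐ Y, k Y * φ Y ≤ dom Y := by
    filter_upwards [hle, hpos] with Y hY hY0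
    have hkY : k Y ≤ G * (ρ * (ρ + ‖X - Y‖) ^ (-((n : ℝ) + 3))) :=
      heatKernel_le hρ hs hs' (norm_nonneg _)
    have e0 : 0 ≤ L ^ (-a) := by positivity
    have e1 : 0 ≤ (2 ^ a * L ^ (-a) * ρ) * (ρ + ‖X - Y‖) ^ (-((n : ℝ) + 3)) := by positivity
    have e2 : 0 ≤ (3 ^ ((n : ℝ) + 3) * L) * ((L + ‖X - Y‖) ^ (-((n : ℝ) + 3)) *
      (|Y 0| ^ (-p₀) * |Y 1| ^ (-p₁))) := by positivity
    refine (mul_le_mul_of_nonneg_right hkY (hφ0 Y)).trans ?_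
    rw [mul_assoc]
    refine mul_le_mul_of_nonneg_left ?_ hG0.le
    -- either the weight at `Y` is bounded by the one at `X`, or `Y` is so far from `X` that the
    -- kernel may be replaced by the one at the scale `ρ + p X`
    rcases half_le_or_add_le hp hρ X Y with h | h
    · have : φ Y ≤ 2 ^ a * L ^ (-a) := by
        rw [hφ]
        exact rpow_neg_le_of_le_mul hL0 (by norm_num) ha0 h
      calc _ ≤ ρ * (ρ + ‖X - Y‖) ^ (-((n : ℝ) + 3)) * (2 ^ a * L ^ (-a)) := by gcongr
        _ = (2 ^ a * L ^ (-a) * ρ) * (ρ + ‖X - Y‖) ^ (-((n : ℝ) + 3)) := by ring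
        _ ≤ _ := by linarith
    · have e3 : (ρ + ‖X - Y‖) ^ (-((n : ℝ) + 3)) ≤
          3 ^ ((n : ℝ) + 3) * (L + ‖X - Y‖) ^ (-((n : ℝ) + 3)) :=
        rpow_neg_le_of_le_mul (by positivity) (by norm_num) (by positivity) h
      have e4 : ρ ≤ L := by linarith [hp.nonneg X]
      calc _ ≤ L * (3 ^ ((n : ℝ) + 3) * (L + ‖X - Y‖) ^ (-((n : ℝ) + 3))) *
            (|Y 0| ^ (-p₀) * |Y 1| ^ (-p₁)) := by gcongr; exact hφ0 Y
        _ = (3 ^ ((n : ℝ) + 3) * L) * ((L + ‖X - Y‖) ^ (-((n : ℝ) + 3)) *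
              (|Y 0| ^ (-p₀) * |Y 1| ^ (-p₁))) := by ring
        _ ≤ _ := by linarith
  have hint : Integrable fun Y => k Y * φ Y := by
    refine hdomi.mono' (Measurable.aestronglyMeasurable (by simp only [hk]; fun_prop)) ?_
    filter_upwards [hbound] with Y hY
    rwa [Real.norm_of_nonneg (mul_nonneg (hk0 Y) (hφ0 Y))]
  rw [hheat]
  constructor
  · have hlow : ∀ᵐ Y ∂(volume.restrict (Metric.ball X ρ)),
        c * ρ ^ (-((n : ℝ) + 2)) * modelWeight p a ρ X ≤ k Y * φ Y := by
      rw [ae_restrict_iff' measurableSet_ball]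
      filter_upwards [hpos] with Y hY hYb
      have hd : ‖X - Y‖ ≤ ρ := by rw [← dist_eq_norm, dist_comm]; exact (Metric.mem_ball.1 hYb).le
      refine mul_le_mul (le_heatKernel hρ hs hs' (norm_nonneg _) hd) ?_
        (modelWeight_pos hp hρ X).le (hk0 Y)
      rw [hφ]
      refine Real.rpow_le_rpow_of_nonpos hY ?_ (by linarith)
      have := hp.le_add Y X
      rw [norm_sub_rev] at this
      linarith
    have hvol : (volume (Metric.ball X ρ)).toReal = ρ ^ (n + 2) * v := by
      rw [Measure.addHaar_ball _ _ hρ.le, ENNReal.toReal_mul,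
        ENNReal.toReal_ofReal (by positivity), finrank_euclideanSpace_fin]
    calc c * v * modelWeight p a ρ X
        = ∫ Y in Metric.ball X ρ, c * ρ ^ (-((n : ℝ) + 2)) * modelWeight p a ρ X := by
          rw [setIntegral_const, smul_eq_mul, measureReal_def, hvol]
          have : ρ ^ (n + 2) * ρ ^ (-((n : ℝ) + 2)) = 1 := by
            rw [← Real.rpow_natCast, ← Real.rpow_add hρ]
            push_cast
            simp
          linear_combination (-(c * v * modelWeight p a ρ X)) * this
      _ ≤ ∫ Y in Metric.ball X ρ, k Y * φ Y :=
          integral_mono_ae (integrableOn_const measure_ball_lt_top.ne) hint.integrableOn hlow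
      _ ≤ ∫ Y, k Y * φ Y :=
          setIntegral_le_integral hint (Eventually.of_forall fun Y => mul_nonneg (hk0 Y) (hφ0 Y))
  · refine (integral_mono_ae hint hdomi hbound).trans ?_
    rw [integral_const_mul, integral_add (I₁.const_mul _) (I₂.const_mul _), integral_const_mul,
      integral_const_mul]
    have e1 : 2 ^ a * L ^ (-a) * ρ * ∫ Y : Space n, (ρ + ‖X - Y‖) ^ (-((n : ℝ) + 3)) ≤
        2 ^ a * C₁ * L ^ (-a) := by
      have : (n : ℝ) + 2 - (n + 3) = -1 := by ring
      rw [this, Real.rpow_neg_one] at J₁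
      calc _ ≤ 2 ^ a * L ^ (-a) * ρ * (C₁ * ρ⁻¹) := by gcongr
        _ = _ := by field_simp
    have e2 : 3 ^ ((n : ℝ) + 3) * L * ∫ Y : Space n, (L + ‖X - Y‖) ^ (-((n : ℝ) + 3)) *
        (|Y 0| ^ (-p₀) * |Y 1| ^ (-p₁)) ≤ 3 ^ ((n : ℝ) + 3) * C₂ * L ^ (-a) := by
      have : (n : ℝ) + 2 - (n + 3) - (p₀ + p₁) = -1 + -a := by rw [ha]; ring
      rw [this, Real.rpow_add hL0, Real.rpow_neg_one] at J₂
      calc _ ≤ 3 ^ ((n : ℝ) + 3) * L * (C₂ * (L⁻¹ * L ^ (-a))) := by gcongr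
        _ = _ := by field_simp
    have e3 : modelWeight p a ρ X = L ^ (-a) := rfl
    have e4 : 0 ≤ L ^ (-a) := by positivity
    rw [e3]
    nlinarith [mul_le_mul_of_nonneg_left (add_le_add e1 e2) hG0.le]

end Heat

/-! ### Averages of products of weights -/

/-- On balls of radius `τ ≥ ρ` the averages of the product of a weight with a weight bounded by
`|x_2|^{-δ}` are small compared with the weight at the centre. -/
lemma exists_setIntegral_weight_le {n : ℕ} {δ a p₀ p₁ : ℝ} (hδ0 : 0 < δ) (hδ1 : δ < 1)
    (ha0 : 0 ≤ a) (h0 : 0 ≤ p₀) (h0' : p₀ < 1) (h1 : 0 ≤ p₁) (h1' : p₁ < 1)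
    (hap : a + δ = p₀ + p₁) : ∃ C : ℝ, 0 ≤ C ∧ ∀ (p p' : Space n → ℝ) (c : Space n) (ρ τ : ℝ),
      IsDistLike p → IsDistLike p' → 0 < ρ → ρ ≤ τ →
      (∀ᵐ Y : Space n, modelWeight p' δ ρ Y ≤ |Y 1| ^ (-δ)) →
      (∀ᵐ Y : Space n, modelWeight p a ρ Y * modelWeight p' δ ρ Y ≤
        |Y 0 + c 0| ^ (-p₀) * |Y 1 + c 1| ^ (-p₁)) → ∀ X,
      ∫ Y in Metric.closedBall X (2 * τ), modelWeight p a ρ Y * modelWeight p' δ ρ Y ≤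
        C * τ ^ (n + 2) * ρ ^ (-δ) * (ρ / τ) ^ (δ / 2) * modelWeight p a ρ X := by
  -- the indicator of the ball is replaced by a power slightly weaker than `-d`, which produces the
  -- gain `(ρ/τ)^{δ/2}`
  set D : ℝ := n + 2 - δ / 2 with hD
  have hD0 : 0 ≤ D := by have : (0 : ℝ) ≤ n := by positivity
                         linarith
  obtain ⟨C₁, hC₁, H₁⟩ := exists_integral_kernel_mul_le n 0 δ D le_rfl zero_lt_one hδ0.le hδ1
    (by linarith)
  obtain ⟨C₂, hC₂, H₂⟩ := exists_integral_kernel_mul_le n p₀ p₁ D h0 h0' h1 h1' (by linarith)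
  refine ⟨3 ^ D * (2 ^ a * C₁ + 3 ^ D * C₂), by positivity,
    fun p p' c ρ τ hp hp' hρ hρτ hm1 hmm X => ?_⟩
  have hτ : 0 < τ := hρ.trans_le hρτ
  set L := ρ + p X with hL
  have hρL : ρ ≤ L := by linarith [hp.nonneg X]
  have hL0 : 0 < L := by linarith
  set m := modelWeight p a ρ with hm
  set m1 := modelWeight p' δ ρ with hm1'
  have hmp : ∀ Y, 0 < m Y := modelWeight_pos hp hρ
  have hm1p : ∀ Y, 0 < m1 Y := modelWeight_pos hp' hρ
  obtain ⟨I₁, J₁⟩ := H₁ ρ X 0 hρ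
  obtain ⟨I₂, J₂⟩ := H₂ L X c hL0
  simp only [PiLp.zero_apply, add_zero, neg_zero, Real.rpow_zero, one_mul] at I₁ J₁
  set dom : Space n → ℝ := fun Y => (3 * τ) ^ D * ((2 ^ a * m X) * ((ρ + ‖X - Y‖) ^ (-D) *
    |Y 1| ^ (-δ)) + 3 ^ D * ((L + ‖X - Y‖) ^ (-D) *
      (|Y 0 + c 0| ^ (-p₀) * |Y 1 + c 1| ^ (-p₁)))) with hdom
  have hdomi : Integrable dom := ((I₁.const_mul _).add (I₂.const_mul _)).const_mul _
  have hdom0 : ∀ Y, 0 ≤ dom Y := fun Y => by have := hmp X; positivity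
  have hbound : ∀ᵐ Y ∂(volume.restrict (Metric.closedBall X (2 * τ))), m Y * m1 Y ≤ dom Y := by
    rw [ae_restrict_iff' measurableSet_closedBall]
    filter_upwards [hm1, hmm] with Y hY1 hY2 hYb
    have hd : ‖X - Y‖ ≤ 2 * τ := by rw [← dist_eq_norm, dist_comm]; exact hYb
    have e0 : 1 ≤ (3 * τ) ^ D * (ρ + ‖X - Y‖) ^ (-D) := by
      rw [Real.rpow_neg (by positivity), ← div_eq_mul_inv, one_le_div (by positivity)]
      exact Real.rpow_le_rpow (by positivity) (by linarith) hD0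
    have hmm0 : 0 ≤ m Y * m1 Y := (mul_pos (hmp Y) (hm1p Y)).le
    have e00 : m Y * m1 Y ≤ (3 * τ) ^ D * ((ρ + ‖X - Y‖) ^ (-D) * (m Y * m1 Y)) := by
      nlinarith
    refine e00.trans (mul_le_mul_of_nonneg_left ?_ (by positivity))
    have hmX := hmp X
    have e1 : 0 ≤ (2 ^ a * m X) * ((ρ + ‖X - Y‖) ^ (-D) * |Y 1| ^ (-δ)) := by positivity
    have e2 : 0 ≤ 3 ^ D * ((L + ‖X - Y‖) ^ (-D) *
      (|Y 0 + c 0| ^ (-p₀) * |Y 1 + c 1| ^ (-p₁))) := by positivity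
    -- either the weight at `Y` is bounded by the one at `X`, or `Y` is so far from `X` that the
    -- kernel may be replaced by the one at the scale `ρ + p X`
    rcases half_le_or_add_le hp hρ X Y with h | h
    · have : m Y ≤ 2 ^ a * m X :=
        rpow_neg_le_of_le_mul hL0 (by norm_num) ha0 (by linarith)
      calc _ ≤ (ρ + ‖X - Y‖) ^ (-D) * ((2 ^ a * m X) * |Y 1| ^ (-δ)) := by
            gcongr
            exact (hm1p Y).le
        _ = (2 ^ a * m X) * ((ρ + ‖X - Y‖) ^ (-D) * |Y 1| ^ (-δ)) := by ring
        _ ≤ _ := by linarith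
    · have e3 : (ρ + ‖X - Y‖) ^ (-D) ≤ 3 ^ D * (L + ‖X - Y‖) ^ (-D) :=
        rpow_neg_le_of_le_mul (by positivity) (by norm_num) hD0 h
      calc _ ≤ (3 ^ D * (L + ‖X - Y‖) ^ (-D)) *
            (|Y 0 + c 0| ^ (-p₀) * |Y 1 + c 1| ^ (-p₁)) := by gcongr
        _ = 3 ^ D * ((L + ‖X - Y‖) ^ (-D) *
            (|Y 0 + c 0| ^ (-p₀) * |Y 1 + c 1| ^ (-p₁))) := by ring
        _ ≤ _ := by linarith
  have hint : IntegrableOn (fun Y => m Y * m1 Y) (Metric.closedBall X (2 * τ)) := by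
    refine hdomi.integrableOn.mono' (Measurable.aestronglyMeasurable
      ((measurable_modelWeight hp).mul (measurable_modelWeight hp'))) ?_
    filter_upwards [hbound] with Y hY
    rwa [Real.norm_of_nonneg (mul_pos (hmp Y) (hm1p Y)).le]
  calc _ ≤ ∫ Y in Metric.closedBall X (2 * τ), dom Y :=
        integral_mono_ae hint hdomi.integrableOn hbound
    _ ≤ ∫ Y, dom Y := setIntegral_le_integral hdomi (Eventually.of_forall hdom0)
    _ = (3 * τ) ^ D * ((2 ^ a * m X) * (∫ Y : Space n, (ρ + ‖X - Y‖) ^ (-D) * |Y 1| ^ (-δ)) +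
          3 ^ D * ∫ Y : Space n, (L + ‖X - Y‖) ^ (-D) *
            (|Y 0 + c 0| ^ (-p₀) * |Y 1 + c 1| ^ (-p₁))) := by
        rw [integral_const_mul, integral_add (I₁.const_mul _) (I₂.const_mul _), integral_const_mul,
          integral_const_mul]
    _ ≤ (3 * τ) ^ D * ((2 ^ a * m X) * (C₁ * ρ ^ (-(δ / 2))) +
          3 ^ D * (C₂ * (m X * ρ ^ (-(δ / 2))))) := by
        have hmX := hmp X
        have e1 : (n : ℝ) + 2 - D - (0 + δ) = -(δ / 2) := by rw [hD]; ring
        have e2 : (n : ℝ) + 2 - D - (p₀ + p₁) = -a + -(δ / 2) := by rw [hD, ← hap]; ring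
        rw [e1] at J₁
        rw [e2, Real.rpow_add hL0] at J₂
        have e3 : L ^ (-(δ / 2)) ≤ ρ ^ (-(δ / 2)) :=
          Real.rpow_le_rpow_of_nonpos hρ hρL (by linarith)
        have e4 : L ^ (-a) = m X := rfl
        gcongr
        refine J₂.trans ?_
        rw [e4]
        gcongr
    _ = _ := by
        have e1 : (3 * τ) ^ D = 3 ^ D * (τ ^ (n + 2) * τ ^ (-(δ / 2))) := by
          rw [Real.mul_rpow (by norm_num) hτ.le, ← Real.rpow_natCast, ← Real.rpow_add hτ, hD]
          push_cast
          ring_nf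
        have e2 : ρ ^ (-δ) * (ρ / τ) ^ (δ / 2) = ρ ^ (-(δ / 2)) * τ ^ (-(δ / 2)) := by
          rw [Real.div_rpow hρ.le hτ.le, Real.rpow_neg hτ.le, div_eq_mul_inv, ← mul_assoc,
            ← Real.rpow_add hρ]
          ring_nf
        rw [e1]
        linear_combination (-(3 ^ D * (2 ^ a * C₁ + 3 ^ D * C₂) * τ ^ (n + 2) * m X)) * e2

/-! ### The distances defining the two weights -/

section Concrete

variable {n : ℕ}

/-- The distance of `X + c` to the subspace `x_1 = x_2 = 0`. -/
noncomputable def planeDist (c X : Space n) : ℝ :=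
  √((X 0 + c 0) ^ 2 + (X 1 + c 1) ^ 2)

/-- The distance to the hyperplane `x_2 = 0`. -/
def axisDist (X : Space n) : ℝ := |X 1|

lemma isDistLike_axisDist : IsDistLike (axisDist (n := n)) where
  nonneg X := abs_nonneg _
  le_add X Y := by
    have h := PiLp.norm_apply_le (X - Y) 1
    rw [PiLp.sub_apply, Real.norm_eq_abs] at h
    unfold axisDist
    linarith [abs_sub_abs_le_abs_sub (X 1) (Y 1)]
  measurable := by unfold axisDist; fun_prop

lemma sqrt_sq_add_sq_le_norm (Z : Space n) : √(Z 0 ^ 2 + Z 1 ^ 2) ≤ ‖Z‖ := by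
  rw [EuclideanSpace.norm_eq]
  refine Real.sqrt_le_sqrt ?_
  rw [Fin.sum_univ_succ, Fin.sum_univ_succ]
  simp only [Real.norm_eq_abs, sq_abs]
  have : 0 ≤ ∑ i : Fin n, (Z i.succ.succ) ^ 2 := Finset.sum_nonneg fun i _ => sq_nonneg _
  have e : (Fin.succ (0 : Fin (n + 1))) = 1 := rfl
  rw [e]
  linarith

lemma isDistLike_planeDist (c : Space n) : IsDistLike (planeDist c) where
  nonneg X := Real.sqrt_nonneg _
  le_add X Y := by
    have hn : ∀ a b : ℝ, √(a ^ 2 + b ^ 2) = ‖(!₂[a, b] : EuclideanSpace ℝ (Fin 2))‖ := fun a b => by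
      simp [EuclideanSpace.norm_eq]
    have h := sqrt_sq_add_sq_le_norm (X - Y)
    have h2 : (!₂[X 0 + c 0, X 1 + c 1] : EuclideanSpace ℝ (Fin 2)) =
        !₂[Y 0 + c 0, Y 1 + c 1] + !₂[(X - Y) 0, (X - Y) 1] := by
      ext i; fin_cases i <;> simp <;> ring
    unfold planeDist
    rw [hn, hn, h2]
    rw [hn] at h
    linarith [norm_add_le (!₂[Y 0 + c 0, Y 1 + c 1] : EuclideanSpace ℝ (Fin 2))
      !₂[(X - Y) 0, (X - Y) 1]]
  measurable := by unfold planeDist; fun_prop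

lemma abs_le_planeDist_left (c X : Space n) : |X 0 + c 0| ≤ planeDist c X := by
  rw [← Real.sqrt_sq_eq_abs]
  exact Real.sqrt_le_sqrt (by nlinarith [sq_nonneg (X 1 + c 1)])

lemma abs_le_planeDist_right (c X : Space n) : |X 1 + c 1| ≤ planeDist c X := by
  rw [← Real.sqrt_sq_eq_abs]
  exact Real.sqrt_le_sqrt (by nlinarith [sq_nonneg (X 0 + c 0)])

/-- `(ρ + |x'|)^{-(q₀ + q₁)}` is bounded by a product of powers of the coordinates. -/
lemma rpow_neg_add_le_mul {x y z q₀ q₁ : ℝ} (hx : 0 < x) (hy : 0 < y) (hxz : x ≤ z) (hyz : y ≤ z)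
    (h0 : 0 ≤ q₀) (h1 : 0 ≤ q₁) : z ^ (-(q₀ + q₁)) ≤ x ^ (-q₀) * y ^ (-q₁) := by
  have hz : 0 < z := hx.trans_le hxz
  rw [neg_add, Real.rpow_add hz]
  exact mul_le_mul (Real.rpow_le_rpow_of_nonpos hx hxz (by linarith))
    (Real.rpow_le_rpow_of_nonpos hy hyz (by linarith)) (by positivity) (by positivity)

lemma exists_heatOp_phi0_comparable (n : ℕ) {δ : ℝ} (hδ0 : 0 < δ) (hδ1 : δ < 1) :
    ∃ c C : ℝ, 0 < c ∧ 0 < C ∧ ∀ ρ s : ℝ, 0 < ρ → ρ ^ 2 ≤ s → s ≤ 2 * ρ ^ 2 → ∀ X : Space n,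
      c * modelWeight axisDist δ ρ X ≤ heatOp s (phi0 δ) X ∧
      heatOp s (phi0 δ) X ≤ C * modelWeight axisDist δ ρ X := by
  refine exists_heatOp_comparable isDistLike_axisDist (p₀ := 0) (p₁ := δ) le_rfl zero_lt_one hδ0.le
    hδ1 (by ring) (fun X => rfl) ?_ (Eventually.of_forall fun X => ?_)
  · filter_upwards [ae_coord_ne 1 0] with X hX
    exact abs_pos.2 hX
  · simp [phi0]

lemma exists_heatOp_phi1_comparable (n : ℕ) {δ : ℝ} (hδ0 : 0 < δ) (hδ1 : δ < 1) :
    ∃ c C : ℝ, 0 < c ∧ 0 < C ∧ ∀ ρ s : ℝ, 0 < ρ → ρ ^ 2 ≤ s → s ≤ 2 * ρ ^ 2 → ∀ X : Space n,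
      c * modelWeight (planeDist 0) (1 + δ) ρ X ≤ heatOp s (phi1 δ) X ∧
      heatOp s (phi1 δ) X ≤ C * modelWeight (planeDist 0) (1 + δ) ρ X := by
  have hφ : ∀ X : Space n, phi1 δ X = planeDist 0 X ^ (-(1 + δ)) := fun X => by
    simp only [phi1, planeDist, PiLp.zero_apply, add_zero]
    rw [Real.sqrt_eq_rpow, ← Real.rpow_mul (by positivity)]
    ring_nf
  refine exists_heatOp_comparable (isDistLike_planeDist 0) (p₀ := (1 + δ) / 2) (p₁ := (1 + δ) / 2)
    (by linarith) (by linarith) (by linarith) (by linarith) (by ring) hφ ?_ ?_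
  · filter_upwards [ae_coord_ne 1 0] with X hX
    refine lt_of_lt_of_le (abs_pos.2 hX) ?_
    simpa using abs_le_planeDist_right 0 X
  · filter_upwards [ae_coord_ne 0 0, ae_coord_ne 1 0] with X hX0 hX1
    rw [hφ, show -(1 + δ) = -((1 + δ) / 2 + (1 + δ) / 2) by ring]
    refine rpow_neg_add_le_mul (abs_pos.2 hX0) (abs_pos.2 hX1) ?_ ?_ (by linarith) (by linarith)
    · simpa using abs_le_planeDist_left 0 X
    · simpa using abs_le_planeDist_right 0 X

lemma modelWeight_axisDist_le {δ ρ : ℝ} (hδ0 : 0 < δ) (hρ : 0 < ρ) {X : Space n} (hX : X 1 ≠ 0) :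
    modelWeight axisDist δ ρ X ≤ |X 1| ^ (-δ) :=
  Real.rpow_le_rpow_of_nonpos (abs_pos.2 hX) (by unfold axisDist; linarith) (by linarith)

/-- The averages of `f_± f_1`. -/
lemma exists_setIntegral_planeDist_le (n : ℕ) {δ : ℝ} (hδ0 : 0 < δ) (hδ1 : δ < 1 / 2) :
    ∃ C : ℝ, 0 ≤ C ∧ ∀ (c : Space n) (ρ τ : ℝ), c 1 = 0 → 0 < ρ → ρ ≤ τ → ∀ X,
      ∫ Y in Metric.closedBall X (2 * τ),
        modelWeight (planeDist c) (1 + δ) ρ Y * modelWeight axisDist δ ρ Y ≤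
        C * τ ^ (n + 2) * ρ ^ (-δ) * (ρ / τ) ^ (δ / 2) * modelWeight (planeDist c) (1 + δ) ρ X := by
  obtain ⟨C, hC0, hC⟩ := exists_setIntegral_weight_le (n := n) (δ := δ) (a := 1 + δ)
    (p₀ := 1 / 2 + δ) (p₁ := 1 / 2 + δ) hδ0 (by linarith) (by linarith) (by linarith) (by linarith)
    (by linarith) (by linarith) (by ring)
  refine ⟨C, hC0, fun c ρ τ hc hρ hτ X => hC (planeDist c) axisDist c ρ τ (isDistLike_planeDist c)
    isDistLike_axisDist hρ hτ ?_ ?_ X⟩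
  · filter_upwards [ae_coord_ne 1 0] with Y hY using modelWeight_axisDist_le hδ0 hρ hY
  · filter_upwards [ae_coord_ne 1 0, ae_coord_ne 0 (-c 0)] with Y hY1 hY0
    have hY1' : 0 < |Y 1| := abs_pos.2 hY1
    have hY0' : 0 < |Y 0 + c 0| := abs_pos.2 fun h => hY0 (by linarith)
    have h1 := modelWeight_axisDist_le hδ0 hρ hY1
    have h2 : modelWeight (planeDist c) (1 + δ) ρ Y ≤
        |Y 0 + c 0| ^ (-(1 / 2 + δ)) * |Y 1| ^ (-(1 / 2 : ℝ)) := by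
      rw [modelWeight, show -(1 + δ) = -((1 / 2 + δ) + 1 / 2) by ring]
      refine rpow_neg_add_le_mul hY0' hY1' ?_ ?_ (by linarith) (by norm_num)
      · linarith [abs_le_planeDist_left c Y]
      · have := abs_le_planeDist_right c Y
        rw [hc, add_zero] at this
        linarith
    rw [hc, add_zero]
    calc _ ≤ (|Y 0 + c 0| ^ (-(1 / 2 + δ)) * |Y 1| ^ (-(1 / 2 : ℝ))) * |Y 1| ^ (-δ) := by
          gcongr
          exact (modelWeight_pos isDistLike_axisDist hρ Y).le
      _ = _ := by rw [mul_assoc, ← Real.rpow_add hY1', neg_add (1 / 2 : ℝ)]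

/-- The averages of `f_1²`. -/
lemma exists_setIntegral_axisDist_le (n : ℕ) {δ : ℝ} (hδ0 : 0 < δ) (hδ1 : δ < 1 / 2) :
    ∃ C : ℝ, 0 ≤ C ∧ ∀ (ρ τ : ℝ), 0 < ρ → ρ ≤ τ → ∀ X : Space n,
      ∫ Y in Metric.closedBall X (2 * τ),
        modelWeight axisDist δ ρ Y * modelWeight axisDist δ ρ Y ≤
        C * τ ^ (n + 2) * ρ ^ (-δ) * (ρ / τ) ^ (δ / 2) * modelWeight axisDist δ ρ X := by
  obtain ⟨C, hC0, hC⟩ := exists_setIntegral_weight_le (n := n) (δ := δ) (a := δ)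
    (p₀ := 0) (p₁ := 2 * δ) hδ0 (by linarith) (by linarith) le_rfl (by linarith)
    (by linarith) (by linarith) (by ring)
  refine ⟨C, hC0, fun ρ τ hρ hτ X => hC axisDist axisDist 0 ρ τ isDistLike_axisDist
    isDistLike_axisDist hρ hτ ?_ ?_ X⟩
  · filter_upwards [ae_coord_ne 1 0] with Y hY using modelWeight_axisDist_le hδ0 hρ hY
  · filter_upwards [ae_coord_ne 1 0] with Y hY1
    have h1 := modelWeight_axisDist_le hδ0 hρ hY1
    have h0 := (modelWeight_pos (a := δ) isDistLike_axisDist hρ Y).le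
    simp only [PiLp.zero_apply, add_zero, neg_zero, Real.rpow_zero, one_mul]
    calc _ ≤ |Y 1| ^ (-δ) * |Y 1| ^ (-δ) := by gcongr
      _ = _ := by rw [← Real.rpow_add (abs_pos.2 hY1)]; ring_nf

/-- Functions bounded by `f_1` decay fast enough for singular integrals to converge at infinity. -/
lemma integrable_kernel_mul_axisDist {δ ρ : ℝ} (hδ0 : 0 < δ) (hδ1 : δ < 1) (hρ : 0 < ρ)
    (X : Space n) : Integrable fun Y : Space n =>
      (1 + ‖X - Y‖) ^ (-((n : ℝ) + 2)) * modelWeight axisDist δ ρ Y := by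
  obtain ⟨C, -, hC⟩ := exists_integral_kernel_mul_le n 0 δ (n + 2) le_rfl zero_lt_one hδ0.le hδ1
    (by linarith)
  have h := (hC 1 X 0 one_pos).1
  simp only [PiLp.zero_apply, add_zero, neg_zero, Real.rpow_zero, one_mul] at h
  refine h.mono' ?_ ?_
  · have := measurable_modelWeight (a := δ) (ρ := ρ) (isDistLike_axisDist (n := n))
    exact (Measurable.mul (by fun_prop) this).aestronglyMeasurable
  · filter_upwards [ae_coord_ne 1 0] with Y hY
    have h0 := (modelWeight_pos (a := δ) isDistLike_axisDist hρ Y).le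
    rw [Real.norm_of_nonneg (by positivity)]
    gcongr
    exact modelWeight_axisDist_le hδ0 hρ hY

end Concrete

section SingularIntegrals

open scoped ContDiff

/-! ### The kernel `∂_i ∂_j N` -/

section Kernel

variable {n : ℕ}

/-- The kernel `∂_i ∂_j N` away from the origin, in closed form. -/
noncomputable def explicitKernel (i j : Fin (n + 2)) (X : Space n) : ℝ :=
  ((if i = j then 1 else 0) * (‖X‖ ^ (n + 2))⁻¹ -
    ((n : ℝ) + 2) * (X i * X j) * (‖X‖ ^ (n + 4))⁻¹) / sphereArea n

lemma sphereArea_pos (n : ℕ) : 0 < sphereArea n :=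
  mul_pos (by positivity) (ENNReal.toReal_pos (Metric.measure_ball_pos _ _ one_pos).ne'
    measure_ball_lt_top.ne)

lemma inner_basisVec (X : Space n) (j : Fin (n + 2)) : inner ℝ X (basisVec j) = X j := by
  simp [basisVec, EuclideanSpace.inner_single_right]

lemma hasFDerivAt_normSq_comp {g : ℝ → ℝ} {g' : ℝ} {X : Space n} (hg : HasDerivAt g g' (‖X‖ ^ 2)) :
    HasFDerivAt (fun Y : Space n => g (‖Y‖ ^ 2)) (g' • (2 • innerSL ℝ X)) X :=
  hg.comp_hasFDerivAt X (hasStrictFDerivAt_norm_sq X).hasFDerivAt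

lemma partialDeriv_newton (j : Fin (n + 2)) {X : Space n} (hX : X ≠ 0) :
    partialDeriv j newton X = X j * (‖X‖ ^ 2) ^ (-(((n : ℝ) + 2) / 2)) / sphereArea n := by
  have hS := sphereArea_pos n
  have hq : 0 < ‖X‖ ^ 2 := by positivity
  rcases Nat.eq_zero_or_pos n with hn | hn
  · subst hn
    have hnew : (newton : Space 0 → ℝ) =
        fun Y => (fun q : ℝ => Real.log q / (2 * sphereArea 0)) (‖Y‖ ^ 2) := by
      funext Y
      simp only [newton, if_true, Real.log_pow]
      push_cast
      field_simp
    have hd : HasDerivAt (fun q : ℝ => Real.log q / (2 * sphereArea 0))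
        ((‖X‖ ^ 2)⁻¹ / (2 * sphereArea 0)) (‖X‖ ^ 2) := (Real.hasDerivAt_log hq.ne').div_const _
    rw [partialDeriv, hnew, (hasFDerivAt_normSq_comp hd).fderiv]
    simp only [smul_apply, innerSL_apply_apply, inner_basisVec, smul_eq_mul,
      nsmul_eq_mul]
    have : (‖X‖ ^ 2) ^ (-((((0 : ℕ) : ℝ) + 2) / 2)) = (‖X‖ ^ 2)⁻¹ := by
      rw [← Real.rpow_neg_one]; norm_num
    rw [this]
    push_cast
    field_simp
  · have hn' : (0 : ℝ) < n := by exact_mod_cast hn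
    have hnew : (newton : Space n → ℝ) =
        fun Y => (fun q : ℝ => -(q ^ (-((n : ℝ) / 2)) / (n * sphereArea n))) (‖Y‖ ^ 2) := by
      funext Y
      simp only [newton, hn.ne', if_false]
      have : (‖Y‖ ^ 2) ^ (-((n : ℝ) / 2)) = (‖Y‖ ^ n)⁻¹ := by
        rw [← Real.rpow_natCast, ← Real.rpow_mul (norm_nonneg _), ← Real.rpow_natCast,
          ← Real.rpow_neg (norm_nonneg _)]
        congr 1
        push_cast; ring
      rw [this]
      rw [one_div, mul_inv, div_eq_mul_inv]
      ring
    have hd : HasDerivAt (fun q : ℝ => -(q ^ (-((n : ℝ) / 2)) / (n * sphereArea n)))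
        (-((-((n : ℝ) / 2)) * (‖X‖ ^ 2) ^ (-((n : ℝ) / 2) - 1) / (n * sphereArea n))) (‖X‖ ^ 2) :=
      ((Real.hasDerivAt_rpow_const (Or.inl hq.ne')).div_const _).neg
    rw [partialDeriv, hnew, (hasFDerivAt_normSq_comp hd).fderiv]
    simp only [smul_apply, innerSL_apply_apply, inner_basisVec, smul_eq_mul,
      nsmul_eq_mul]
    have : -(((n : ℝ) + 2) / 2) = -((n : ℝ) / 2) - 1 := by ring
    rw [this]
    push_cast
    field_simp

lemma normSq_rpow_neg_half (m : ℕ) (X : Space n) :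
    (‖X‖ ^ 2) ^ (-((m : ℝ) / 2)) = (‖X‖ ^ m)⁻¹ := by
  rw [← Real.rpow_natCast, ← Real.rpow_mul (norm_nonneg _), ← Real.rpow_natCast,
    ← Real.rpow_neg (norm_nonneg _)]
  congr 1
  push_cast; ring

lemma kernel_eq_explicitKernel (i j : Fin (n + 2)) {X : Space n} (hX : X ≠ 0) :
    kernel i j X = explicitKernel i j X := by
  have hS := sphereArea_pos n
  have hq : 0 < ‖X‖ ^ 2 := by positivity
  have heq : partialDeriv j newton =ᶠ[𝓝 X]
      fun Y : Space n => Y j * (‖Y‖ ^ 2) ^ (-(((n : ℝ) + 2) / 2)) / sphereArea n := by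
    filter_upwards [isOpen_ne.mem_nhds hX] with Y hY using partialDeriv_newton j hY
  have h1 : HasFDerivAt (fun Y : Space n => Y j) (EuclideanSpace.proj j : Space n →L[ℝ] ℝ) X :=
    (EuclideanSpace.proj j : Space n →L[ℝ] ℝ).hasFDerivAt
  have h2 := hasFDerivAt_normSq_comp (X := X)
    (Real.hasDerivAt_rpow_const (p := -(((n : ℝ) + 2) / 2)) (Or.inl hq.ne'))
  have h3 := (h1.mul h2).mul_const (sphereArea n)⁻¹
  have h4 := h3.congr_of_eventuallyEq (heq.trans (Eventually.of_forall fun Y => by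
    simp only [Pi.mul_apply, div_eq_mul_inv]))
  rw [kernel, partialDeriv, h4.fderiv]
  simp only [smul_apply, add_apply, innerSL_apply_apply,
    inner_basisVec, smul_eq_mul, nsmul_eq_mul, PiLp.proj_apply]
  have e1 := normSq_rpow_neg_half (n + 2) X
  have e2 := normSq_rpow_neg_half (n + 4) X
  push_cast at e1 e2
  have e3 : -(((n : ℝ) + 2) / 2) - 1 = -(((n : ℝ) + 4) / 2) := by ring
  have e4 : (basisVec i : Space n) j = if i = j then 1 else 0 := by
    simp [basisVec, eq_comm]
  rw [e3, e1, e2, e4, explicitKernel]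
  push_cast
  field_simp
  ring

lemma explicitKernel_smul (i j : Fin (n + 2)) {τ : ℝ} (hτ : 0 < τ) (X : Space n) :
    explicitKernel i j (τ • X) = (τ ^ (n + 2))⁻¹ * explicitKernel i j X := by
  simp only [explicitKernel, norm_smul, Real.norm_of_nonneg hτ.le, PiLp.smul_apply, smul_eq_mul,
    mul_pow, mul_inv]
  have : τ ^ (n + 4) = τ ^ (n + 2) * τ ^ 2 := by ring
  rw [this]
  field_simp

lemma abs_coord_le_norm (X : Space n) (i : Fin (n + 2)) : |X i| ≤ ‖X‖ := by
  simpa using PiLp.norm_apply_le X i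

lemma abs_explicitKernel_le (i j : Fin (n + 2)) (X : Space n) :
    |explicitKernel i j X| ≤ ((n : ℝ) + 3) / sphereArea n * (‖X‖ ^ (n + 2))⁻¹ := by
  have hS := sphereArea_pos n
  rw [explicitKernel, abs_div, abs_of_pos hS, div_mul_eq_mul_div]
  gcongr
  rcases eq_or_ne X 0 with rfl | hX
  · simp
  have hX' : 0 < ‖X‖ := norm_pos_iff.2 hX
  have h1 : |X i * X j| ≤ ‖X‖ ^ 2 := by
    rw [abs_mul, sq]
    exact mul_le_mul (abs_coord_le_norm X i) (abs_coord_le_norm X j) (abs_nonneg _) hX'.le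
  have h2 : |((if i = j then 1 else 0) : ℝ) * (‖X‖ ^ (n + 2))⁻¹| ≤ (‖X‖ ^ (n + 2))⁻¹ := by
    split_ifs <;> simp [abs_of_nonneg, hX'.le]
  have h3 : |((n : ℝ) + 2) * (X i * X j) * (‖X‖ ^ (n + 4))⁻¹| ≤
      ((n : ℝ) + 2) * (‖X‖ ^ (n + 2))⁻¹ := by
    rw [abs_mul, abs_mul, abs_of_nonneg (by positivity : (0 : ℝ) ≤ (n : ℝ) + 2),
      abs_of_nonneg (by positivity : (0 : ℝ) ≤ (‖X‖ ^ (n + 4))⁻¹)]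
    calc _ ≤ ((n : ℝ) + 2) * ‖X‖ ^ 2 * (‖X‖ ^ (n + 4))⁻¹ := by gcongr
      _ = _ := by
        have : ‖X‖ ^ (n + 4) = ‖X‖ ^ (n + 2) * ‖X‖ ^ 2 := by ring
        rw [this]; field_simp
  calc _ ≤ _ + _ := abs_sub _ _
    _ ≤ (‖X‖ ^ (n + 2))⁻¹ + ((n : ℝ) + 2) * (‖X‖ ^ (n + 2))⁻¹ := add_le_add h2 h3
    _ = _ := by ring

lemma measurable_explicitKernel (i j : Fin (n + 2)) :
    Measurable (explicitKernel i j : Space n → ℝ) := by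
  unfold explicitKernel
  fun_prop

lemma integral_explicitKernel_mul_radial_of_ne {i j : Fin (n + 2)} (hij : i ≠ j) (η : ℝ → ℝ) :
    ∫ Z : Space n, explicitKernel i j Z * η ‖Z‖ = 0 := by
  -- the reflection `z_i ↦ -z_i` changes the sign of the integrand
  let e : Space n ≃ₗᵢ[ℝ] Space n := LinearIsometryEquiv.piLpCongrRight 2 fun k : Fin (n + 2) =>
    if k = i then LinearIsometryEquiv.neg ℝ else LinearIsometryEquiv.refl ℝ ℝ
  have hi : ∀ Z : Space n, e Z i = -Z i := fun Z => by
    simp [e, LinearIsometryEquiv.piLpCongrRight_apply]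
  have hj : ∀ Z : Space n, e Z j = Z j := fun Z => by
    simp [e, LinearIsometryEquiv.piLpCongrRight_apply, hij.symm]
  have h := e.measurePreserving.integral_comp e.toHomeomorph.measurableEmbedding
    (fun Z : Space n => explicitKernel i j Z * η ‖Z‖)
  have h2 : (fun Z : Space n => explicitKernel i j (e Z) * η ‖e Z‖) =
      fun Z => -(explicitKernel i j Z * η ‖Z‖) := by
    funext Z
    simp only [explicitKernel, hi, hj, LinearIsometryEquiv.norm_map, hij, if_false]
    ring
  rw [h2, integral_neg] at h
  linarith

lemma integral_explicitKernel_mul_radial_diag (i j : Fin (n + 2)) (η : ℝ → ℝ) :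
    ∫ Z : Space n, explicitKernel i i Z * η ‖Z‖ = ∫ Z : Space n, explicitKernel j j Z * η ‖Z‖ := by
  let e : Space n ≃ₗᵢ[ℝ] Space n := LinearIsometryEquiv.piLpCongrLeft 2 ℝ ℝ (Equiv.swap i j)
  have hi : ∀ Z : Space n, e Z i = Z j := fun Z => by
    simp [e, LinearIsometryEquiv.piLpCongrLeft_apply]
  have h := e.measurePreserving.integral_comp e.toHomeomorph.measurableEmbedding
    (fun Z : Space n => explicitKernel i i Z * η ‖Z‖)
  rw [← h]
  refine integral_congr_ae (Eventually.of_forall fun Z => ?_)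
  simp only [explicitKernel, hi, LinearIsometryEquiv.norm_map, if_true]

lemma sum_explicitKernel (Z : Space n) : ∑ i, explicitKernel i i Z = 0 := by
  rcases eq_or_ne Z 0 with rfl | hZ
  · simp [explicitKernel]
  have hZ' : 0 < ‖Z‖ := norm_pos_iff.2 hZ
  have h1 : ∑ i, Z i * Z i = ‖Z‖ ^ 2 := by
    rw [EuclideanSpace.norm_sq_eq]; simp [sq]
  simp only [explicitKernel, if_true, ← Finset.sum_div, Finset.sum_sub_distrib, ← Finset.sum_mul,
    ← Finset.mul_sum, h1]
  have : ‖Z‖ ^ (n + 4) = ‖Z‖ ^ (n + 2) * ‖Z‖ ^ 2 := by ring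
  rw [this]
  simp only [Finset.sum_const, Finset.card_univ, Fintype.card_fin, nsmul_eq_mul, mul_one]
  push_cast
  field_simp
  simp

/-- The kernel has mean zero on spheres. No integrability is needed: by symmetry the integrals
with `i = j` all agree, so they vanish if the functions are integrable, because the sum over `i` of
the kernels is zero, and otherwise by convention. -/
lemma integral_explicitKernel_mul_radial (i j : Fin (n + 2)) (η : ℝ → ℝ) :
    ∫ Z : Space n, explicitKernel i j Z * η ‖Z‖ = 0 := by
  rcases ne_or_eq i j with hij | rfl
  · exact integral_explicitKernel_mul_radial_of_ne hij η
  by_cases hint : ∀ k, Integrable fun Z : Space n => explicitKernel k k Z * η ‖Z‖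
  · have h : ∑ k : Fin (n + 2), ∫ Z : Space n, explicitKernel k k Z * η ‖Z‖ = 0 := by
      rw [← integral_finsetSum _ fun k _ => hint k]
      simp [← Finset.sum_mul, sum_explicitKernel]
    simp only [integral_explicitKernel_mul_radial_diag _ i] at h
    simp only [Finset.sum_const, Finset.card_univ, Fintype.card_fin, nsmul_eq_mul,
      mul_eq_zero] at h
    rcases h with h | h
    · exact absurd h (by positivity)
    · exact h
  · push Not at hint
    obtain ⟨k, hk⟩ := hint
    rw [integral_explicitKernel_mul_radial_diag i k, integral_undef hk]

end Kernel

/-! ### Dyadic decomposition of the kernel and principal values -/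

section Dyadic

variable {n : ℕ}

/-- Smooth functions supported in the ball of radius `2`. -/
structure IsPiece (κ : Space n → ℝ) : Prop where
  smooth : ContDiff ℝ ∞ κ
  eq_zero : ∀ Z, 2 < ‖Z‖ → κ Z = 0

/-- The `L¹`-normalised dilate `τ^{-d} κ(· / τ)`. -/
noncomputable def dilate (τ : ℝ) (κ : Space n → ℝ) (Z : Space n) : ℝ :=
  (τ ^ (n + 2))⁻¹ * κ (τ⁻¹ • Z)

/-- Convolution with the dilate of `κ` at scale `τ`. -/
noncomputable def scaleOp (τ : ℝ) (κ g : Space n → ℝ) (X : Space n) : ℝ :=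
  ∫ Y, dilate τ κ (X - Y) * g Y

/-- A smooth function of `r = |Z|` supported in `1/2 ≤ r ≤ √2` whose dyadic dilates sum to `1`. -/
noncomputable def radialBump (r : ℝ) : ℝ :=
  Real.smoothTransition (2 - r ^ 2) - Real.smoothTransition (2 - 4 * r ^ 2)

/-- The part of the kernel `∂_i ∂_j N` living at distance about `1` from the origin. -/
noncomputable def dyadicKernel (i j : Fin (n + 2)) (Z : Space n) : ℝ :=
  explicitKernel i j Z * radialBump ‖Z‖

lemma radialBump_nonneg (r : ℝ) : 0 ≤ radialBump r :=
  sub_nonneg.2 (Real.smoothTransition.monotone (by nlinarith [sq_nonneg r]))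

lemma radialBump_le_one (r : ℝ) : radialBump r ≤ 1 := by
  have h1 := Real.smoothTransition.le_one (2 - r ^ 2)
  have h2 := Real.smoothTransition.nonneg (2 - 4 * r ^ 2)
  unfold radialBump
  linarith

lemma continuous_radialBump : Continuous radialBump := by
  unfold radialBump
  exact (Real.smoothTransition.continuous.comp (by fun_prop)).sub
    (Real.smoothTransition.continuous.comp (by fun_prop))

lemma radialBump_eq_zero_of_le {r : ℝ} (h0 : 0 ≤ r) (h : r ≤ 1 / 2) : radialBump r = 0 := by
  rw [radialBump, Real.smoothTransition.one_of_one_le (by nlinarith),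
    Real.smoothTransition.one_of_one_le (by nlinarith), sub_self]

lemma radialBump_eq_zero_of_ge {r : ℝ} (h : 2 ≤ r ^ 2) : radialBump r = 0 := by
  rw [radialBump, Real.smoothTransition.zero_of_nonpos (by linarith),
    Real.smoothTransition.zero_of_nonpos (by linarith), sub_self]

/-- The dyadic dilates of `radialBump` form a partition of unity. -/
lemma hasSum_radialBump {r : ℝ} (hr : 0 < r) :
    HasSum (fun k : ℤ => radialBump ((2 ^ k)⁻¹ * r)) 1 := by
  obtain ⟨m, hm, hm'⟩ := exists_mem_Ico_zpow (y := (2 : ℝ)) hr one_lt_two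
  have h2 : ∀ k : ℤ, (0 : ℝ) < 2 ^ k := fun k => by positivity
  have hz : ∀ k ∉ ({m, m + 1} : Finset ℤ), radialBump ((2 ^ k)⁻¹ * r) = 0 := by
    intro k hk
    simp only [Finset.mem_insert, Finset.mem_singleton, not_or] at hk
    rcases lt_or_gt_of_ne hk.1 with h | h
    · apply radialBump_eq_zero_of_ge
      have h3 : (2 : ℝ) ^ (k + 1) ≤ 2 ^ m := zpow_le_zpow_right₀ one_le_two (by omega)
      rw [zpow_add_one₀ two_ne_zero] at h3
      have h4 : 2 ≤ (2 ^ k)⁻¹ * r := by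
        rw [inv_mul_eq_div, le_div_iff₀ (h2 k)]; linarith
      nlinarith
    · apply radialBump_eq_zero_of_le (by have := h2 k; positivity)
      have h3 : (2 : ℝ) ^ (m + 1 + 1) ≤ 2 ^ k := zpow_le_zpow_right₀ one_le_two (by omega)
      rw [zpow_add_one₀ two_ne_zero] at h3
      rw [inv_mul_eq_div, div_le_iff₀ (h2 k)]
      linarith
  have hs : HasSum (fun k : ℤ => radialBump ((2 ^ k)⁻¹ * r)) _ := hasSum_sum_of_ne_finset_zero hz
  convert hs using 1
  rw [Finset.sum_pair (by omega)]
  set q := (2 ^ m)⁻¹ * r with hq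
  have hq1 : 1 ≤ q := by rw [hq, inv_mul_eq_div, le_div_iff₀ (h2 m)]; linarith
  rw [zpow_add_one₀ two_ne_zero] at hm' ⊢
  have hq2 : q < 2 := by rw [hq, inv_mul_eq_div, div_lt_iff₀ (h2 m)]; linarith
  have e : (2 ^ m * 2)⁻¹ * r = q / 2 := by rw [hq, mul_inv]; ring
  rw [e, radialBump, radialBump, Real.smoothTransition.zero_of_nonpos (x := 2 - 4 * q ^ 2)
    (by nlinarith), Real.smoothTransition.one_of_one_le (x := 2 - (q / 2) ^ 2) (by nlinarith)]
  ring_nf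

lemma contDiff_radialBump_norm : ContDiff ℝ ∞ fun Z : Space n => radialBump ‖Z‖ := by
  unfold radialBump
  exact (Real.smoothTransition.contDiff.comp (contDiff_const.sub (contDiff_norm_sq ℝ))).sub
    (Real.smoothTransition.contDiff.comp
      (contDiff_const.sub (contDiff_const.mul (contDiff_norm_sq ℝ))))

lemma isPiece_dyadicKernel (i j : Fin (n + 2)) : IsPiece (dyadicKernel i j : Space n → ℝ) where
  smooth := by
    rw [contDiff_iff_contDiffAt]
    intro Z
    rcases eq_or_ne Z 0 with rfl | hZ
    · have : (dyadicKernel i j : Space n → ℝ) =ᶠ[𝓝 0] fun _ => 0 := by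
        filter_upwards [Metric.ball_mem_nhds (0 : Space n) (by norm_num : (0 : ℝ) < 1 / 2)] with Y hY
        rw [mem_ball_zero_iff] at hY
        rw [dyadicKernel, radialBump_eq_zero_of_le (norm_nonneg _) hY.le, mul_zero]
      exact contDiffAt_const.congr_of_eventuallyEq this
    · have hn : ContDiffAt ℝ ∞ (fun Y : Space n => ‖Y‖) Z := contDiffAt_norm ℝ hZ
      have hnz : ‖Z‖ ≠ 0 := norm_ne_zero_iff.2 hZ
      have hc : ∀ k : Fin (n + 2), ContDiffAt ℝ ∞ (fun Y : Space n => Y k) Z := fun k =>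
        (EuclideanSpace.proj k : Space n →L[ℝ] ℝ).contDiff.contDiffAt
      refine ContDiffAt.mul ?_ contDiff_radialBump_norm.contDiffAt
      unfold explicitKernel
      refine ContDiffAt.div_const (ContDiffAt.sub ?_ ?_) _
      · exact contDiffAt_const.mul ((hn.pow _).inv (pow_ne_zero _ hnz))
      · exact (contDiffAt_const.mul ((hc i).mul (hc j))).mul ((hn.pow _).inv (pow_ne_zero _ hnz))
  eq_zero Z hZ := by
    rw [dyadicKernel, radialBump_eq_zero_of_ge (by nlinarith), mul_zero]

lemma integral_dyadicKernel (i j : Fin (n + 2)) : ∫ Z : Space n, dyadicKernel i j Z = 0 :=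
  integral_explicitKernel_mul_radial i j radialBump

lemma dilate_dyadicKernel (i j : Fin (n + 2)) {τ : ℝ} (hτ : 0 < τ) (Z : Space n) :
    dilate τ (dyadicKernel i j) Z = explicitKernel i j Z * radialBump (τ⁻¹ * ‖Z‖) := by
  rw [dilate, dyadicKernel, explicitKernel_smul i j (inv_pos.2 hτ), norm_smul,
    Real.norm_of_nonneg (inv_pos.2 hτ).le, inv_pow, inv_inv]
  field_simp

lemma explicitKernel_zero (i j : Fin (n + 2)) : explicitKernel i j (0 : Space n) = 0 := by
  simp [explicitKernel]

lemma integrable_explicitKernel_mul_radial (i j : Fin (n + 2)) {η : ℝ → ℝ} {a b : ℝ} (ha : 0 < a)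
    (hη : Measurable η) (h1 : ∀ r, |η r| ≤ 1) (h0 : ∀ r, 0 ≤ r → r ≤ a → η r = 0)
    (h0' : ∀ r, b ≤ r → η r = 0) : Integrable fun Z : Space n => explicitKernel i j Z * η ‖Z‖ := by
  have hS := sphereArea_pos n
  have hdom : Integrable (Set.indicator (Metric.ball (0 : Space n) b)
      fun _ => ((n : ℝ) + 3) / sphereArea n * (a ^ (n + 2))⁻¹) :=
    (integrable_indicator_iff measurableSet_ball).2 (integrableOn_const measure_ball_lt_top.ne)
  refine hdom.mono' ((measurable_explicitKernel i j).mul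
    (hη.comp measurable_norm)).aestronglyMeasurable (Eventually.of_forall fun Z => ?_)
  have hnn : 0 ≤ Set.indicator (Metric.ball (0 : Space n) b)
      (fun _ => ((n : ℝ) + 3) / sphereArea n * (a ^ (n + 2))⁻¹) Z :=
    Set.indicator_nonneg (fun _ _ => by positivity) _
  rcases le_or_gt ‖Z‖ a with h | h
  · simpa [h0 _ (norm_nonneg _) h] using hnn
  rcases le_or_gt b ‖Z‖ with h' | h'
  · simpa [h0' _ h'] using hnn
  rw [Set.indicator_of_mem (by simpa using h'), norm_mul, Real.norm_eq_abs, Real.norm_eq_abs]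
  calc _ ≤ |explicitKernel i j Z| * 1 := by gcongr; exact h1 _
    _ ≤ ((n : ℝ) + 3) / sphereArea n * (‖Z‖ ^ (n + 2))⁻¹ := by
        rw [mul_one]; exact abs_explicitKernel_le i j Z
    _ ≤ _ := by gcongr

lemma integrableOn_ball_norm_rpow {α : ℝ} (hα : 0 < α) :
    IntegrableOn (fun Z : Space n => ‖Z‖ ^ (α - (n + 2))) (Metric.ball 0 1) := by
  rw [integrableOn_fun_norm_addHaar volume (f := fun r : ℝ => r ^ (α - (n + 2)))]
  have h : IntegrableOn (fun y : ℝ => y ^ (α - 1)) (Set.Ioo 0 1) := by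
    rw [← integrableOn_Ioc_iff_integrableOn_Ioo,
      ← intervalIntegrable_iff_integrableOn_Ioc_of_le zero_le_one]
    exact intervalIntegral.intervalIntegrable_rpow' (by linarith)
  refine h.congr_fun (fun y hy => ?_) measurableSet_Ioo
  simp only [finrank_euclideanSpace_fin, smul_eq_mul]
  rw [show n + 2 - 1 = n + 1 by omega, ← Real.rpow_natCast, ← Real.rpow_add hy.1]
  congr 1
  push_cast
  ring

/-- The regularised integrand `∂_i ∂_j N(X - Y) (g(Y) - g(X) 1_{|X - Y| < 1})`. -/
noncomputable def regIntegrand (i j : Fin (n + 2)) (g : Space n → ℝ) (X Y : Space n) : ℝ :=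
  explicitKernel i j (X - Y) * (g Y - if ‖X - Y‖ < 1 then g X else 0)

lemma integrable_regIntegrand (i j : Fin (n + 2)) {g : Space n → ℝ} (hg : Measurable g)
    {X : Space n} {α B : ℝ} (hα : 0 < α)
    (hint : Integrable fun Y => (1 + ‖X - Y‖) ^ (-((n : ℝ) + 2)) * g Y)
    (hB : ∀ Y, |g Y - g X| ≤ B * ‖X - Y‖ ^ α) : Integrable (regIntegrand i j g X) := by
  have hS := sphereArea_pos n
  set c : ℝ := ((n : ℝ) + 3) / sphereArea n with hc
  have hc0 : 0 < c := by positivity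
  have hB0 : 0 ≤ B := by
    have h := hB (X + basisVec 0)
    have : ‖X - (X + basisVec 0)‖ = 1 := by simp [basisVec]
    rw [this, Real.one_rpow, mul_one] at h
    exact (abs_nonneg _).trans h
  have h1 : Integrable (fun Y : Space n => Set.indicator (Metric.ball (0 : Space n) 1)
      (fun Z => ‖Z‖ ^ (α - (n + 2))) (X - Y)) :=
    ((integrable_indicator_iff measurableSet_ball).2
      (integrableOn_ball_norm_rpow hα)).comp_sub_left X
  refine ((h1.const_mul (c * B)).add ((hint.norm).const_mul (c * 2 ^ (n + 2)))).mono' ?_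
    (Eventually.of_forall fun Y => ?_)
  · refine Measurable.aestronglyMeasurable (Measurable.mul
      ((measurable_explicitKernel i j).comp (by fun_prop)) (hg.sub ?_))
    exact Measurable.ite (measurableSet_lt (by fun_prop) measurable_const) measurable_const
      measurable_const
  have hk := abs_explicitKernel_le i j (X - Y)
  rw [regIntegrand, norm_mul, Real.norm_eq_abs, Real.norm_eq_abs]
  simp only [Pi.add_apply]
  rcases eq_or_ne (X - Y) 0 with h0 | h0
  · rw [h0, explicitKernel_zero, abs_zero, zero_mul]
    have : 0 ≤ Set.indicator (Metric.ball (0 : Space n) 1) (fun Z => ‖Z‖ ^ (α - (n + 2))) 0 :=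
      Set.indicator_nonneg (fun _ _ => by positivity) _
    positivity
  have hr : 0 < ‖X - Y‖ := norm_pos_iff.2 h0
  split_ifs with h
  · rw [Set.indicator_of_mem (by simpa using h)]
    have e : ‖X - Y‖ ^ (α - ((n : ℝ) + 2)) = (‖X - Y‖ ^ (n + 2))⁻¹ * ‖X - Y‖ ^ α := by
      rw [sub_eq_neg_add α, Real.rpow_add hr, Real.rpow_neg hr.le]
      congr 2
      exact_mod_cast Real.rpow_natCast _ (n + 2)
    rw [e]
    calc _ ≤ (c * (‖X - Y‖ ^ (n + 2))⁻¹) * (B * ‖X - Y‖ ^ α) :=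
          mul_le_mul hk (hB Y) (abs_nonneg _) (by positivity)
      _ = c * B * ((‖X - Y‖ ^ (n + 2))⁻¹ * ‖X - Y‖ ^ α) := by ring
      _ ≤ _ := le_add_of_nonneg_right (by positivity)
  · rw [sub_zero, norm_mul, Set.indicator_of_notMem (by simpa using h), mul_zero, zero_add,
      Real.norm_of_nonneg (by positivity), Real.norm_eq_abs]
    have e : (1 + ‖X - Y‖) ^ (-((n : ℝ) + 2)) = ((1 + ‖X - Y‖) ^ (n + 2))⁻¹ := by
      rw [Real.rpow_neg (by positivity)]
      congr 1
      exact_mod_cast Real.rpow_natCast _ (n + 2)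
    have e2 : (‖X - Y‖ ^ (n + 2))⁻¹ ≤ 2 ^ (n + 2) * ((1 + ‖X - Y‖) ^ (n + 2))⁻¹ := by
      have h1 : 1 ≤ ‖X - Y‖ := not_lt.1 h
      rw [← div_eq_mul_inv, ← div_pow, ← inv_pow]
      refine pow_le_pow_left₀ (by positivity) ?_ _
      rw [inv_le_comm₀ hr (by positivity), inv_div]
      linarith
    rw [e]
    calc _ ≤ (c * (2 ^ (n + 2) * ((1 + ‖X - Y‖) ^ (n + 2))⁻¹)) * |g Y| := by
          gcongr
          exact hk.trans (by gcongr)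
      _ = _ := by ring

/-- The principal value exists, and it is the sum of the convolutions with the dyadic pieces of the
kernel. -/
lemma hasSum_scaleOp_and_tendsto_truncated (i j : Fin (n + 2)) {g : Space n → ℝ} (hg : Measurable g)
    {X : Space n} {α B : ℝ} (hα : 0 < α)
    (hint : Integrable fun Y => (1 + ‖X - Y‖) ^ (-((n : ℝ) + 2)) * g Y)
    (hB : ∀ Y, |g Y - g X| ≤ B * ‖X - Y‖ ^ α) :
    (∀ ε : ℝ, 0 < ε →
      IntegrableOn (fun Y => kernel i j (X - Y) * g Y) {Y : Space n | ε < ‖X - Y‖}) ∧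
    ∃ l : ℝ, HasSum (fun k : ℤ => scaleOp (2 ^ k) (dyadicKernel i j) g X) l ∧
      Tendsto (truncated i j g X) (𝓝[>] 0) (𝓝 l) := by
  have hF := integrable_regIntegrand i j hg hα hint hB
  have hmeas : ∀ ε : ℝ, MeasurableSet {Y : Space n | ε < ‖X - Y‖} := fun ε =>
    measurableSet_lt measurable_const (by fun_prop)
  -- the correction in `regIntegrand` is a radial truncation of the kernel
  have hcorr : ∀ (η : ℝ → ℝ), (∃ a b : ℝ, 0 < a ∧ (∀ r, 0 ≤ r → r ≤ a → η r = 0) ∧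
      (∀ r, b ≤ r → η r = 0)) → Measurable η → (∀ r, |η r| ≤ 1) →
      Integrable (fun Y : Space n => explicitKernel i j (X - Y) * η ‖X - Y‖ * g X) ∧
      ∫ Y : Space n, explicitKernel i j (X - Y) * η ‖X - Y‖ * g X = 0 := by
    rintro η ⟨a, b, ha, h0, h0'⟩ hη h1
    refine ⟨((integrable_explicitKernel_mul_radial i j ha hη h1 h0 h0').comp_sub_left X).mul_const _,
      ?_⟩
    rw [integral_mul_const, integral_sub_left_eq_self
      (fun Z => explicitKernel i j Z * η ‖Z‖) volume X, integral_explicitKernel_mul_radial, zero_mul]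
  set ηε : ℝ → ℝ → ℝ := fun ε => Set.indicator (Set.Ioo ε 1) 1 with hηε
  have hηcorr : ∀ ε, 0 < ε → Integrable (fun Y : Space n =>
      explicitKernel i j (X - Y) * ηε ε ‖X - Y‖ * g X) ∧
      ∫ Y : Space n, explicitKernel i j (X - Y) * ηε ε ‖X - Y‖ * g X = 0 := fun ε hε =>
    hcorr _ ⟨ε, 1, hε, fun r _ hr => Set.indicator_of_notMem (fun h => not_lt.2 hr h.1) _,
      fun r hr => Set.indicator_of_notMem (fun h => not_lt.2 hr h.2) _⟩
      (measurable_one.indicator measurableSet_Ioo) fun r => by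
        simp only [hηε, Set.indicator]; split_ifs <;> simp
  have htrunc : ∀ ε, 0 < ε → ∀ Y, Set.indicator {Y : Space n | ε < ‖X - Y‖}
      (fun Y => kernel i j (X - Y) * g Y) Y =
      Set.indicator {Y : Space n | ε < ‖X - Y‖} (regIntegrand i j g X) Y +
        explicitKernel i j (X - Y) * ηε ε ‖X - Y‖ * g X := by
    intro ε hε Y
    by_cases h : ε < ‖X - Y‖
    · have h0 : X - Y ≠ 0 := norm_pos_iff.1 (hε.trans h)
      rw [Set.indicator_of_mem (by exact h), Set.indicator_of_mem (by exact h),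
        kernel_eq_explicitKernel i j h0, regIntegrand]
      simp only [hηε, Set.indicator, Set.mem_Ioo, h, true_and, Pi.one_apply]
      split_ifs <;> ring
    · rw [Set.indicator_of_notMem (by exact h), Set.indicator_of_notMem (by exact h)]
      simp [hηε, h]
  refine ⟨fun ε hε => ?_, ∫ Y, regIntegrand i j g X Y, ?_, ?_⟩
  · rw [← integrable_indicator_iff (hmeas ε), funext (htrunc ε hε)]
    exact (hF.indicator (hmeas ε)).add (hηcorr ε hε).1
  · have hpiece : ∀ k : ℤ, scaleOp (2 ^ k) (dyadicKernel i j) g X =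
        ∫ Y, regIntegrand i j g X Y * radialBump ((2 ^ k)⁻¹ * ‖X - Y‖) := by
      intro k
      have h2 : (0 : ℝ) < 2 ^ k := by positivity
      set η : ℝ → ℝ := fun r => radialBump ((2 ^ k)⁻¹ * r) * Set.indicator (Set.Iio 1) 1 r with hη
      have hc := hcorr η ⟨2 ^ k / 2, 1, by positivity, fun r h0 hr => by
          simp only [hη]
          rw [radialBump_eq_zero_of_le (by positivity), zero_mul]
          rw [inv_mul_eq_div, div_le_iff₀ h2]; linarith, fun r hr => by
          simp only [hη]
          rw [Set.indicator_of_notMem (by simpa using hr), mul_zero]⟩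
        ((continuous_radialBump.comp (by fun_prop)).measurable.mul
          (measurable_one.indicator measurableSet_Iio)) fun r => by
          simp only [hη, abs_mul, abs_of_nonneg (radialBump_nonneg _)]
          refine mul_le_one₀ (radialBump_le_one _) (abs_nonneg _) ?_
          simp only [Set.indicator]; split_ifs <;> simp
      have hFi : Integrable fun Y => regIntegrand i j g X Y * radialBump ((2 ^ k)⁻¹ * ‖X - Y‖) := by
        refine hF.mul_bdd (c := 1) (continuous_radialBump.comp (by fun_prop)).aestronglyMeasurable
          (Eventually.of_forall fun Y => ?_)
        rw [Real.norm_of_nonneg (radialBump_nonneg _)]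
        exact radialBump_le_one _
      rw [← add_zero (∫ Y, regIntegrand i j g X Y * radialBump ((2 ^ k)⁻¹ * ‖X - Y‖)), ← hc.2,
        ← integral_add hFi hc.1, scaleOp]
      refine integral_congr_ae (Eventually.of_forall fun Y => ?_)
      simp only [dilate_dyadicKernel i j h2, regIntegrand, hη, Set.indicator, Set.mem_Iio,
        Pi.one_apply]
      split_ifs <;> ring
    simp only [hpiece]
    have hsum : ∀ Y, HasSum (fun k : ℤ => regIntegrand i j g X Y *
        radialBump ((2 ^ k)⁻¹ * ‖X - Y‖)) (regIntegrand i j g X Y) := by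
      intro Y
      rcases eq_or_ne (X - Y) 0 with h0 | h0
      · simp [regIntegrand, h0, explicitKernel_zero]
      · simpa using (hasSum_radialBump (norm_pos_iff.2 h0)).mul_left (regIntegrand i j g X Y)
    have hsum' : ∀ Y, HasSum (fun k : ℤ => ‖regIntegrand i j g X Y *
        radialBump ((2 ^ k)⁻¹ * ‖X - Y‖)‖) ‖regIntegrand i j g X Y‖ := by
      intro Y
      simp only [norm_mul, Real.norm_of_nonneg (radialBump_nonneg _)]
      rcases eq_or_ne (X - Y) 0 with h0 | h0
      · simp [regIntegrand, h0, explicitKernel_zero]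
      · simpa using (hasSum_radialBump (norm_pos_iff.2 h0)).mul_left ‖regIntegrand i j g X Y‖
    refine hasSum_integral_of_dominated_convergence _ (fun k => hF.aestronglyMeasurable.mul
      (continuous_radialBump.comp (by fun_prop)).aestronglyMeasurable)
      (fun k => Eventually.of_forall fun Y => le_rfl)
      (Eventually.of_forall fun Y => (hsum' Y).summable) ?_ (Eventually.of_forall hsum)
    simpa only [(hsum' _).tsum_eq] using hF.norm
  · have hlim : Tendsto (fun ε : ℝ => ∫ Y, Set.indicator {Y : Space n | ε < ‖X - Y‖}
        (regIntegrand i j g X) Y) (𝓝[>] 0) (𝓝 (∫ Y, regIntegrand i j g X Y)) := by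
      refine tendsto_integral_filter_of_dominated_convergence (fun Y => ‖regIntegrand i j g X Y‖)
        (Eventually.of_forall fun ε => hF.aestronglyMeasurable.indicator (hmeas ε))
        (Eventually.of_forall fun ε => Eventually.of_forall fun Y => norm_indicator_le_norm_self _ _)
        hF.norm (Eventually.of_forall fun Y => ?_)
      rcases eq_or_ne (X - Y) 0 with h0 | h0
      · have : regIntegrand i j g X Y = 0 := by simp [regIntegrand, h0, explicitKernel_zero]
        simp [Set.indicator, this]
      · refine tendsto_const_nhds.congr' ?_
        filter_upwards [mem_nhdsWithin_of_mem_nhds (Iio_mem_nhds (norm_pos_iff.2 h0))] with ε hε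
        rw [Set.indicator_of_mem (by exact hε)]
    refine hlim.congr' ?_
    filter_upwards [self_mem_nhdsWithin] with ε hε
    rw [truncated, ← integral_indicator (hmeas ε), funext (htrunc ε hε),
      integral_add (hF.indicator (hmeas ε)) (hηcorr ε hε).1, (hηcorr ε hε).2, add_zero]

end Dyadic

/-! ### Dyadic sums -/

section Sums

/-- The function `min (q^a, q^{-b})`, which decays geometrically along dyadic scales. -/
noncomputable def profile (a b q : ℝ) : ℝ := min (q ^ a) (q ^ (-b))

lemma profile_nonneg (a b : ℝ) {q : ℝ} (hq : 0 ≤ q) : 0 ≤ profile a b q :=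
  le_min (Real.rpow_nonneg hq _) (Real.rpow_nonneg hq _)

lemma profile_eq_left {a b q : ℝ} (ha : 0 < a) (hb : 0 < b) (hq : 0 < q) (hq1 : q ≤ 1) :
    profile a b q = q ^ a :=
  min_eq_left ((Real.rpow_le_one hq.le hq1 ha.le).trans
    (Real.one_le_rpow_of_pos_of_le_one_of_nonpos hq hq1 (by linarith)))

lemma profile_eq_right {a b q : ℝ} (ha : 0 < a) (hb : 0 < b) (hq1 : 1 ≤ q) :
    profile a b q = q ^ (-b) :=
  min_eq_right ((Real.rpow_le_one_of_one_le_of_nonpos hq1 (by linarith)).trans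
    (Real.one_le_rpow hq1 ha.le))

lemma summable_profile_zpow {a b : ℝ} (ha : 0 < a) (hb : 0 < b) :
    Summable fun k : ℤ => profile a b (2 ^ k) := by
  have h2 : ∀ c : ℝ, 0 < c → Summable fun k : ℕ => ((2 : ℝ) ^ (-c)) ^ k := fun c hc =>
    summable_geometric_of_lt_one (by positivity)
      (Real.rpow_lt_one_of_one_lt_of_neg one_lt_two (by linarith))
  have e : ∀ (k : ℕ) (c : ℝ), ((2 : ℝ) ^ k) ^ c = ((2 : ℝ) ^ c) ^ k := fun k c => by
    rw [← Real.rpow_natCast, ← Real.rpow_natCast, ← Real.rpow_mul (by norm_num),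
      ← Real.rpow_mul (by norm_num), mul_comm]
  refine Summable.of_nat_of_neg ?_ ?_
  · refine Summable.of_nonneg_of_le (fun k => profile_nonneg _ _ (by positivity)) (fun k => ?_)
      (h2 b hb)
    refine (min_le_right _ _).trans (le_of_eq ?_)
    rw [zpow_natCast, e]
  · refine Summable.of_nonneg_of_le (fun k => profile_nonneg _ _ (by positivity)) (fun k => ?_)
      (h2 a ha)
    refine (min_le_left _ _).trans (le_of_eq ?_)
    rw [zpow_neg, zpow_natCast, Real.inv_rpow (by positivity), e, ← inv_pow,
      Real.rpow_neg (by norm_num)]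

/-- Sums of `profile` over dyadic scales are bounded uniformly in the reference scale. -/
lemma exists_tsum_profile_le {a b : ℝ} (ha : 0 < a) (hb : 0 < b) :
    ∃ C : ℝ, 0 ≤ C ∧ ∀ r : ℝ, 0 < r → Summable (fun k : ℤ => profile a b (2 ^ k / r)) ∧
      ∑' k : ℤ, profile a b (2 ^ k / r) ≤ C := by
  have hs := summable_profile_zpow ha hb
  refine ⟨2 ^ b * ∑' k : ℤ, profile a b (2 ^ k),
    mul_nonneg (by positivity) (tsum_nonneg fun k => profile_nonneg _ _ (by positivity)),
    fun r hr => ?_⟩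
  obtain ⟨m, hm, hm'⟩ := exists_mem_Ico_zpow (y := (2 : ℝ)) hr one_lt_two
  have hb2 : (1 : ℝ) ≤ 2 ^ b := Real.one_le_rpow one_le_two hb.le
  have hle : ∀ k : ℤ, profile a b (2 ^ k / r) ≤ 2 ^ b * profile a b (2 ^ (k - m)) := by
    intro k
    have e1 : (2 : ℝ) ^ (k - m) = 2 ^ k / 2 ^ m := zpow_sub₀ two_ne_zero _ _
    have hq : (0 : ℝ) < 2 ^ k / r := by positivity
    have hq' : (0 : ℝ) < 2 ^ (k - m) := by positivity
    rw [profile, profile, mul_min_of_nonneg _ _ (by positivity)]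
    refine min_le_min ?_ ?_
    · have h1 : (2 : ℝ) ^ k / r ≤ 2 ^ (k - m) := by rw [e1]; gcongr
      have h2 := Real.rpow_le_rpow hq.le h1 ha.le
      have h3 : (0 : ℝ) ≤ (2 ^ (k - m)) ^ a := by positivity
      nlinarith
    · refine rpow_neg_le_of_le_mul hq' two_pos hb.le ?_
      rw [e1, zpow_add_one₀ two_ne_zero] at *
      rw [div_le_iff₀ (by positivity)]
      have : (2 : ℝ) * (2 ^ k / r) * 2 ^ m = 2 ^ k * (2 ^ m * 2 / r) := by ring
      rw [this]
      have : 1 ≤ (2 : ℝ) ^ m * 2 / r := by rw [one_le_div hr]; exact hm'.le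
      nlinarith [(by positivity : (0 : ℝ) < 2 ^ k)]
  have hshift : Summable fun k : ℤ => 2 ^ b * profile a b (2 ^ (k - m)) :=
    ((Equiv.subRight m).summable_iff.2 hs).mul_left _
  have hsum := Summable.of_nonneg_of_le (fun k => profile_nonneg _ _ (by positivity)) hle hshift
  refine ⟨hsum, (hsum.tsum_le_tsum hle hshift).trans (le_of_eq ?_)⟩
  rw [tsum_mul_left]
  congr 1
  exact (Equiv.subRight m).tsum_eq fun k : ℤ => profile a b (2 ^ k)

/-- A series dominated by `A * profile` sums to at most a constant times `A`. -/
lemma exists_abs_le_of_hasSum {a b : ℝ} (ha : 0 < a) (hb : 0 < b) :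
    ∃ C : ℝ, 0 ≤ C ∧ ∀ (r A s : ℝ) (f : ℤ → ℝ), 0 < r → 0 ≤ A → HasSum f s →
      (∀ k, |f k| ≤ A * profile a b (2 ^ k / r)) → |s| ≤ C * A := by
  obtain ⟨C, hC0, hC⟩ := exists_tsum_profile_le ha hb
  refine ⟨C, hC0, fun r A s f hr hA hs hf => ?_⟩
  obtain ⟨h1, h2⟩ := hC r hr
  have h3 := (h1.mul_left A).hasSum
  have := tsum_of_norm_bounded (f := f) h3 hf
  rw [hs.tsum_eq, tsum_mul_left, Real.norm_eq_abs] at this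
  nlinarith

lemma profile_div_eq {α τ r : ℝ} (hτ : 0 < τ) (hr : 0 < r) :
    r ^ α * profile α (1 - α) (τ / r) = min (τ ^ α) (r * τ ^ (α - 1)) := by
  rw [profile, mul_min_of_nonneg _ _ (by positivity)]
  congr 1
  · rw [Real.div_rpow hτ.le hr.le]; field_simp
  · rw [neg_sub, Real.div_rpow hτ.le hr.le, Real.rpow_sub_one hr.ne']; field_simp

/-- The summation behind all Hölder bounds: increments bounded by `A min (τ^α, r τ^{α-1})` at the
scale `τ` add up to a multiple of `A r^α`. -/
lemma exists_abs_sub_le_of_hasSum {α : ℝ} (hα0 : 0 < α) (hα1 : α < 1) :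
    ∃ C : ℝ, 0 ≤ C ∧ ∀ (r A s s' : ℝ) (f f' : ℤ → ℝ), 0 < r → 0 ≤ A → HasSum f s → HasSum f' s' →
      (∀ k, |f k - f' k| ≤ A * (2 ^ k) ^ α) → (∀ k, |f k - f' k| ≤ A * (r * (2 ^ k) ^ (α - 1))) →
      |s - s'| ≤ C * A * r ^ α := by
  obtain ⟨C, hC0, hC⟩ := exists_abs_le_of_hasSum hα0 (sub_pos.2 hα1)
  refine ⟨C, hC0, fun r A s s' f f' hr hA hs hs' h1 h2 => ?_⟩
  rw [mul_assoc]
  refine hC r (A * r ^ α) (s - s') _ hr (by positivity) (hs.sub hs') fun k => ?_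
  rw [mul_assoc, profile_div_eq (by positivity) hr, mul_min_of_nonneg _ _ hA]
  exact le_min (h1 k) (h2 k)

end Sums

/-! ### Convolution with a dilated piece -/

section ScaleOp

variable {n : ℕ} {κ : Space n → ℝ} {τ : ℝ}

lemma IsPiece.hasCompactSupport (hκ : IsPiece κ) : HasCompactSupport κ :=
  HasCompactSupport.intro (isCompact_closedBall (0 : Space n) 2) fun Z hZ =>
    hκ.eq_zero Z (by simpa using hZ)

lemma IsPiece.partialDeriv (hκ : IsPiece κ) (l : Fin (n + 2)) :
    IsPiece (WeightedRiesz.partialDeriv l κ) where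
  smooth := (hκ.smooth.fderiv_right (m := ∞) (by simp)).clm_apply contDiff_const
  eq_zero Z hZ := by
    have h : κ =ᶠ[𝓝 Z] fun _ => 0 := by
      filter_upwards [(isOpen_lt continuous_const continuous_norm).mem_nhds hZ] with Y hY
      exact hκ.eq_zero Y hY
    rw [WeightedRiesz.partialDeriv, h.fderiv_eq]
    simp

lemma IsPiece.exists_bound (hκ : IsPiece κ) : ∃ B : ℝ, 0 < B ∧ ∀ Z, |κ Z| ≤ B := by
  obtain ⟨B, hB⟩ := hκ.hasCompactSupport.exists_bound_of_continuous hκ.smooth.continuous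
  exact ⟨|B| + 1, by positivity, fun Z => (hB Z).trans (by linarith [le_abs_self B])⟩

lemma IsPiece.dilate_eq_zero (hκ : IsPiece κ) (hτ : 0 < τ) {Z : Space n} (hZ : 2 * τ < ‖Z‖) :
    dilate τ κ Z = 0 := by
  rw [dilate, hκ.eq_zero, mul_zero]
  rw [norm_smul, Real.norm_of_nonneg (inv_pos.2 hτ).le, inv_mul_eq_div, lt_div_iff₀ hτ]
  exact hZ

lemma IsPiece.contDiff_dilate (hκ : IsPiece κ) : ContDiff ℝ ∞ (dilate τ κ) := by
  unfold dilate
  exact contDiff_const.mul (hκ.smooth.comp (contDiff_const_smul _))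

lemma IsPiece.hasCompactSupport_dilate (hκ : IsPiece κ) (hτ : 0 < τ) :
    HasCompactSupport (dilate τ κ) :=
  HasCompactSupport.intro (isCompact_closedBall (0 : Space n) (2 * τ)) fun Z hZ =>
    hκ.dilate_eq_zero hτ (by simpa using hZ)

lemma IsPiece.hasFDerivAt_dilate (hκ : IsPiece κ) (Z : Space n) :
    HasFDerivAt (dilate τ κ) ((τ ^ (n + 2))⁻¹ • τ⁻¹ • fderiv ℝ κ (τ⁻¹ • Z)) Z := by
  have h1 : HasFDerivAt (fun Z : Space n => τ⁻¹ • Z) (τ⁻¹ • ContinuousLinearMap.id ℝ (Space n)) Z :=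
    (hasFDerivAt_id Z).const_smul τ⁻¹
  have h2 := ((hκ.smooth.differentiable (by simp)).differentiableAt (x := τ⁻¹ • Z)).hasFDerivAt
  exact ((h2.comp Z h1).const_mul (τ ^ (n + 2))⁻¹).congr_fderiv (by ext v; simp)

lemma IsPiece.partialDeriv_dilate (hκ : IsPiece κ) (l : Fin (n + 2)) (Z : Space n) :
    fderiv ℝ (dilate τ κ) Z (basisVec l) = τ⁻¹ * dilate τ (WeightedRiesz.partialDeriv l κ) Z := by
  rw [(hκ.hasFDerivAt_dilate Z).fderiv]
  simp only [smul_apply, smul_eq_mul, dilate, WeightedRiesz.partialDeriv]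
  ring

lemma IsPiece.integrable_mul (hκ : IsPiece κ) (hτ : 0 < τ) {g : Space n → ℝ} (hg : Continuous g)
    (X : Space n) : Integrable fun Y => dilate τ κ (X - Y) * g Y := by
  refine Continuous.integrable_of_hasCompactSupport
    ((hκ.contDiff_dilate.continuous.comp (by fun_prop)).mul hg) ?_
  refine HasCompactSupport.intro (isCompact_closedBall X (2 * τ)) fun Y hY => ?_
  rw [hκ.dilate_eq_zero hτ, zero_mul]
  simpa [dist_eq_norm, norm_sub_rev] using hY

lemma integral_dilate_sub (h0 : ∫ Z, κ Z = 0) (X : Space n) :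
    ∫ Y, dilate τ κ (X - Y) = 0 := by
  rw [integral_sub_left_eq_self (dilate τ κ) volume X]
  simp only [dilate]
  rw [integral_const_mul, Measure.integral_comp_smul, h0, smul_zero, mul_zero]

/-- Integration by parts. -/
lemma IsPiece.scaleOp_partialDeriv (hκ : IsPiece κ) (hτ : 0 < τ) (k : Fin (n + 2))
    {F : Space n → ℝ} (hF : Differentiable ℝ F) (hF' : Continuous (WeightedRiesz.partialDeriv k F))
    (X : Space n) : scaleOp τ κ (WeightedRiesz.partialDeriv k F) X =
      τ⁻¹ * scaleOp τ (WeightedRiesz.partialDeriv k κ) F X := by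
  have hd : ∀ Y, HasFDerivAt (fun Y => dilate τ κ (X - Y))
      (-(fderiv ℝ (dilate τ κ) (X - Y))) Y := fun Y => by
    have h1 : HasFDerivAt (fun Y : Space n => X - Y) (-ContinuousLinearMap.id ℝ (Space n)) Y := by
      simpa using (hasFDerivAt_id Y).const_sub X
    have h2 := (hκ.hasFDerivAt_dilate (τ := τ) (X - Y)).differentiableAt.hasFDerivAt
    exact (h2.comp Y h1).congr_fderiv (by ext v; simp)
  have hd' : ∀ Y, fderiv ℝ (fun Y => dilate τ κ (X - Y)) Y (basisVec k) =
      -(τ⁻¹ * dilate τ (WeightedRiesz.partialDeriv k κ) (X - Y)) := fun Y => by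
    rw [(hd Y).fderiv, neg_apply, hκ.partialDeriv_dilate]
  have hi : Integrable fun Y => dilate τ (WeightedRiesz.partialDeriv k κ) (X - Y) * F Y :=
    (hκ.partialDeriv k).integrable_mul hτ hF.continuous X
  have h := integral_mul_fderiv_eq_neg_fderiv_mul_of_integrable (μ := (volume : Measure (Space n)))
    (f := fun Y => dilate τ κ (X - Y)) (g := F) (v := basisVec k)
    (by simp only [hd']
        convert (hi.const_mul τ⁻¹).neg using 2
        simp [mul_assoc])
    (hκ.integrable_mul hτ hF' X) (hκ.integrable_mul hτ hF.continuous X)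
    (fun Y _ => (hd Y).differentiableAt) (fun Y _ => hF Y)
  rw [scaleOp, scaleOp, ← integral_const_mul]
  refine h.trans ?_
  rw [← integral_neg]
  refine integral_congr_ae (Eventually.of_forall fun Y => ?_)
  simp only [hd']
  ring

lemma IsPiece.integral_partialDeriv (hκ : IsPiece κ) (l : Fin (n + 2)) :
    ∫ Z, WeightedRiesz.partialDeriv l κ Z = 0 := by
  have hi : ∀ {κ : Space n → ℝ}, IsPiece κ → Integrable κ := fun h =>
    h.smooth.continuous.integrable_of_hasCompactSupport h.hasCompactSupport
  have h := integral_mul_fderiv_eq_neg_fderiv_mul_of_integrable (μ := (volume : Measure (Space n)))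
    (f := fun _ => (1 : ℝ)) (g := κ) (v := basisVec l)
    (by simp) (by simpa using! hi (hκ.partialDeriv l)) (by simpa using hi hκ)
    (fun Y _ => differentiableAt_const _) (fun Y _ => hκ.smooth.differentiable (by simp) Y)
  simpa using! h

lemma IsPiece.scaleOp_sub_const (hκ : IsPiece κ) (hτ : 0 < τ) (h0 : ∫ Z, κ Z = 0) {g : Space n → ℝ}
    (hg : Continuous g) (c : ℝ) (X : Space n) :
    scaleOp τ κ (fun Y => g Y - c) X = scaleOp τ κ g X := by
  simp only [scaleOp, mul_sub]
  rw [integral_sub (hκ.integrable_mul hτ hg X) (hκ.integrable_mul hτ continuous_const X),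
    integral_mul_const, integral_dilate_sub h0, zero_mul, sub_zero]

lemma IsPiece.differentiableAt_scaleOp (hκ : IsPiece κ) (hτ : 0 < τ) {g : Space n → ℝ}
    (hg : Continuous g) (X : Space n) : DifferentiableAt ℝ (scaleOp τ κ g) X ∧
      ∀ l, fderiv ℝ (scaleOp τ κ g) X (basisVec l) =
        τ⁻¹ * scaleOp τ (WeightedRiesz.partialDeriv l κ) g X := by
  have hconv : scaleOp τ κ g =
      convolution (dilate τ κ) g (ContinuousLinearMap.mul ℝ ℝ) volume := by
    funext X
    rw [convolution_eq_swap]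
    rfl
  have h := (hκ.hasCompactSupport_dilate hτ).hasFDerivAt_convolution_left
    (ContinuousLinearMap.mul ℝ ℝ) (hκ.contDiff_dilate.of_le (by simp))
    (hg.locallyIntegrable (μ := volume)) X
  rw [← hconv] at h
  refine ⟨h.differentiableAt, fun l => ?_⟩
  rw [h.fderiv, convolution_eq_swap, scaleOp, ← integral_const_mul,
    ContinuousLinearMap.integral_apply]
  · refine integral_congr_ae (Eventually.of_forall fun Y => ?_)
    simp only [ContinuousLinearMap.precompL_apply, ContinuousLinearMap.mul_apply',
      hκ.partialDeriv_dilate]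
    ring
  · have hc := hκ.contDiff_dilate (τ := τ)
    refine Continuous.integrable_of_hasCompactSupport ?_ ?_
    · have h1 : Continuous fun Y : Space n => fderiv ℝ (dilate τ κ) (X - Y) :=
        (hc.continuous_fderiv (by simp)).comp (by fun_prop)
      exact ((ContinuousLinearMap.precompL (Space n)
        (ContinuousLinearMap.mul ℝ ℝ)).continuous₂).comp (h1.prodMk hg)
    · refine HasCompactSupport.intro (isCompact_closedBall X (2 * τ)) fun Y hY => ?_
      have hY' : 2 * τ < ‖X - Y‖ := by simpa [dist_eq_norm, norm_sub_rev] using hY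
      have hz : dilate τ κ =ᶠ[𝓝 (X - Y)] fun _ => 0 := by
        filter_upwards [(isOpen_lt continuous_const continuous_norm).mem_nhds hY'] with Z hZ
        exact hκ.dilate_eq_zero hτ hZ
      rw [hz.fderiv_eq]
      simp

end ScaleOp

/-! ### Bounds at a single scale -/

section SingleScale

variable {n : ℕ} {κ : Space n → ℝ} {τ : ℝ}

lemma norm_basisVec (l : Fin (n + 2)) : ‖(basisVec l : Space n)‖ = 1 := by simp [basisVec]

lemma abs_apply_basisVec_le (L : Space n →L[ℝ] ℝ) (l : Fin (n + 2)) : |L (basisVec l)| ≤ ‖L‖ := by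
  simpa [norm_basisVec] using L.le_opNorm (basisVec l)

lemma norm_le_of_abs_apply_basisVec_le (L : Space n →L[ℝ] ℝ) {B : ℝ} (hB : 0 ≤ B)
    (h : ∀ l, |L (basisVec l)| ≤ B) : ‖L‖ ≤ ((n : ℝ) + 2) * B := by
  refine L.opNorm_le_bound (by positivity) fun v => ?_
  have hv : v = ∑ l, v l • (basisVec l : Space n) := by
    have := (EuclideanSpace.basisFun (Fin (n + 2)) ℝ).sum_repr v
    simpa [basisVec] using this.symm
  have h1 : L v = ∑ l, v l * L (basisVec l) := by
    conv_lhs => rw [hv]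
    simp
  rw [h1]
  calc _ ≤ ∑ l, ‖v l * L (basisVec l)‖ := norm_sum_le _ _
    _ ≤ ∑ _l : Fin (n + 2), ‖v‖ * B := by
        refine Finset.sum_le_sum fun l _ => ?_
        rw [norm_mul]
        exact mul_le_mul (abs_coord_le_norm v l) (h l) (norm_nonneg _) (norm_nonneg _)
    _ = _ := by simp; ring

lemma abs_sub_le_of_fderiv_le {f : Space n → ℝ} {X : Space n} {r B : ℝ}
    (hf : ∀ Y, ‖X - Y‖ ≤ r → DifferentiableAt ℝ f Y) (hB : ∀ Y, ‖X - Y‖ ≤ r → ‖fderiv ℝ f Y‖ ≤ B)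
    {Y : Space n} (hY : ‖X - Y‖ ≤ r) : |f Y - f X| ≤ B * ‖X - Y‖ := by
  have hm : ∀ Z ∈ Metric.closedBall X r, ‖X - Z‖ ≤ r := fun Z hZ => by
    rwa [← dist_eq_norm, dist_comm]
  have h := (convex_closedBall X r).norm_image_sub_le_of_norm_fderiv_le (𝕜 := ℝ) (f := f) (C := B)
    (fun Z hZ => hf Z (hm Z hZ)) (fun Z hZ => hB Z (hm Z hZ)) (x := X) (y := Y)
    (Metric.mem_closedBall_self ((norm_nonneg _).trans hY))
    (by rw [Metric.mem_closedBall, dist_eq_norm, norm_sub_rev]; exact hY)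
  rwa [Real.norm_eq_abs, norm_sub_rev Y X] at h

lemma continuous_of_norm_sub_le_rpow {E : Type*} [NormedAddCommGroup E] {f : Space n → E} {α B : ℝ}
    (hα : 0 < α) (h : ∀ X Y, ‖f X - f Y‖ ≤ B * ‖X - Y‖ ^ α) : Continuous f := by
  rw [continuous_iff_continuousAt]
  intro X
  rw [ContinuousAt, tendsto_iff_norm_sub_tendsto_zero]
  refine squeeze_zero (fun _ => norm_nonneg _) (fun Y => h Y X) ?_
  have h1 : Continuous fun Y : Space n => B * ‖Y - X‖ ^ α :=
    continuous_const.mul (Continuous.rpow_const (by fun_prop) fun _ => Or.inr hα.le)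
  simpa [Real.zero_rpow hα.ne'] using h1.tendsto X

/-- Convolution with a dilate at scale `τ` is bounded by averages over balls of radius `2 τ`. -/
lemma IsPiece.exists_abs_scaleOp_le_average (hκ : IsPiece κ) : ∃ C : ℝ, 0 ≤ C ∧
    ∀ (τ : ℝ) (F G : Space n → ℝ) (X : Space n), 0 < τ →
      IntegrableOn G (Metric.closedBall X (2 * τ)) → (∀ Y, ‖X - Y‖ ≤ 2 * τ → |F Y| ≤ G Y) →
      |scaleOp τ κ F X| ≤ C * ((τ ^ (n + 2))⁻¹ * ∫ Y in Metric.closedBall X (2 * τ), G Y) := by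
  obtain ⟨B, hB0, hB⟩ := hκ.exists_bound
  refine ⟨B, hB0.le, fun τ F G X hτ hG hF => ?_⟩
  have hi : Integrable (Set.indicator (Metric.closedBall X (2 * τ))
      fun Y => B * (τ ^ (n + 2))⁻¹ * G Y) :=
    (integrable_indicator_iff measurableSet_closedBall).2 (hG.const_mul _)
  have h := norm_integral_le_of_norm_le hi (f := fun Y => dilate τ κ (X - Y) * F Y)
    (Eventually.of_forall fun Y => ?_)
  · rw [integral_indicator measurableSet_closedBall, integral_const_mul] at h
    rw [← mul_assoc]
    exact h
  · by_cases hY : ‖X - Y‖ ≤ 2 * τ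
    · rw [Set.indicator_of_mem (by rw [Metric.mem_closedBall, dist_eq_norm, norm_sub_rev]; exact hY),
        norm_mul, dilate, norm_mul, Real.norm_of_nonneg (by positivity : (0 : ℝ) ≤ (τ ^ (n + 2))⁻¹)]
      calc _ ≤ (τ ^ (n + 2))⁻¹ * B * G Y := by
            gcongr
            · exact hB _
            · exact hF Y hY
        _ = _ := by ring
    · rw [hκ.dilate_eq_zero hτ (not_le.1 hY), zero_mul, norm_zero,
        Set.indicator_of_notMem]
      rw [Metric.mem_closedBall, dist_eq_norm, norm_sub_rev]
      exact hY

/-- The volume of the ball of radius `2`. -/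
noncomputable def ballVolume (n : ℕ) : ℝ :=
  2 ^ (n + 2) * (volume (Metric.closedBall (0 : Space n) 1)).toReal

lemma ballVolume_nonneg (n : ℕ) : 0 ≤ ballVolume n := by unfold ballVolume; positivity

lemma average_const (hτ : 0 < τ) (X : Space n) (c : ℝ) :
    (τ ^ (n + 2))⁻¹ * ∫ _Y in Metric.closedBall X (2 * τ), c = ballVolume n * c := by
  rw [setIntegral_const, smul_eq_mul, measureReal_def,
    Measure.addHaar_closedBall' _ _ (by positivity),
    ENNReal.toReal_mul, ENNReal.toReal_ofReal (by positivity), finrank_euclideanSpace_fin,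
    ballVolume, mul_pow]
  field_simp

lemma IsPiece.exists_abs_scaleOp_le (hκ : IsPiece κ) : ∃ C : ℝ, 0 ≤ C ∧
    ∀ (τ B : ℝ) (F : Space n → ℝ) (X : Space n), 0 < τ → (∀ Y, ‖X - Y‖ ≤ 2 * τ → |F Y| ≤ B) →
      |scaleOp τ κ F X| ≤ C * B := by
  obtain ⟨C, hC0, hC⟩ := hκ.exists_abs_scaleOp_le_average
  refine ⟨C * ballVolume n, mul_nonneg hC0 (ballVolume_nonneg n), fun τ B F X hτ hF => ?_⟩
  have h := hC τ F (fun _ => B) X hτ (integrableOn_const measure_closedBall_lt_top.ne) hF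
  rwa [average_const hτ, ← mul_assoc] at h

/-- The commutator of multiplication by `u` with the convolution at scale `τ`, applied to `g`. -/
noncomputable def commOp (τ : ℝ) (κ u g : Space n → ℝ) (X : Space n) : ℝ :=
  scaleOp τ κ (fun Y => (u Y - u X) * g Y) X

lemma IsPiece.commOp_eq (hκ : IsPiece κ) (hτ : 0 < τ) {u g : Space n → ℝ} (hu : Continuous u)
    (hg : Continuous g) (X : Space n) :
    commOp τ κ u g X = scaleOp τ κ (fun Y => u Y * g Y) X - u X * scaleOp τ κ g X := by
  have hi : Integrable fun Y => dilate τ κ (X - Y) * (u Y * g Y) :=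
    hκ.integrable_mul hτ (hu.mul hg) X
  rw [commOp, scaleOp, scaleOp, scaleOp, ← integral_const_mul,
    ← integral_sub hi ((hκ.integrable_mul hτ hg X).const_mul _)]
  refine integral_congr_ae (Eventually.of_forall fun Y => ?_)
  simp only
  ring

lemma IsPiece.differentiableAt_commOp (hκ : IsPiece κ) (hτ : 0 < τ) {u g : Space n → ℝ}
    (hu : Differentiable ℝ u) (hg : Continuous g) (X : Space n) :
    DifferentiableAt ℝ (commOp τ κ u g) X ∧
      ∀ l, fderiv ℝ (commOp τ κ u g) X (basisVec l) =
        τ⁻¹ * commOp τ (WeightedRiesz.partialDeriv l κ) u g X -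
          WeightedRiesz.partialDeriv l u X * scaleOp τ κ g X := by
  obtain ⟨h1, h1'⟩ := hκ.differentiableAt_scaleOp hτ (hu.continuous.mul hg) X
  obtain ⟨h2, h2'⟩ := hκ.differentiableAt_scaleOp hτ hg X
  have h := h1.hasFDerivAt.sub ((hu X).hasFDerivAt.mul h2.hasFDerivAt)
  have heq : commOp τ κ u g =
      (scaleOp τ κ (u * g)) - (u * scaleOp τ κ g) := by
    funext Y; exact hκ.commOp_eq hτ hu.continuous hg Y
  rw [heq]
  refine ⟨h.differentiableAt, fun l => ?_⟩
  rw [h.fderiv, (hκ.partialDeriv l).commOp_eq hτ hu.continuous hg]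
  have e1 : fderiv ℝ (scaleOp τ κ (u * g)) X (basisVec l) =
      τ⁻¹ * scaleOp τ (WeightedRiesz.partialDeriv l κ) (fun Y => u Y * g Y) X := h1' l
  simp only [sub_apply, add_apply, smul_apply, smul_eq_mul, e1, h2' l]
  rw [WeightedRiesz.partialDeriv]
  ring

lemma continuous_partialDeriv {f : Space n → ℝ} (hf : Continuous (fderiv ℝ f)) (l : Fin (n + 2)) :
    Continuous (WeightedRiesz.partialDeriv l f) :=
  hf.clm_apply continuous_const

/-- Integration by parts in the commutator: `c` may be any constant. -/
lemma IsPiece.commOp_partialDeriv (hκ : IsPiece κ) (hτ : 0 < τ) (k : Fin (n + 2))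
    {u w : Space n → ℝ} (hu : Differentiable ℝ u) (hu' : Continuous (fderiv ℝ u))
    (hw : Differentiable ℝ w) (hw' : Continuous (fderiv ℝ w)) (c : ℝ) (X : Space n) :
    commOp τ κ u (WeightedRiesz.partialDeriv k w) X =
      τ⁻¹ * scaleOp τ (WeightedRiesz.partialDeriv k κ) (fun Y => (u Y - u X) * (w Y - c)) X -
        scaleOp τ κ (fun Y => WeightedRiesz.partialDeriv k u Y * (w Y - c)) X := by
  have hF : ∀ Y, HasFDerivAt (fun Y => (u Y - u X) * (w Y - c))
      ((u Y - u X) • fderiv ℝ w Y + (w Y - c) • fderiv ℝ u Y) Y := fun Y =>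
    ((hu Y).hasFDerivAt.sub_const _).mul ((hw Y).hasFDerivAt.sub_const _)
  have hF' : WeightedRiesz.partialDeriv k (fun Y => (u Y - u X) * (w Y - c)) =
      fun Y => (u Y - u X) * WeightedRiesz.partialDeriv k w Y +
        WeightedRiesz.partialDeriv k u Y * (w Y - c) := by
    funext Y
    simp only [WeightedRiesz.partialDeriv, (hF Y).fderiv, add_apply, smul_apply, smul_eq_mul]
    ring
  have hku := continuous_partialDeriv hu' k
  have hkw := continuous_partialDeriv hw' k
  have hc1 : Continuous fun Y => (u Y - u X) * WeightedRiesz.partialDeriv k w Y :=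
    (hu.continuous.sub continuous_const).mul hkw
  have hc2 : Continuous fun Y => WeightedRiesz.partialDeriv k u Y * (w Y - c) :=
    hku.mul (hw.continuous.sub continuous_const)
  have h := hκ.scaleOp_partialDeriv hτ k (F := fun Y => (u Y - u X) * (w Y - c))
    (fun Y => (hF Y).differentiableAt) (by rw [hF']; exact hc1.add hc2) X
  have hi : Integrable fun Y => dilate τ κ (X - Y) * ((u Y - u X) *
      WeightedRiesz.partialDeriv k w Y + WeightedRiesz.partialDeriv k u Y * (w Y - c)) :=
    hκ.integrable_mul hτ (hc1.add hc2) X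
  rw [← h, hF', commOp, scaleOp, scaleOp, scaleOp,
    ← integral_sub hi (hκ.integrable_mul hτ hc2 X)]
  refine integral_congr_ae (Eventually.of_forall fun Y => ?_)
  simp only
  ring

end SingleScale

/-- The functions `u`, `w` of the commutator estimate and their quantitative bounds, for abstract
weights: `h`, which replaces `f_±`, varies by at most the factor `A` over distances `2 ρ`, and the
averages of `h * h₁`, where `h₁` replaces `f_1`, over balls of radius `2 τ ≥ 2 ρ` decay like
`(ρ/τ)^ε`. The scales `ρ`, `R`, `M` are `(1 + μ₁ t)^{1/2}`, `(μ₁ t)^{1/2}` and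
`max (R, R^{1 - α})`, and `U`, `W` are multiples of the norms of `u` and `w`. In the Hölder bounds of
`w` the weight has been estimated by `h₁ ≤ 1`. -/
structure CommData (n : ℕ) (α ε A : ℝ) where
  ρ : ℝ
  R : ℝ
  M : ℝ
  U : ℝ
  W : ℝ
  h : Space n → ℝ
  h₁ : Space n → ℝ
  u : Space n → ℝ
  w : Space n → ℝ
  one_le_rho : 1 ≤ ρ
  R_pos : 0 < R
  R_le : R ≤ ρ
  M_pos : 0 < M
  M_le : M ≤ ρ * R ^ (1 - α)
  U_nonneg : 0 ≤ U
  W_nonneg : 0 ≤ W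
  h_pos : ∀ X, 0 < h X
  h_le_one : ∀ X, h X ≤ 1
  h_meas : Measurable h
  h_near : ∀ X Y, ‖X - Y‖ ≤ 2 * ρ → h Y ≤ A * h X
  h₁_pos : ∀ X, 0 < h₁ X
  h₁_le_one : ∀ X, h₁ X ≤ 1
  h₁_meas : Measurable h₁
  h₁_int : ∀ X, Integrable fun Y => (1 + ‖X - Y‖) ^ (-((n : ℝ) + 2)) * h₁ Y
  avg : ∀ τ X, ρ ≤ τ → (τ ^ (n + 2))⁻¹ * ∫ Y in Metric.closedBall X (2 * τ), h Y * h₁ Y ≤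
    A * (ρ / τ) ^ ε * h X
  u_diff : Differentiable ℝ u
  w_diff : Differentiable ℝ w
  u_le : ∀ X, |u X| ≤ U * h X
  u_holder : ∀ X Y, |u X - u Y| ≤ U * (h X + h Y) * ‖X - Y‖ ^ α
  du_le : ∀ X, ‖fderiv ℝ u X‖ ≤ U * ρ⁻¹ * h X
  du_holder : ∀ X Y, ‖fderiv ℝ u X - fderiv ℝ u Y‖ ≤
    U * ρ⁻¹ * (ρ ^ α)⁻¹ * (h X + h Y) * ‖X - Y‖ ^ α
  w_le : ∀ X, |w X| ≤ W * h₁ X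
  w_holder : ∀ X Y, |w X - w Y| ≤ 2 * W * ‖X - Y‖ ^ α
  dw_le : ∀ X, ‖fderiv ℝ w X‖ ≤ W * M⁻¹ * h₁ X
  dw_holder : ∀ X Y, ‖fderiv ℝ w X - fderiv ℝ w Y‖ ≤ 2 * W * M⁻¹ * (R ^ α)⁻¹ * ‖X - Y‖ ^ α

namespace CommData

variable {n : ℕ} {α ε A : ℝ} (D : CommData n α ε A) {κ : Space n → ℝ} {τ : ℝ}

/-- The partial derivative `∂_k w` to which the commutator is applied. -/
noncomputable def g (k : Fin (n + 2)) : Space n → ℝ := WeightedRiesz.partialDeriv k D.w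

lemma rho_pos : 0 < D.ρ := zero_lt_one.trans_le D.one_le_rho

lemma A_ge_one (D : CommData n α ε A) : 1 ≤ A := by
  have h1 := D.h_near 0 0 (by simpa using D.rho_pos.le)
  have h2 := D.h_pos 0
  by_contra hA
  nlinarith [not_le.1 hA]

lemma continuous_fderiv_u (hα : 0 < α) : Continuous (fderiv ℝ D.u) := by
  refine continuous_of_norm_sub_le_rpow (B := D.U * D.ρ⁻¹ * (D.ρ ^ α)⁻¹ * 2) hα fun X Y =>
    (D.du_holder X Y).trans ?_
  have := D.U_nonneg
  have := D.rho_pos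
  gcongr
  linarith [D.h_le_one X, D.h_le_one Y]

lemma continuous_fderiv_w (hα : 0 < α) : Continuous (fderiv ℝ D.w) :=
  continuous_of_norm_sub_le_rpow hα D.dw_holder

lemma continuous_g (hα : 0 < α) (k : Fin (n + 2)) : Continuous (D.g k) :=
  continuous_partialDeriv (D.continuous_fderiv_w hα) k

lemma abs_g_le (k : Fin (n + 2)) (X : Space n) : |D.g k X| ≤ D.W * D.M⁻¹ :=
  (abs_apply_basisVec_le _ _).trans ((D.dw_le X).trans (mul_le_of_le_one_right
    (mul_nonneg D.W_nonneg (inv_pos.2 D.M_pos).le) (D.h₁_le_one X)))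

lemma abs_g_sub_le (k : Fin (n + 2)) (X Y : Space n) :
    |D.g k X - D.g k Y| ≤ 2 * D.W * D.M⁻¹ * (D.R ^ α)⁻¹ * ‖X - Y‖ ^ α :=
  (abs_apply_basisVec_le (fderiv ℝ D.w X - fderiv ℝ D.w Y) k).trans (D.dw_holder X Y)

lemma abs_partialDeriv_u_le (l : Fin (n + 2)) (X : Space n) :
    |WeightedRiesz.partialDeriv l D.u X| ≤ D.U * D.ρ⁻¹ * D.h X :=
  (abs_apply_basisVec_le _ _).trans (D.du_le X)

lemma abs_partialDeriv_u_sub_le (l : Fin (n + 2)) (X Y : Space n) :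
    |WeightedRiesz.partialDeriv l D.u X - WeightedRiesz.partialDeriv l D.u Y| ≤
      D.U * D.ρ⁻¹ * (D.ρ ^ α)⁻¹ * (D.h X + D.h Y) * ‖X - Y‖ ^ α :=
  (abs_apply_basisVec_le (fderiv ℝ D.u X - fderiv ℝ D.u Y) l).trans (D.du_holder X Y)

lemma abs_u_sub_le_near (hτ : τ ≤ D.ρ) {X Y : Space n} (hY : ‖X - Y‖ ≤ 2 * τ) :
    |D.u Y - D.u X| ≤ D.U * D.ρ⁻¹ * (A * D.h X) * (2 * τ) := by
  have hA := D.A_ge_one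
  have hU := D.U_nonneg
  have hρ := D.rho_pos
  have hX := D.h_pos X
  refine (abs_sub_le_of_fderiv_le (r := 2 * τ) (B := D.U * D.ρ⁻¹ * (A * D.h X))
    (fun Z _ => D.u_diff Z) (fun Z hZ => (D.du_le Z).trans ?_) hY).trans ?_
  · gcongr
    exact D.h_near X Z (by linarith)
  · gcongr

lemma rpow_two_mul_le (hα0 : 0 < α) (hα1 : α < 1) (hτ : 0 < τ) {r : ℝ} (hr0 : 0 ≤ r)
    (hr : r ≤ 2 * τ) : r ^ α ≤ 2 * τ ^ α := by
  calc r ^ α ≤ (2 * τ) ^ α := Real.rpow_le_rpow hr0 hr hα0.le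
    _ = 2 ^ α * τ ^ α := Real.mul_rpow (by norm_num) hτ.le
    _ ≤ 2 ^ (1 : ℝ) * τ ^ α := by gcongr; norm_num
    _ = _ := by rw [Real.rpow_one]

end CommData

/-! ### Commutators at a single scale -/

namespace CommData

variable {n : ℕ} {α ε A : ℝ} {κ : Space n → ℝ}

lemma M_mul_le (D : CommData n α ε A) : D.M * D.R ^ α ≤ D.ρ * D.R := by
  have hR := D.R_pos
  calc D.M * D.R ^ α ≤ D.ρ * D.R ^ (1 - α) * D.R ^ α := by gcongr; exact D.M_le
    _ = D.ρ * D.R := by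
      rw [mul_assoc, ← Real.rpow_add hR]; simp

lemma integrableOn_mul (D : CommData n α ε A) (X : Space n) (r : ℝ) :
    IntegrableOn (fun Y => D.h Y * D.h₁ Y) (Metric.closedBall X r) := by
  refine (integrableOn_const (C := (1 : ℝ)) measure_closedBall_lt_top.ne).mono'
    (D.h_meas.mul D.h₁_meas).aestronglyMeasurable (Eventually.of_forall fun Y => ?_)
  rw [Real.norm_of_nonneg (mul_pos (D.h_pos Y) (D.h₁_pos Y)).le]
  exact mul_le_one₀ (D.h_le_one Y) (D.h₁_pos Y).le (D.h₁_le_one Y)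

/-- Size of the commutator at the scale `τ`, after integrating by parts to replace `∂_k w` by `w`:
for `τ ≤ ρ` the smoothness of `u` and `w` is used, for `τ ≥ ρ` the averages of the weights. -/
lemma exists_abs_commOp_le (hα0 : 0 < α) (hα1 : α < 1) (hε0 : 0 < ε) (hε1 : ε ≤ 1)
    (hκ : IsPiece κ) (k : Fin (n + 2)) : ∃ C : ℝ, 0 ≤ C ∧ ∀ (D : CommData n α ε A) (τ : ℝ)
      (X : Space n), 0 < τ → |commOp τ κ D.u (D.g k) X| ≤
        C * (D.U * D.W * D.h X) * (D.ρ ^ (α - 1) * profile α ε (τ / D.ρ)) := by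
  obtain ⟨C₀, hC₀, H₀⟩ := hκ.exists_abs_scaleOp_le
  obtain ⟨C₁, hC₁, H₁⟩ := (hκ.partialDeriv k).exists_abs_scaleOp_le
  obtain ⟨C₂, hC₂, H₂⟩ := hκ.exists_abs_scaleOp_le_average
  obtain ⟨C₃, hC₃, H₃⟩ := (hκ.partialDeriv k).exists_abs_scaleOp_le_average
  have hV := ballVolume_nonneg n
  refine ⟨8 * C₁ * |A| + 4 * C₀ * |A| + C₃ * (ballVolume n + |A|) + C₂ * |A|, by positivity,
    fun D τ X hτ => ?_⟩
  have hA1 : 1 ≤ A := D.A_ge_one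
  rw [abs_of_nonneg (by linarith : 0 ≤ A)]
  have hU := D.U_nonneg
  have hW := D.W_nonneg
  have hρ := D.rho_pos
  have hX := D.h_pos X
  have hUWh : 0 ≤ D.U * D.W * D.h X := by positivity
  have hdiff := fun c => hκ.commOp_partialDeriv hτ k D.u_diff (D.continuous_fderiv_u hα0) D.w_diff
    (D.continuous_fderiv_w hα0) c X
  rcases le_total τ D.ρ with hτρ | hτρ
  · -- `c = w X` in the integration by parts: both `u` and `w` are subtracted at `X`
    have hw : ∀ Y, ‖X - Y‖ ≤ 2 * τ → |D.w Y - D.w X| ≤ 4 * D.W * τ ^ α := fun Y hY => by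
      rw [abs_sub_comm]
      refine (D.w_holder X Y).trans ?_
      have := rpow_two_mul_le hα0 hα1 hτ (norm_nonneg (X - Y)) hY
      calc _ ≤ 2 * D.W * (2 * τ ^ α) := by gcongr
        _ = _ := by ring
    have hprof : D.ρ ^ (α - 1) * profile α ε (τ / D.ρ) = D.ρ⁻¹ * τ ^ α := by
      rw [profile_eq_left hα0 hε0 (by positivity) ((div_le_one hρ).2 hτρ),
        Real.div_rpow hτ.le hρ.le, Real.rpow_sub_one hρ.ne']
      field_simp
    have b1 := H₁ τ (D.U * D.ρ⁻¹ * (A * D.h X) * (2 * τ) * (4 * D.W * τ ^ α))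
      (fun Y => (D.u Y - D.u X) * (D.w Y - D.w X)) X hτ fun Y hY => by
        rw [abs_mul]
        exact mul_le_mul (D.abs_u_sub_le_near hτρ hY) (hw Y hY) (abs_nonneg _) (by positivity)
    have b2 := H₀ τ (D.U * D.ρ⁻¹ * (A * D.h X) * (4 * D.W * τ ^ α))
      (fun Y => partialDeriv k D.u Y * (D.w Y - D.w X)) X hτ fun Y hY => by
        rw [abs_mul]
        refine mul_le_mul ((D.abs_partialDeriv_u_le k Y).trans ?_) (hw Y hY) (abs_nonneg _)
          (by positivity)
        gcongr
        exact D.h_near X Y (by linarith)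
    rw [hprof, g, hdiff (D.w X)]
    refine (abs_sub _ _).trans ?_
    rw [abs_mul, abs_of_pos (inv_pos.2 hτ)]
    calc _ ≤ τ⁻¹ * (C₁ * (D.U * D.ρ⁻¹ * (A * D.h X) * (2 * τ) * (4 * D.W * τ ^ α))) +
          C₀ * (D.U * D.ρ⁻¹ * (A * D.h X) * (4 * D.W * τ ^ α)) := by gcongr
      _ = (8 * C₁ * A + 4 * C₀ * A) * (D.U * D.W * D.h X) * (D.ρ⁻¹ * τ ^ α) := by
          field_simp; ring
      _ ≤ _ := by
          have h1 : 0 ≤ C₃ * (ballVolume n + A) := by positivity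
          have h2 : 0 ≤ C₂ * A := by positivity
          exact mul_le_mul_of_nonneg_right (mul_le_mul_of_nonneg_right (by linarith) hUWh)
            (by positivity)
  · -- `c = 0` in the integration by parts: the differences are estimated by the weights
    set q := (D.ρ / τ) ^ ε with hq
    have hq0 : 0 ≤ q := by positivity
    have hq1 : q ≤ 1 := Real.rpow_le_one (by positivity) ((div_le_one hτ).2 hτρ) hε0.le
    have hτinv : τ⁻¹ ≤ D.ρ⁻¹ * q := by
      have h1 : D.ρ / τ ≤ q := by
        have := Real.rpow_le_rpow_of_exponent_ge (x := D.ρ / τ) (by positivity)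
          ((div_le_one hτ).2 hτρ) hε1
        rwa [Real.rpow_one] at this
      calc τ⁻¹ = D.ρ⁻¹ * (D.ρ / τ) := by field_simp
        _ ≤ _ := by gcongr
    have hprof : D.ρ⁻¹ * q ≤ D.ρ ^ (α - 1) * profile α ε (τ / D.ρ) := by
      rw [profile_eq_right hα0 hε0 ((one_le_div hρ).2 hτρ), Real.rpow_sub_one hρ.ne']
      have h1 : (1 : ℝ) ≤ D.ρ ^ α := Real.one_le_rpow D.one_le_rho hα0.le
      have h2 : (τ / D.ρ) ^ (-ε) = q := by
        rw [Real.rpow_neg (by positivity), ← Real.inv_rpow (by positivity), inv_div]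
      rw [h2, div_eq_mul_inv]
      have h3 : 0 ≤ D.ρ⁻¹ * q := by positivity
      nlinarith
    have havg := D.avg τ X hτρ
    have hint := D.integrableOn_mul X (2 * τ)
    have hc : IntegrableOn (fun _ : Space n => D.U * D.W * D.h X)
      (Metric.closedBall X (2 * τ)) := integrableOn_const measure_closedBall_lt_top.ne
    have b1 := H₃ τ (fun Y => (D.u Y - D.u X) * (D.w Y - 0))
      (fun Y => D.U * D.W * D.h X + D.U * D.W * (D.h Y * D.h₁ Y)) X hτ
      (hc.add (hint.const_mul _)) fun Y _ => by
        rw [sub_zero, abs_mul]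
        have h1 : |D.u Y - D.u X| ≤ D.U * D.h Y + D.U * D.h X :=
          (abs_sub _ _).trans (add_le_add (D.u_le Y) (D.u_le X))
        have hY := D.h_pos Y
        have hY1 := D.h₁_pos Y
        calc _ ≤ (D.U * D.h Y + D.U * D.h X) * (D.W * D.h₁ Y) :=
              mul_le_mul h1 (D.w_le Y) (abs_nonneg _) (by positivity)
          _ = D.U * D.W * D.h X * D.h₁ Y + D.U * D.W * (D.h Y * D.h₁ Y) := by ring
          _ ≤ _ := add_le_add (mul_le_of_le_one_right hUWh (D.h₁_le_one Y)) le_rfl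
    have b2 := H₂ τ (fun Y => partialDeriv k D.u Y * (D.w Y - 0))
      (fun Y => D.U * D.ρ⁻¹ * D.W * (D.h Y * D.h₁ Y)) X hτ (hint.const_mul _) fun Y _ => by
        rw [sub_zero, abs_mul]
        have hY := D.h_pos Y
        calc _ ≤ (D.U * D.ρ⁻¹ * D.h Y) * (D.W * D.h₁ Y) :=
              mul_le_mul (D.abs_partialDeriv_u_le k Y) (D.w_le Y) (abs_nonneg _) (by positivity)
          _ = _ := by ring
    rw [integral_add hc (hint.const_mul _), mul_add, average_const hτ, integral_const_mul,
      mul_left_comm (τ ^ (n + 2))⁻¹] at b1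
    rw [integral_const_mul, mul_left_comm (τ ^ (n + 2))⁻¹] at b2
    rw [g, hdiff 0]
    refine (abs_sub _ _).trans ?_
    rw [abs_mul, abs_of_pos (inv_pos.2 hτ)]
    calc _ ≤ (D.ρ⁻¹ * q) * (C₃ * (ballVolume n * (D.U * D.W * D.h X) +
              D.U * D.W * (A * q * D.h X))) +
            C₂ * (D.U * D.ρ⁻¹ * D.W * (A * q * D.h X)) := by
          gcongr
          · exact b1.trans (by gcongr)
          · exact b2.trans (by gcongr)
      _ = (D.U * D.W * D.h X) * (D.ρ⁻¹ * q) * (C₃ * (ballVolume n + A * q) + C₂ * A) := by ring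
      _ ≤ (D.U * D.W * D.h X) * (D.ρ⁻¹ * q) * (C₃ * (ballVolume n + A * 1) + C₂ * A) := by
          gcongr
      _ = (C₃ * (ballVolume n + A) + C₂ * A) * (D.U * D.W * D.h X) * (D.ρ⁻¹ * q) := by ring
      _ ≤ _ := by
          have h1 : 0 ≤ 8 * C₁ * A := by positivity
          have h2 : 0 ≤ 4 * C₀ * A := by positivity
          exact mul_le_mul (mul_le_mul_of_nonneg_right (by linarith) hUWh) hprof (by positivity)
            (by positivity)

/-- `∂_k w` at the scale `τ`, using the Hölder bound of `w`. -/
lemma exists_abs_scaleOp_g_le (hα0 : 0 < α) (hα1 : α < 1) (hκ : IsPiece κ) (k : Fin (n + 2)) :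
    ∃ C : ℝ, 0 ≤ C ∧ ∀ (D : CommData n α ε A) (τ : ℝ) (X : Space n), 0 < τ →
      |scaleOp τ κ (D.g k) X| ≤ C * D.W * τ ^ (α - 1) := by
  obtain ⟨C₁, hC₁, H₁⟩ := (hκ.partialDeriv k).exists_abs_scaleOp_le
  refine ⟨C₁ * 4, by positivity, fun D τ X hτ => ?_⟩
  have hW := D.W_nonneg
  have hb := H₁ τ (4 * D.W * τ ^ α) (fun Y => D.w Y - D.w X) X hτ fun Y hY => by
    rw [abs_sub_comm]
    refine (D.w_holder X Y).trans ?_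
    have := rpow_two_mul_le hα0 hα1 hτ (norm_nonneg (X - Y)) hY
    calc _ ≤ 2 * D.W * (2 * τ ^ α) := by gcongr
      _ = _ := by ring
  rw [(hκ.partialDeriv k).scaleOp_sub_const hτ (hκ.integral_partialDeriv k) D.w_diff.continuous] at hb
  rw [g, hκ.scaleOp_partialDeriv hτ k D.w_diff (D.continuous_g hα0 k), abs_mul,
    abs_of_pos (inv_pos.2 hτ), Real.rpow_sub_one hτ.ne']
  calc _ ≤ τ⁻¹ * (C₁ * (4 * D.W * τ ^ α)) := by gcongr
    _ = _ := by field_simp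

/-- `∂_k w` at the scale `τ`, using its own Hölder bound and the cancellation of the kernel. -/
lemma exists_abs_scaleOp_g_le' (hα0 : 0 < α) (hα1 : α < 1) (hκ : IsPiece κ) (h0 : ∫ Z, κ Z = 0)
    (k : Fin (n + 2)) : ∃ C : ℝ, 0 ≤ C ∧ ∀ (D : CommData n α ε A) (τ : ℝ) (X : Space n), 0 < τ →
      |scaleOp τ κ (D.g k) X| ≤ C * D.W * (τ ^ α * (D.M⁻¹ * (D.R ^ α)⁻¹)) := by
  obtain ⟨C₁, hC₁, H₁⟩ := hκ.exists_abs_scaleOp_le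
  refine ⟨C₁ * 4, by positivity, fun D τ X hτ => ?_⟩
  have hW := D.W_nonneg
  have hM := D.M_pos
  have hR := D.R_pos
  have hb := H₁ τ (4 * D.W * D.M⁻¹ * (D.R ^ α)⁻¹ * τ ^ α) (fun Y => D.g k Y - D.g k X) X hτ
    fun Y hY => by
      rw [abs_sub_comm]
      refine (D.abs_g_sub_le k X Y).trans ?_
      have := rpow_two_mul_le hα0 hα1 hτ (norm_nonneg (X - Y)) hY
      calc _ ≤ 2 * D.W * D.M⁻¹ * (D.R ^ α)⁻¹ * (2 * τ ^ α) := by gcongr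
        _ = _ := by ring
  rw [hκ.scaleOp_sub_const hτ h0 (D.continuous_g hα0 k)] at hb
  exact hb.trans (le_of_eq (by ring))

/-- The singular part of the gradient of the commutator at the scale `τ`. -/
lemma exists_abs_inv_mul_commOp_le (hα0 : 0 < α) (hα1 : α < 1) (hε0 : 0 < ε) (hε1 : ε ≤ 1)
    (hκ : IsPiece κ) (k : Fin (n + 2)) : ∃ C : ℝ, 0 ≤ C ∧ ∀ (D : CommData n α ε A) (τ : ℝ)
      (X : Space n), 0 < τ → |τ⁻¹ * commOp τ κ D.u (D.g k) X| ≤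
        C * (D.U * D.W * D.h X) * (D.ρ⁻¹ * τ ^ (α - 1)) := by
  obtain ⟨C, hC, H⟩ := exists_abs_commOp_le (A := A) hα0 hα1 hε0 hε1 hκ k
  refine ⟨C, hC, fun D τ X hτ => ?_⟩
  have hρ := D.rho_pos
  have hUWh : 0 ≤ D.U * D.W * D.h X :=
    mul_nonneg (mul_nonneg D.U_nonneg D.W_nonneg) (D.h_pos X).le
  have h1 : D.ρ ^ (α - 1) * profile α ε (τ / D.ρ) ≤ D.ρ⁻¹ * τ ^ α := by
    calc _ ≤ D.ρ ^ (α - 1) * (τ / D.ρ) ^ α := by gcongr; exact min_le_left _ _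
      _ = _ := by
        rw [Real.div_rpow hτ.le hρ.le, Real.rpow_sub_one hρ.ne']; field_simp
  rw [abs_mul, abs_of_pos (inv_pos.2 hτ)]
  calc _ ≤ τ⁻¹ * (C * (D.U * D.W * D.h X) * (D.ρ⁻¹ * τ ^ α)) := by
        gcongr
        exact (H D τ X hτ).trans (by gcongr)
    _ = _ := by rw [Real.rpow_sub_one hτ.ne']; field_simp

/-- The singular part of the gradient of the commutator at the scale `τ`, using the Hölder bounds
of the gradients of `u` and `w` and the cancellation of the kernel. -/
lemma exists_abs_inv_mul_commOp_le' (hα0 : 0 < α) (hα1 : α < 1) (hε0 : 0 < ε) (hε1 : ε ≤ 1)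
    (hκ : IsPiece κ) (h0 : ∫ Z, κ Z = 0) (l k : Fin (n + 2)) :
    ∃ C : ℝ, 0 ≤ C ∧ ∀ (D : CommData n α ε A) (τ : ℝ) (X : Space n), 0 < τ →
      |τ⁻¹ * commOp τ (partialDeriv l κ) D.u (D.g k) X| ≤
        C * (D.U * D.W * D.h X) * (τ ^ α * (D.M⁻¹ * (D.R ^ α)⁻¹)) := by
  obtain ⟨C₀, hC₀, H₀⟩ := hκ.exists_abs_scaleOp_le
  obtain ⟨C₁, hC₁, H₁⟩ := (hκ.partialDeriv l).exists_abs_scaleOp_le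
  obtain ⟨C₂, hC₂, H₂⟩ := exists_abs_inv_mul_commOp_le (A := A) hα0 hα1 hε0 hε1
    (hκ.partialDeriv l) k
  refine ⟨8 * C₁ * |A| + 2 * C₀ * (1 + |A|) + C₂, by positivity, fun D τ X hτ => ?_⟩
  have hA1 : 1 ≤ A := D.A_ge_one
  rw [abs_of_nonneg (by linarith : 0 ≤ A)]
  have hU := D.U_nonneg
  have hW := D.W_nonneg
  have hρ := D.rho_pos
  have hρ1 := D.one_le_rho
  have hR := D.R_pos
  have hM := D.M_pos
  have hX := D.h_pos X
  have hUWh : 0 ≤ D.U * D.W * D.h X := by positivity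
  rcases le_total τ D.ρ with hτρ | hτρ
  · have hgc := D.continuous_g hα0 k
    have huc := D.u_diff.continuous
    have b1 := H₁ τ (D.U * D.ρ⁻¹ * (A * D.h X) * (2 * τ) *
        (4 * D.W * D.M⁻¹ * (D.R ^ α)⁻¹ * τ ^ α))
      (fun Y => (D.u Y - D.u X) * (D.g k Y - D.g k X)) X hτ fun Y hY => by
        rw [abs_mul]
        refine mul_le_mul (D.abs_u_sub_le_near hτρ hY) ?_ (abs_nonneg _) (by positivity)
        rw [abs_sub_comm]
        refine (D.abs_g_sub_le k X Y).trans ?_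
        have := rpow_two_mul_le hα0 hα1 hτ (norm_nonneg (X - Y)) hY
        calc _ ≤ 2 * D.W * D.M⁻¹ * (D.R ^ α)⁻¹ * (2 * τ ^ α) := by gcongr
          _ = _ := by ring
    have hku := continuous_partialDeriv (D.continuous_fderiv_u hα0) l
    have b2 := H₀ τ (D.U * D.ρ⁻¹ * (D.ρ ^ α)⁻¹ * (D.h X + A * D.h X) * (2 * τ ^ α))
      (fun Y => partialDeriv l D.u Y - partialDeriv l D.u X) X hτ fun Y hY => by
        rw [abs_sub_comm]
        refine (D.abs_partialDeriv_u_sub_le l X Y).trans ?_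
        have := rpow_two_mul_le hα0 hα1 hτ (norm_nonneg (X - Y)) hY
        gcongr
        exact D.h_near X Y (by linarith)
    rw [hκ.scaleOp_sub_const hτ h0 hku,
      hκ.scaleOp_partialDeriv hτ l D.u_diff hku,
      ← (hκ.partialDeriv l).scaleOp_sub_const hτ (hκ.integral_partialDeriv l) huc (D.u X)] at b2
    -- subtracting `g X` leaves a second order remainder and a term in which a derivative of the
    -- kernel can be moved to `u`, whose gradient is Hölder continuous
    have hsplit : commOp τ (partialDeriv l κ) D.u (D.g k) X =
        scaleOp τ (partialDeriv l κ) (fun Y => (D.u Y - D.u X) * (D.g k Y - D.g k X)) X +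
          D.g k X * scaleOp τ (partialDeriv l κ) (fun Y => D.u Y - D.u X) X := by
      have hi1 : Integrable fun Y => dilate τ (partialDeriv l κ) (X - Y) *
          ((D.u Y - D.u X) * (D.g k Y - D.g k X)) :=
        (hκ.partialDeriv l).integrable_mul hτ
          ((huc.sub continuous_const).mul (hgc.sub continuous_const)) X
      have hi2 : Integrable fun Y => dilate τ (partialDeriv l κ) (X - Y) * (D.u Y - D.u X) :=
        (hκ.partialDeriv l).integrable_mul hτ (huc.sub continuous_const) X
      rw [commOp, scaleOp, scaleOp, scaleOp, ← integral_const_mul,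
        ← integral_add hi1 (hi2.const_mul _)]
      refine integral_congr_ae (Eventually.of_forall fun Y => ?_)
      simp only
      ring
    have hρα : (D.ρ ^ α)⁻¹ ≤ (D.R ^ α)⁻¹ := by
      have := D.R_le
      gcongr
    have hρinv : D.ρ⁻¹ ≤ 1 := inv_le_one_of_one_le₀ hρ1
    rw [hsplit, mul_add, mul_left_comm τ⁻¹ (D.g k X)]
    refine (abs_add_le _ _).trans ?_
    rw [abs_mul (D.g k X), abs_mul τ⁻¹, abs_of_pos (inv_pos.2 hτ)]
    calc _ ≤ τ⁻¹ * (C₁ * (D.U * D.ρ⁻¹ * (A * D.h X) * (2 * τ) *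
            (4 * D.W * D.M⁻¹ * (D.R ^ α)⁻¹ * τ ^ α))) +
          (D.W * D.M⁻¹) *
            (C₀ * (D.U * D.ρ⁻¹ * (D.ρ ^ α)⁻¹ * (D.h X + A * D.h X) * (2 * τ ^ α))) := by
          gcongr
          exact D.abs_g_le k X
      _ ≤ τ⁻¹ * (C₁ * (D.U * 1 * (A * D.h X) * (2 * τ) *
            (4 * D.W * D.M⁻¹ * (D.R ^ α)⁻¹ * τ ^ α))) +
          (D.W * D.M⁻¹) *
            (C₀ * (D.U * 1 * (D.R ^ α)⁻¹ * (D.h X + A * D.h X) * (2 * τ ^ α))) := by gcongr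
      _ = (8 * C₁ * A + 2 * C₀ * (1 + A)) * (D.U * D.W * D.h X) *
            (τ ^ α * (D.M⁻¹ * (D.R ^ α)⁻¹)) := by
          field_simp; ring
      _ ≤ _ := by
          exact mul_le_mul_of_nonneg_right (mul_le_mul_of_nonneg_right (by linarith) hUWh)
            (by positivity)
  · -- for `τ ≥ ρ` the bound without cancellation is already good enough, as `M R^α ≤ ρ τ`
    have hle : D.ρ⁻¹ * τ ^ (α - 1) ≤ τ ^ α * (D.M⁻¹ * (D.R ^ α)⁻¹) := by
      have hm : D.M * D.R ^ α ≤ D.ρ * τ :=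
        D.M_mul_le.trans (by have := D.R_le; gcongr; linarith)
      rw [← mul_inv, Real.rpow_sub_one hτ.ne', ← div_eq_mul_inv, le_div_iff₀ (by positivity)]
      calc _ ≤ D.ρ⁻¹ * (τ ^ α / τ) * (D.ρ * τ) := by gcongr
        _ = τ ^ α := by field_simp
    refine (H₂ D τ X hτ).trans ?_
    calc _ ≤ C₂ * (D.U * D.W * D.h X) * (τ ^ α * (D.M⁻¹ * (D.R ^ α)⁻¹)) := by gcongr
      _ ≤ _ := by
        have h1 : 0 ≤ 8 * C₁ * A := by positivity
        have h2 : 0 ≤ 2 * C₀ * (1 + A) := by positivity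
        exact mul_le_mul_of_nonneg_right (mul_le_mul_of_nonneg_right (by linarith) hUWh)
          (by positivity)

end CommData

/-! ### Summation of the scales -/

lemma le_mul_profile {a b A x q : ℝ} (h1 : x ≤ A * q ^ a) (h2 : x ≤ A * q ^ (-b)) :
    x ≤ A * profile a b q := by
  rw [profile]
  rcases min_choice (q ^ a) (q ^ (-b)) with h | h <;> rw [h] <;> assumption

section Series

variable {n : ℕ} {α : ℝ}

/-- Hölder continuity, at distances at most `ρ`, of the sum of a dyadic series whose term of scale
`τ` has size `τ ^ α` and gradient of size `τ ^ (α - 1)`. -/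
lemma exists_abs_sub_le_of_hasSum_scales (hα0 : 0 < α) (hα1 : α < 1) (n : ℕ) {A : ℝ} (hA : 1 ≤ A) :
    ∃ C : ℝ, 0 ≤ C ∧ ∀ (h : Space n → ℝ) (ρ B : ℝ) (V : ℤ → Space n → ℝ) (v : Space n → ℝ),
      (∀ X, 0 ≤ h X) → (∀ X Y, ‖X - Y‖ ≤ 2 * ρ → h Y ≤ A * h X) → 0 ≤ B →
      (∀ X, HasSum (fun m => V m X) (v X)) → (∀ m, Differentiable ℝ (V m)) →
      (∀ m X, |V m X| ≤ B * h X * (2 ^ m) ^ α) →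
      (∀ m l X, |fderiv ℝ (V m) X (basisVec l)| ≤ B * h X * (2 ^ m) ^ (α - 1)) →
      ∀ X Y, ‖X - Y‖ ≤ ρ → |v X - v Y| ≤ C * B * (h X + h Y) * ‖X - Y‖ ^ α := by
  obtain ⟨C, hC, H⟩ := exists_abs_sub_le_of_hasSum hα0 hα1
  refine ⟨C * (((n : ℝ) + 2) * A), by positivity, fun h ρ B V v h0 hnear hB hV hd h1 h2 X Y hXY =>
    ?_⟩
  rcases eq_or_ne X Y with rfl | hne
  · simp [hα0.ne']
  have hr : 0 < ‖X - Y‖ := norm_pos_iff.2 (sub_ne_zero.2 hne)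
  have hX := h0 X
  have hY := h0 Y
  have hnA : 1 ≤ ((n : ℝ) + 2) * A := by
    have : (0 : ℝ) ≤ n := Nat.cast_nonneg n
    nlinarith
  refine (H ‖X - Y‖ (((n : ℝ) + 2) * A * B * (h X + h Y)) _ _ _ _ hr (by positivity) (hV X) (hV Y)
    (fun m => ?_) fun m => ?_).trans (le_of_eq (by ring))
  · calc _ ≤ |V m X| + |V m Y| := abs_sub _ _
      _ ≤ B * h X * (2 ^ m) ^ α + B * h Y * (2 ^ m) ^ α := add_le_add (h1 m X) (h1 m Y)
      _ = 1 * (B * (h X + h Y) * (2 ^ m) ^ α) := by ring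
      _ ≤ (((n : ℝ) + 2) * A) * (B * (h X + h Y) * (2 ^ m) ^ α) := by gcongr
      _ = _ := by ring
  · rw [abs_sub_comm]
    refine (abs_sub_le_of_fderiv_le (r := ‖X - Y‖)
      (B := ((n : ℝ) + 2) * (B * (A * h X) * (2 ^ m) ^ (α - 1))) (fun Z _ => hd m Z)
      (fun Z hZ => norm_le_of_abs_apply_basisVec_le _ (by positivity) fun l => ?_) le_rfl).trans ?_
    · refine (h2 m l Z).trans ?_
      gcongr
      exact hnear X Z (by linarith [norm_nonneg (X - Z)])
    · calc _ = ((n : ℝ) + 2) * A * B * (h X + 0) * (‖X - Y‖ * (2 ^ m) ^ (α - 1)) := by ring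
        _ ≤ _ := by gcongr

/-- At distances at least `1`, a Hölder estimate follows from the pointwise one. -/
lemma abs_sub_le_of_one_le_norm (hα0 : 0 ≤ α) {v h : Space n → ℝ} {B : ℝ} (hB : 0 ≤ B)
    (h0 : ∀ X, 0 ≤ h X) (hv : ∀ X, |v X| ≤ B * h X) {X Y : Space n} (hXY : 1 ≤ ‖X - Y‖) :
    |v X - v Y| ≤ B * (h X + h Y) * ‖X - Y‖ ^ α := by
  have hX := h0 X
  have hY := h0 Y
  have h1 : 1 ≤ ‖X - Y‖ ^ α := Real.one_le_rpow hXY hα0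
  calc |v X - v Y| ≤ |v X| + |v Y| := abs_sub _ _
    _ ≤ B * h X + B * h Y := add_le_add (hv X) (hv Y)
    _ = B * (h X + h Y) * 1 := by ring
    _ ≤ _ := by gcongr

/-- A dyadic series whose terms have gradients controlled by a summable profile can be
differentiated term by term. -/
lemma differentiable_and_hasSum_partialDeriv {a b r K : ℝ} (ha : 0 < a) (hb : 0 < b) (hr : 0 < r)
    (hK : 0 ≤ K) {V : ℤ → Space n → ℝ} {v : Space n → ℝ} (hV : ∀ X, HasSum (fun m => V m X) (v X))
    (hd : ∀ m, Differentiable ℝ (V m))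
    (h : ∀ m l X, |partialDeriv l (V m) X| ≤ K * profile a b (2 ^ m / r)) :
    Differentiable ℝ v ∧ ∀ l X, HasSum (fun m => partialDeriv l (V m) X) (partialDeriv l v X) := by
  obtain ⟨C, -, hC⟩ := exists_tsum_profile_le ha hb
  have hsum := ((hC r hr).1.mul_left K).mul_left ((n : ℝ) + 2)
  have hbd : ∀ m X, ‖fderiv ℝ (V m) X‖ ≤ ((n : ℝ) + 2) * (K * profile a b (2 ^ m / r)) :=
    fun m X => norm_le_of_abs_apply_basisVec_le _
      (mul_nonneg hK (profile_nonneg _ _ (by positivity))) fun l => h m l X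
  have hv : v = fun X => ∑' m, V m X := funext fun X => (hV X).tsum_eq.symm
  have key : ∀ X, HasFDerivAt v (∑' m, fderiv ℝ (V m) X) X := fun X => by
    rw [hv]
    exact hasFDerivAt_tsum hsum (fun m Y => (hd m Y).hasFDerivAt) hbd (x₀ := 0) (hV 0).summable X
  refine ⟨fun X => (key X).differentiableAt, fun l X => ?_⟩
  have hs : Summable fun m => fderiv ℝ (V m) X :=
    Summable.of_norm_bounded hsum fun m => hbd m X
  have := (ContinuousLinearMap.apply ℝ ℝ (basisVec l : Space n)).hasSum hs.hasSum
  rw [partialDeriv, (key X).fderiv]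
  exact this

end Series

namespace CommData

variable {n : ℕ} {α ε A : ℝ}

lemma rho_inv_mul_rpow_le (D : CommData n α ε A) {τ : ℝ} (hτ : 0 < τ) :
    D.ρ⁻¹ * τ ^ (α - 1) ≤ D.M⁻¹ * (τ / D.R) ^ (α - 1) := by
  have hR := D.R_pos
  have hM := D.M_pos
  have hρ := D.rho_pos
  have h1 : D.ρ⁻¹ ≤ D.M⁻¹ * D.R ^ (1 - α) := by
    rw [inv_mul_eq_div, le_div_iff₀ hM, inv_mul_le_iff₀ hρ]
    exact D.M_le
  rw [Real.div_rpow hτ.le hR.le, show α - 1 = -(1 - α) by ring, Real.rpow_neg hR.le, div_inv_eq_mul]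
  calc _ ≤ (D.M⁻¹ * D.R ^ (1 - α)) * τ ^ (-(1 - α)) := by gcongr
    _ = _ := by ring

/-- The pieces of `∂_k w` sum to the principal value. -/
lemma pv_g (D : CommData n α ε A) (hα0 : 0 < α) (i j k : Fin (n + 2)) (X : Space n) :
    (∀ ε : ℝ, 0 < ε →
      IntegrableOn (fun Y => kernel i j (X - Y) * D.g k Y) {Y : Space n | ε < ‖X - Y‖}) ∧
    ∃ l : ℝ, HasSum (fun m : ℤ => scaleOp (2 ^ m) (dyadicKernel i j) (D.g k) X) l ∧
      Tendsto (truncated i j (D.g k) X) (𝓝[>] 0) (𝓝 l) := by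
  have hg := D.continuous_g hα0 k
  have hk : Measurable fun Y : Space n => (1 + ‖X - Y‖) ^ (-((n : ℝ) + 2)) := by fun_prop
  refine hasSum_scaleOp_and_tendsto_truncated i j hg.measurable hα0
    (B := 2 * D.W * D.M⁻¹ * (D.R ^ α)⁻¹) ?_ fun Y => ?_
  · refine ((D.h₁_int X).const_mul (D.W * D.M⁻¹)).mono'
      (hk.mul hg.measurable).aestronglyMeasurable (Eventually.of_forall fun Y => ?_)
    rw [norm_mul, Real.norm_of_nonneg (by positivity)]
    calc _ ≤ (1 + ‖X - Y‖) ^ (-((n : ℝ) + 2)) * (D.W * D.M⁻¹ * D.h₁ Y) := by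
          gcongr
          exact (abs_apply_basisVec_le _ _).trans (D.dw_le Y)
      _ = _ := by ring
  · rw [abs_sub_comm]
    exact D.abs_g_sub_le k X Y

lemma pv_u_mul_g (D : CommData n α ε A) (hα0 : 0 < α) (i j k : Fin (n + 2)) (X : Space n) :
    (∀ ε : ℝ, 0 < ε → IntegrableOn (fun Y => kernel i j (X - Y) * (D.u Y * D.g k Y))
      {Y : Space n | ε < ‖X - Y‖}) ∧
    ∃ l : ℝ, HasSum (fun m : ℤ => scaleOp (2 ^ m) (dyadicKernel i j)
        (fun Y => D.u Y * D.g k Y) X) l ∧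
      Tendsto (truncated i j (fun Y => D.u Y * D.g k Y) X) (𝓝[>] 0) (𝓝 l) := by
  have hg := D.continuous_g hα0 k
  have hu := D.u_diff.continuous
  have hU := D.U_nonneg
  have hW := D.W_nonneg
  have hM := D.M_pos
  have hR := D.R_pos
  have hu1 : ∀ Y, |D.u Y| ≤ D.U := fun Y =>
    (D.u_le Y).trans (mul_le_of_le_one_right hU (D.h_le_one Y))
  have hk : Measurable fun Y : Space n => (1 + ‖X - Y‖) ^ (-((n : ℝ) + 2)) := by fun_prop
  have hug : Measurable fun Y => D.u Y * D.g k Y := (hu.mul hg).measurable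
  refine hasSum_scaleOp_and_tendsto_truncated i j hug hα0
    (B := D.U * (2 * D.W * D.M⁻¹ * (D.R ^ α)⁻¹) + (D.W * D.M⁻¹) * (D.U * 2)) ?_ fun Y => ?_
  · refine ((D.h₁_int X).const_mul (D.U * (D.W * D.M⁻¹))).mono'
      (hk.mul hug).aestronglyMeasurable (Eventually.of_forall fun Y => ?_)
    rw [norm_mul, norm_mul, Real.norm_of_nonneg (by positivity : 0 ≤ (1 + ‖X - Y‖) ^ (-((n : ℝ) + 2)))]
    calc _ ≤ (1 + ‖X - Y‖) ^ (-((n : ℝ) + 2)) * (D.U * (D.W * D.M⁻¹ * D.h₁ Y)) := by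
          gcongr
          · exact hu1 Y
          · exact (abs_apply_basisVec_le _ _).trans (D.dw_le Y)
      _ = _ := by ring
  · have e : D.u Y * D.g k Y - D.u X * D.g k X =
        D.u Y * (D.g k Y - D.g k X) + D.g k X * (D.u Y - D.u X) := by ring
    rw [e]
    refine (abs_add_le _ _).trans ?_
    rw [abs_mul, abs_mul, abs_sub_comm (D.g k Y), abs_sub_comm (D.u Y)]
    have hY := (D.h_pos Y).le
    have hX := (D.h_pos X).le
    calc _ ≤ D.U * (2 * D.W * D.M⁻¹ * (D.R ^ α)⁻¹ * ‖X - Y‖ ^ α) +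
          (D.W * D.M⁻¹) * (D.U * (D.h X + D.h Y) * ‖X - Y‖ ^ α) := by
          gcongr
          · exact hu1 Y
          · exact D.abs_g_sub_le k X Y
          · exact D.abs_g_le k X
          · exact D.u_holder X Y
      _ ≤ D.U * (2 * D.W * D.M⁻¹ * (D.R ^ α)⁻¹ * ‖X - Y‖ ^ α) +
          (D.W * D.M⁻¹) * (D.U * 2 * ‖X - Y‖ ^ α) := by
          gcongr
          linarith [D.h_le_one X, D.h_le_one Y]
      _ = _ := by ring

/-- The commutator is the sum of its dyadic pieces; the multiples of the identity cancel. -/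
lemma hasSum_rieszCommutator (D : CommData n α ε A) (hα0 : 0 < α) (i j k : Fin (n + 2))
    (X : Space n) : HasSum (fun m : ℤ => commOp (2 ^ m) (dyadicKernel i j) D.u (D.g k) X)
      (rieszCommutator i j D.u (D.g k) X) := by
  obtain ⟨-, l, hl, hlt⟩ := D.pv_g hα0 i j k X
  obtain ⟨-, l', hl', hlt'⟩ := D.pv_u_mul_g hα0 i j k X
  have e : rieszCommutator i j D.u (D.g k) X = l' - D.u X * l := by
    rw [rieszCommutator, rieszRiesz, rieszRiesz, hlt.limUnder_eq, hlt'.limUnder_eq]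
    ring
  rw [e]
  refine (hl'.sub (hl.mul_left (D.u X))).congr_fun fun m => ?_
  exact (isPiece_dyadicKernel i j).commOp_eq (by positivity) D.u_diff.continuous
    (D.continuous_g hα0 k) X

/-- The Calderón–Zygmund estimates for `∂_k w`. -/
lemma exists_pv_g_bounds (hα0 : 0 < α) (hα1 : α < 1) (i j k : Fin (n + 2)) :
    ∃ C : ℝ, 0 ≤ C ∧ ∀ D : CommData n α ε A, ∃ T : Space n → ℝ,
      (∀ X, HasSum (fun m : ℤ => scaleOp (2 ^ m) (dyadicKernel i j) (D.g k) X) (T X)) ∧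
      (∀ X, |T X| ≤ C * D.W * (D.ρ * D.M⁻¹)) ∧
      ∀ X Y, ‖X - Y‖ ≤ D.ρ → |T X - T Y| ≤ C * D.W * (D.M⁻¹ * (D.R ^ α)⁻¹) * ‖X - Y‖ ^ α := by
  have hκ := isPiece_dyadicKernel i j
  have h0 := integral_dyadicKernel i j
  obtain ⟨C₁, hC₁, H₁⟩ := exists_abs_scaleOp_g_le (ε := ε) (A := A) hα0 hα1 hκ k
  obtain ⟨C₂, hC₂, H₂⟩ := exists_abs_scaleOp_g_le' (ε := ε) (A := A) hα0 hα1 hκ h0 k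
  have hex := fun l => exists_abs_scaleOp_g_le' (ε := ε) (A := A) hα0 hα1 (hκ.partialDeriv l)
    (hκ.integral_partialDeriv l) k
  choose C₃ hC₃ H₃ using hex
  obtain ⟨C₄, hC₄, H₄⟩ := exists_abs_le_of_hasSum hα0 (sub_pos.2 hα1)
  obtain ⟨C₅, hC₅, H₅⟩ := exists_abs_sub_le_of_hasSum_scales hα0 hα1 n (le_refl (1 : ℝ))
  have hC₃' : ∀ l, C₃ l ≤ ∑ l, C₃ l := fun l =>
    Finset.single_le_sum (fun l _ => hC₃ l) (Finset.mem_univ l)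
  have hC₃s : 0 ≤ ∑ l, C₃ l := Finset.sum_nonneg fun l _ => hC₃ l
  refine ⟨C₄ * (C₁ + C₂) + C₅ * (C₂ + ∑ l, C₃ l) * 2, by positivity, fun D => ?_⟩
  have hW := D.W_nonneg
  have hM := D.M_pos
  have hR := D.R_pos
  have hρ := D.rho_pos
  have hex := fun X => (D.pv_g hα0 i j k X).2
  choose T hT hT' using hex
  refine ⟨T, hT, fun X => ?_, fun X Y hXY => ?_⟩
  · refine (H₄ D.R ((C₁ + C₂) * D.W * (D.ρ * D.M⁻¹)) _ _ hR (by positivity) (hT X) fun m =>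
      le_mul_profile ?_ ?_).trans ?_
    · refine (H₂ D (2 ^ m) X (by positivity)).trans ?_
      rw [Real.div_rpow (by positivity) hR.le]
      have := D.one_le_rho
      calc C₂ * D.W * ((2 ^ m) ^ α * (D.M⁻¹ * (D.R ^ α)⁻¹))
          = (0 + C₂) * D.W * (1 * D.M⁻¹) * ((2 ^ m) ^ α / D.R ^ α) := by ring
        _ ≤ _ := by gcongr
    · refine (H₁ D (2 ^ m) X (by positivity)).trans ?_
      have h1 := D.rho_inv_mul_rpow_le (τ := 2 ^ m) (by positivity)
      rw [inv_mul_le_iff₀ hρ] at h1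
      rw [neg_sub]
      calc C₁ * D.W * (2 ^ m) ^ (α - 1)
          ≤ (C₁ + 0) * D.W * (D.ρ * (D.M⁻¹ * (2 ^ m / D.R) ^ (α - 1))) := by
            rw [add_zero]; gcongr
        _ ≤ (C₁ + C₂) * D.W * (D.ρ * (D.M⁻¹ * (2 ^ m / D.R) ^ (α - 1))) := by gcongr
        _ = _ := by ring
    · calc _ = (C₄ * (C₁ + C₂) + 0) * D.W * (D.ρ * D.M⁻¹) := by ring
        _ ≤ _ := by gcongr; positivity
  · refine (H₅ (fun _ => 1) D.ρ ((C₂ + ∑ l, C₃ l) * D.W * (D.M⁻¹ * (D.R ^ α)⁻¹))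
      (fun m => scaleOp (2 ^ m) (dyadicKernel i j) (D.g k)) T (fun _ => zero_le_one)
      (fun _ _ _ => by norm_num) (by positivity) hT
      (fun m Z => (hκ.differentiableAt_scaleOp (by positivity) (D.continuous_g hα0 k) Z).1)
      (fun m Z => ?_) (fun m l Z => ?_) X Y hXY).trans ?_
    · refine (H₂ D (2 ^ m) Z (by positivity)).trans ?_
      calc _ = (C₂ + 0) * D.W * (D.M⁻¹ * (D.R ^ α)⁻¹) * 1 * (2 ^ m) ^ α := by ring
        _ ≤ _ := by gcongr
    · have h2 : (0 : ℝ) < 2 ^ m := by positivity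
      rw [(hκ.differentiableAt_scaleOp h2 (D.continuous_g hα0 k) Z).2 l, abs_mul,
        abs_of_pos (inv_pos.2 h2)]
      calc _ ≤ (2 ^ m)⁻¹ * (C₃ l * D.W * ((2 ^ m) ^ α * (D.M⁻¹ * (D.R ^ α)⁻¹))) := by
            gcongr; exact H₃ l D (2 ^ m) Z h2
        _ ≤ (2 ^ m)⁻¹ * ((0 + ∑ l, C₃ l) * D.W * ((2 ^ m) ^ α * (D.M⁻¹ * (D.R ^ α)⁻¹))) := by
            rw [zero_add]; gcongr; exact hC₃' l
        _ ≤ (2 ^ m)⁻¹ * ((C₂ + ∑ l, C₃ l) * D.W * ((2 ^ m) ^ α * (D.M⁻¹ * (D.R ^ α)⁻¹))) := by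
            gcongr
        _ = _ := by rw [Real.rpow_sub_one h2.ne']; field_simp
    · calc _ = (0 + C₅ * (C₂ + ∑ l, C₃ l) * 2) * D.W * (D.M⁻¹ * (D.R ^ α)⁻¹) * ‖X - Y‖ ^ α := by
            ring
        _ ≤ _ := by gcongr; positivity

end CommData

/-! ### The commutator estimate -/

namespace CommData

variable {n : ℕ} {α ε A : ℝ}

/-- The undifferentiated bounds for the commutator. -/
lemma exists_rieszCommutator_bounds (hα0 : 0 < α) (hα1 : α < 1) (hε0 : 0 < ε) (hε1 : ε ≤ 1)
    (hA : 1 ≤ A) (i j k : Fin (n + 2)) : ∃ C : ℝ, 0 ≤ C ∧ ∀ D : CommData n α ε A,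
      (∀ X, |rieszCommutator i j D.u (D.g k) X| ≤ C * (D.U * D.W) * D.h X) ∧
      ∀ X Y, |rieszCommutator i j D.u (D.g k) X - rieszCommutator i j D.u (D.g k) Y| ≤
        C * (D.U * D.W) * (D.h X + D.h Y) * ‖X - Y‖ ^ α := by
  have hκ := isPiece_dyadicKernel i j
  have h0 := integral_dyadicKernel i j
  obtain ⟨C₁, hC₁, H₁⟩ := exists_abs_commOp_le (A := A) hα0 hα1 hε0 hε1 hκ k
  obtain ⟨C₂, hC₂, H₂⟩ := exists_abs_inv_mul_commOp_le (A := A) hα0 hα1 hε0 hε1 hκ k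
  have hex := fun l => exists_abs_inv_mul_commOp_le (A := A) hα0 hα1 hε0 hε1 (hκ.partialDeriv l) k
  choose C₃ hC₃ H₃ using hex
  obtain ⟨C₄, hC₄, H₄⟩ := exists_abs_scaleOp_g_le (ε := ε) (A := A) hα0 hα1 hκ k
  obtain ⟨C₅, hC₅, H₅⟩ := exists_abs_le_of_hasSum hα0 hε0
  obtain ⟨C₆, hC₆, H₆⟩ := exists_abs_sub_le_of_hasSum_scales hα0 hα1 n hA
  have hC₃' : ∀ l, C₃ l ≤ ∑ l, C₃ l := fun l =>
    Finset.single_le_sum (fun l _ => hC₃ l) (Finset.mem_univ l)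
  have hC₃s : 0 ≤ ∑ l, C₃ l := Finset.sum_nonneg fun l _ => hC₃ l
  refine ⟨C₅ * C₁ + C₆ * (C₂ + ∑ l, C₃ l + C₄), by positivity, fun D => ?_⟩
  have hU := D.U_nonneg
  have hW := D.W_nonneg
  have hM := D.M_pos
  have hR := D.R_pos
  have hρ := D.rho_pos
  have hsum := D.hasSum_rieszCommutator hα0 i j k
  set v := rieszCommutator i j D.u (D.g k) with hv
  have hsup : ∀ X, |v X| ≤ C₅ * C₁ * (D.U * D.W) * D.h X := fun X => by
    have hX := D.h_pos X
    have h1 : D.ρ ^ (α - 1) ≤ 1 := Real.rpow_le_one_of_one_le_of_nonpos D.one_le_rho (by linarith)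
    refine (H₅ D.ρ (C₁ * (D.U * D.W * D.h X)) _ _ hρ (by positivity) (hsum X) fun m => ?_).trans
      (le_of_eq (by ring))
    have hp := profile_nonneg α ε (q := 2 ^ m / D.ρ) (by positivity)
    refine (H₁ D (2 ^ m) X (by positivity)).trans ?_
    gcongr
    exact mul_le_of_le_one_left hp h1
  refine ⟨fun X => (hsup X).trans ?_, fun X Y => ?_⟩
  · have hX := D.h_pos X
    calc _ = (C₅ * C₁ + 0) * (D.U * D.W) * D.h X := by ring
      _ ≤ _ := by gcongr; positivity
  have hX := D.h_pos X
  have hY := D.h_pos Y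
  rcases le_total D.ρ ‖X - Y‖ with hle | hle
  · refine (abs_sub_le_of_one_le_norm hα0.le (by positivity) (fun Z => (D.h_pos Z).le) hsup
      (D.one_le_rho.trans hle)).trans ?_
    calc _ = (C₅ * C₁ + 0) * (D.U * D.W) * (D.h X + D.h Y) * ‖X - Y‖ ^ α := by ring
      _ ≤ _ := by gcongr; positivity
  have hρ1 : D.ρ⁻¹ ≤ 1 := inv_le_one_of_one_le₀ D.one_le_rho
  refine (H₆ D.h D.ρ ((C₂ + ∑ l, C₃ l + C₄) * (D.U * D.W))
    (fun m => commOp (2 ^ m) (dyadicKernel i j) D.u (D.g k)) v (fun X => (D.h_pos X).le) D.h_near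
    (by positivity) hsum
    (fun m Z => (hκ.differentiableAt_commOp (by positivity) D.u_diff (D.continuous_g hα0 k) Z).1)
    (fun m Z => ?_) (fun m l Z => ?_) X Y hle).trans ?_
  · have h2 : (0 : ℝ) < 2 ^ m := by positivity
    have hZ := D.h_pos Z
    have := H₂ D (2 ^ m) Z h2
    rw [abs_mul, abs_of_pos (inv_pos.2 h2), inv_mul_le_iff₀ h2] at this
    refine this.trans ?_
    calc _ = (C₂ + 0 + 0) * (D.U * D.W) * D.h Z * (D.ρ⁻¹ * (2 ^ m) ^ α) := by
          rw [Real.rpow_sub_one h2.ne']; field_simp; ring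
      _ ≤ (C₂ + ∑ l, C₃ l + C₄) * (D.U * D.W) * D.h Z * (1 * (2 ^ m) ^ α) := by gcongr
      _ = _ := by ring
  · have h2 : (0 : ℝ) < 2 ^ m := by positivity
    have hZ := D.h_pos Z
    rw [(hκ.differentiableAt_commOp h2 D.u_diff (D.continuous_g hα0 k) Z).2 l]
    refine (abs_sub _ _).trans ?_
    rw [abs_mul (WeightedRiesz.partialDeriv l D.u Z)]
    calc _ ≤ C₃ l * (D.U * D.W * D.h Z) * (D.ρ⁻¹ * (2 ^ m) ^ (α - 1)) +
          (D.U * D.ρ⁻¹ * D.h Z) * (C₄ * D.W * (2 ^ m) ^ (α - 1)) := by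
          gcongr
          · exact H₃ l D (2 ^ m) Z h2
          · exact D.abs_partialDeriv_u_le l Z
          · exact H₄ D (2 ^ m) Z h2
      _ = (0 + C₃ l + C₄) * (D.U * D.W) * D.h Z * (D.ρ⁻¹ * (2 ^ m) ^ (α - 1)) := by ring
      _ ≤ (C₂ + ∑ l, C₃ l + C₄) * (D.U * D.W) * D.h Z * (1 * (2 ^ m) ^ (α - 1)) := by
          gcongr; exact hC₃' l
      _ = _ := by ring
  · calc _ = (0 + C₆ * (C₂ + ∑ l, C₃ l + C₄)) * (D.U * D.W) * (D.h X + D.h Y) * ‖X - Y‖ ^ α := by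
          ring
      _ ≤ _ := by gcongr; positivity

/-- The bounds for the gradient of the commutator. -/
lemma exists_partialDeriv_rieszCommutator_bounds (hα0 : 0 < α) (hα1 : α < 1) (hε0 : 0 < ε)
    (hε1 : ε ≤ 1) (hA : 1 ≤ A) (i j k l : Fin (n + 2)) :
    ∃ C : ℝ, 0 ≤ C ∧ ∀ D : CommData n α ε A,
      (∀ m X, |partialDeriv l (commOp (2 ^ (m : ℤ)) (dyadicKernel i j) D.u (D.g k)) X| ≤
        C * (D.U * D.W) * (D.M⁻¹ * D.h X) * profile α (1 - α) (2 ^ m / D.R)) ∧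
      ((∀ X, HasSum (fun m : ℤ => partialDeriv l (commOp (2 ^ m) (dyadicKernel i j) D.u (D.g k)) X)
        (partialDeriv l (rieszCommutator i j D.u (D.g k)) X)) →
      (∀ X, |partialDeriv l (rieszCommutator i j D.u (D.g k)) X| ≤
        C * (D.U * D.W) * D.M⁻¹ * D.h X) ∧
      ∀ X Y, |partialDeriv l (rieszCommutator i j D.u (D.g k)) X -
          partialDeriv l (rieszCommutator i j D.u (D.g k)) Y| ≤
        C * (D.U * D.W) * D.M⁻¹ * (D.R ^ α)⁻¹ * (D.h X + D.h Y) * ‖X - Y‖ ^ α) := by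
  have hκ := isPiece_dyadicKernel i j
  have h0 := integral_dyadicKernel i j
  obtain ⟨C₁, hC₁, H₁⟩ := exists_abs_inv_mul_commOp_le (A := A) hα0 hα1 hε0 hε1
    (hκ.partialDeriv l) k
  obtain ⟨C₂, hC₂, H₂⟩ := exists_abs_inv_mul_commOp_le' (A := A) hα0 hα1 hε0 hε1 hκ h0 l k
  have hex := fun m => exists_abs_inv_mul_commOp_le' (A := A) hα0 hα1 hε0 hε1
    (hκ.partialDeriv l) (hκ.integral_partialDeriv l) m k
  choose C₃ hC₃ H₃ using hex
  obtain ⟨C₄, hC₄, H₄⟩ := exists_abs_scaleOp_g_le (ε := ε) (A := A) hα0 hα1 hκ k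
  obtain ⟨C₅, hC₅, H₅⟩ := exists_abs_scaleOp_g_le' (ε := ε) (A := A) hα0 hα1 hκ h0 k
  obtain ⟨C₆, hC₆, H₆⟩ := exists_abs_scaleOp_g_le' (ε := ε) (A := A) hα0 hα1
    (hκ.partialDeriv l) (hκ.integral_partialDeriv l) k
  obtain ⟨C₇, hC₇, H₇⟩ := exists_abs_le_of_hasSum hα0 (sub_pos.2 hα1)
  obtain ⟨C₈, hC₈, H₈⟩ := exists_abs_sub_le_of_hasSum_scales hα0 hα1 n hA
  obtain ⟨C₉, hC₉, H₉⟩ := exists_pv_g_bounds (ε := ε) (A := A) hα0 hα1 i j k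
  have hC₃' : ∀ l, C₃ l ≤ ∑ l, C₃ l := fun l =>
    Finset.single_le_sum (fun l _ => hC₃ l) (Finset.mem_univ l)
  have hC₃s : 0 ≤ ∑ l, C₃ l := Finset.sum_nonneg fun l _ => hC₃ l
  set K := C₁ + C₂ + C₄ + C₅ with hK
  have hK0 : 0 ≤ K := by positivity
  set K' := C₈ * (C₂ + ∑ l, C₃ l + C₆) + 2 * C₉ with hK'
  have hK'0 : 0 ≤ K' := by positivity
  refine ⟨K + C₇ * K + K', by positivity, fun D => ?_⟩
  have hU := D.U_nonneg
  have hW := D.W_nonneg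
  have hM := D.M_pos
  have hR := D.R_pos
  have hρ := D.rho_pos
  have hρ1 : D.ρ⁻¹ ≤ 1 := inv_le_one_of_one_le₀ D.one_le_rho
  have hgc := D.continuous_g hα0 k
  have hder : ∀ (m : ℤ) X, partialDeriv l (commOp (2 ^ m) (dyadicKernel i j) D.u (D.g k)) X =
      (2 ^ m)⁻¹ * commOp (2 ^ m) (WeightedRiesz.partialDeriv l (dyadicKernel i j)) D.u (D.g k) X -
        partialDeriv l D.u X * scaleOp (2 ^ m) (dyadicKernel i j) (D.g k) X := fun m X =>
    (hκ.differentiableAt_commOp (by positivity) D.u_diff hgc X).2 l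
  have hprof : ∀ (m : ℤ) X,
      |partialDeriv l (commOp (2 ^ m) (dyadicKernel i j) D.u (D.g k)) X| ≤
        K * (D.U * D.W) * (D.M⁻¹ * D.h X) * profile α (1 - α) (2 ^ m / D.R) := fun m X => by
    have h2 : (0 : ℝ) < 2 ^ m := by positivity
    have hX := D.h_pos X
    rw [hder]
    refine (abs_sub _ _).trans ?_
    rw [abs_mul (partialDeriv l D.u X)]
    refine le_mul_profile ?_ ?_
    · rw [Real.div_rpow h2.le hR.le]
      calc _ ≤ C₂ * (D.U * D.W * D.h X) * ((2 ^ m) ^ α * (D.M⁻¹ * (D.R ^ α)⁻¹)) +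
            (D.U * D.ρ⁻¹ * D.h X) * (C₅ * D.W * ((2 ^ m) ^ α * (D.M⁻¹ * (D.R ^ α)⁻¹))) := by
            gcongr
            · exact H₂ D (2 ^ m) X h2
            · exact D.abs_partialDeriv_u_le l X
            · exact H₅ D (2 ^ m) X h2
        _ ≤ C₂ * (D.U * D.W * D.h X) * ((2 ^ m) ^ α * (D.M⁻¹ * (D.R ^ α)⁻¹)) +
            (D.U * 1 * D.h X) * (C₅ * D.W * ((2 ^ m) ^ α * (D.M⁻¹ * (D.R ^ α)⁻¹))) := by
            gcongr
        _ = (0 + C₂ + 0 + C₅) * (D.U * D.W) * (D.M⁻¹ * D.h X) * ((2 ^ m) ^ α / D.R ^ α) := by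
            ring
        _ ≤ _ := by rw [hK]; gcongr
    · rw [neg_sub]
      have h3 := D.rho_inv_mul_rpow_le (τ := 2 ^ m) h2
      calc _ ≤ C₁ * (D.U * D.W * D.h X) * (D.ρ⁻¹ * (2 ^ m) ^ (α - 1)) +
            (D.U * D.ρ⁻¹ * D.h X) * (C₄ * D.W * (2 ^ m) ^ (α - 1)) := by
            gcongr
            · exact H₁ D (2 ^ m) X h2
            · exact D.abs_partialDeriv_u_le l X
            · exact H₄ D (2 ^ m) X h2
        _ = (C₁ + 0 + C₄ + 0) * (D.U * D.W) * D.h X * (D.ρ⁻¹ * (2 ^ m) ^ (α - 1)) := by ring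
        _ ≤ K * (D.U * D.W) * D.h X * (D.M⁻¹ * (2 ^ m / D.R) ^ (α - 1)) := by rw [hK]; gcongr
        _ = _ := by ring
  refine ⟨fun m X => (hprof m X).trans ?_, fun hsum => ?_⟩
  · have hX := D.h_pos X
    have hp := profile_nonneg α (1 - α) (q := 2 ^ m / D.R) (by positivity)
    calc _ = (K + 0 + 0) * (D.U * D.W) * (D.M⁻¹ * D.h X) * profile α (1 - α) (2 ^ m / D.R) := by
          ring
      _ ≤ _ := by gcongr; positivity
  set v := rieszCommutator i j D.u (D.g k) with hv
  have hsup : ∀ X, |partialDeriv l v X| ≤ C₇ * K * (D.U * D.W) * D.M⁻¹ * D.h X := fun X => by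
    have hX := D.h_pos X
    exact (H₇ D.R (K * (D.U * D.W) * (D.M⁻¹ * D.h X)) _ _ hR (by positivity) (hsum X) fun m =>
      hprof m X).trans (le_of_eq (by ring))
  refine ⟨fun X => (hsup X).trans ?_, fun X Y => ?_⟩
  · have hX := D.h_pos X
    calc _ = (0 + C₇ * K + 0) * (D.U * D.W) * D.M⁻¹ * D.h X := by ring
      _ ≤ _ := by gcongr
  have hX := D.h_pos X
  have hY := D.h_pos Y
  rcases le_total D.ρ ‖X - Y‖ with hle | hle
  · have hr : 0 < ‖X - Y‖ := hρ.trans_le hle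
    have h1 : 1 ≤ (D.R ^ α)⁻¹ * ‖X - Y‖ ^ α := by
      rw [inv_mul_eq_div, one_le_div (by positivity)]
      exact Real.rpow_le_rpow hR.le (D.R_le.trans hle) hα0.le
    calc _ ≤ |partialDeriv l v X| + |partialDeriv l v Y| := abs_sub _ _
      _ ≤ C₇ * K * (D.U * D.W) * D.M⁻¹ * D.h X + C₇ * K * (D.U * D.W) * D.M⁻¹ * D.h Y :=
          add_le_add (hsup X) (hsup Y)
      _ = (0 + C₇ * K + 0) * (D.U * D.W) * D.M⁻¹ * (D.h X + D.h Y) * 1 := by ring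
      _ ≤ (K + C₇ * K + K') * (D.U * D.W) * D.M⁻¹ * (D.h X + D.h Y) *
          ((D.R ^ α)⁻¹ * ‖X - Y‖ ^ α) := by gcongr
      _ = _ := by ring
  -- the commutator part and the part with the derivative on `u` are estimated separately
  obtain ⟨T, hT, hTsup, hThol⟩ := H₉ D
  have hS : ∀ X, HasSum (fun m : ℤ => (2 ^ m)⁻¹ *
      commOp (2 ^ m) (WeightedRiesz.partialDeriv l (dyadicKernel i j)) D.u (D.g k) X)
      (partialDeriv l v X + partialDeriv l D.u X * T X) := fun X => by
    refine ((hsum X).add ((hT X).mul_left (partialDeriv l D.u X))).congr_fun fun m => ?_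
    rw [hder]; ring
  have hfd : ∀ (m : ℤ) Z, HasFDerivAt (fun X => (2 ^ m : ℝ)⁻¹ *
      commOp (2 ^ m) (WeightedRiesz.partialDeriv l (dyadicKernel i j)) D.u (D.g k) X)
      ((2 ^ m : ℝ)⁻¹ • fderiv ℝ
        (commOp (2 ^ m) (WeightedRiesz.partialDeriv l (dyadicKernel i j)) D.u (D.g k)) Z) Z :=
    fun m Z => (((hκ.partialDeriv l).differentiableAt_commOp (by positivity) D.u_diff
      hgc Z).1.hasFDerivAt.const_mul _)
  have hShol := H₈ D.h D.ρ ((C₂ + ∑ l, C₃ l + C₆) * (D.U * D.W) * (D.M⁻¹ * (D.R ^ α)⁻¹))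
    (fun (m : ℤ) X => (2 ^ m : ℝ)⁻¹ *
      commOp (2 ^ m) (WeightedRiesz.partialDeriv l (dyadicKernel i j)) D.u (D.g k) X)
    _ (fun X => (D.h_pos X).le) D.h_near (by positivity) hS
    (fun m Z => (hfd m Z).differentiableAt) (fun m Z => by
      have hZ := D.h_pos Z
      refine (H₂ D (2 ^ m) Z (by positivity)).trans ?_
      calc _ = (C₂ + 0 + 0) * (D.U * D.W) * (D.M⁻¹ * (D.R ^ α)⁻¹) * D.h Z * (2 ^ m) ^ α := by ring
        _ ≤ _ := by gcongr) (fun m l' Z => by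
      have h2 : (0 : ℝ) < 2 ^ m := by positivity
      have hZ := D.h_pos Z
      rw [(hfd m Z).fderiv, smul_apply, smul_eq_mul,
        ((hκ.partialDeriv l).differentiableAt_commOp h2 D.u_diff hgc Z).2 l', abs_mul,
        abs_of_pos (inv_pos.2 h2)]
      calc _ ≤ (2 ^ m)⁻¹ * (C₃ l' * (D.U * D.W * D.h Z) * ((2 ^ m) ^ α * (D.M⁻¹ * (D.R ^ α)⁻¹)) +
            (D.U * D.ρ⁻¹ * D.h Z) * (C₆ * D.W * ((2 ^ m) ^ α * (D.M⁻¹ * (D.R ^ α)⁻¹)))) := by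
            gcongr
            refine (abs_sub _ _).trans ?_
            rw [abs_mul (WeightedRiesz.partialDeriv l' D.u Z)]
            gcongr
            · exact H₃ l' D (2 ^ m) Z h2
            · exact D.abs_partialDeriv_u_le l' Z
            · exact H₆ D (2 ^ m) Z h2
        _ ≤ (2 ^ m)⁻¹ * ((∑ l, C₃ l) * (D.U * D.W * D.h Z) *
              ((2 ^ m) ^ α * (D.M⁻¹ * (D.R ^ α)⁻¹)) +
            (D.U * 1 * D.h Z) * (C₆ * D.W * ((2 ^ m) ^ α * (D.M⁻¹ * (D.R ^ α)⁻¹)))) := by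
            gcongr
            exact hC₃' l'
        _ = (0 + ∑ l, C₃ l + C₆) * (D.U * D.W) * (D.M⁻¹ * (D.R ^ α)⁻¹) * D.h Z *
            (2 ^ m) ^ (α - 1) := by
            rw [Real.rpow_sub_one h2.ne']; field_simp; ring
        _ ≤ _ := by gcongr) X Y hle
  have hρα : (D.ρ ^ α)⁻¹ ≤ (D.R ^ α)⁻¹ := by
    have := D.R_le
    gcongr
  have hprod : |partialDeriv l D.u X * T X - partialDeriv l D.u Y * T Y| ≤
      2 * C₉ * (D.U * D.W) * (D.M⁻¹ * (D.R ^ α)⁻¹) * (D.h X + D.h Y) * ‖X - Y‖ ^ α := by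
    have e : partialDeriv l D.u X * T X - partialDeriv l D.u Y * T Y =
        (partialDeriv l D.u X - partialDeriv l D.u Y) * T X +
          partialDeriv l D.u Y * (T X - T Y) := by ring
    rw [e]
    refine (abs_add_le _ _).trans ?_
    rw [abs_mul, abs_mul]
    calc _ ≤ (D.U * D.ρ⁻¹ * (D.ρ ^ α)⁻¹ * (D.h X + D.h Y) * ‖X - Y‖ ^ α) *
            (C₉ * D.W * (D.ρ * D.M⁻¹)) +
          (D.U * D.ρ⁻¹ * D.h Y) * (C₉ * D.W * (D.M⁻¹ * (D.R ^ α)⁻¹) * ‖X - Y‖ ^ α) := by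
          gcongr
          · exact D.abs_partialDeriv_u_sub_le l X Y
          · exact hTsup X
          · exact D.abs_partialDeriv_u_le l Y
          · exact hThol X Y hle
      _ ≤ (D.U * D.ρ⁻¹ * (D.R ^ α)⁻¹ * (D.h X + D.h Y) * ‖X - Y‖ ^ α) *
            (C₉ * D.W * (D.ρ * D.M⁻¹)) +
          (D.U * 1 * (D.h X + D.h Y)) * (C₉ * D.W * (D.M⁻¹ * (D.R ^ α)⁻¹) * ‖X - Y‖ ^ α) := by
          gcongr
          linarith
      _ = _ := by field_simp; ring
  have e : partialDeriv l v X - partialDeriv l v Y =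
      ((partialDeriv l v X + partialDeriv l D.u X * T X) -
        (partialDeriv l v Y + partialDeriv l D.u Y * T Y)) -
      (partialDeriv l D.u X * T X - partialDeriv l D.u Y * T Y) := by ring
  rw [e]
  refine (abs_sub _ _).trans ((add_le_add hShol hprod).trans ?_)
  calc _ = (0 + 0 + K') * (D.U * D.W) * D.M⁻¹ * (D.R ^ α)⁻¹ * (D.h X + D.h Y) * ‖X - Y‖ ^ α := by
        rw [hK']; ring
    _ ≤ _ := by gcongr; positivity

/-- The commutator estimate in terms of pointwise bounds. -/
lemma exists_commutator_estimate (hα0 : 0 < α) (hα1 : α < 1) (hε0 : 0 < ε)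
    (hε1 : ε ≤ 1) (hA : 1 ≤ A) (i j k : Fin (n + 2)) :
    ∃ C : ℝ, 0 ≤ C ∧ ∀ D : CommData n α ε A,
      PVExists i j (D.g k) ∧ PVExists i j (fun X => D.u X * D.g k X) ∧
      Differentiable ℝ (rieszCommutator i j D.u (D.g k)) ∧
      (∀ X, |rieszCommutator i j D.u (D.g k) X| ≤ C * (D.U * D.W) * D.h X) ∧
      (∀ X Y, |rieszCommutator i j D.u (D.g k) X - rieszCommutator i j D.u (D.g k) Y| ≤
        C * (D.U * D.W) * (D.h X + D.h Y) * ‖X - Y‖ ^ α) ∧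
      (∀ X, ‖fderiv ℝ (rieszCommutator i j D.u (D.g k)) X‖ ≤
        C * (D.U * D.W) * D.M⁻¹ * D.h X) ∧
      ∀ X Y, ‖fderiv ℝ (rieszCommutator i j D.u (D.g k)) X -
          fderiv ℝ (rieszCommutator i j D.u (D.g k)) Y‖ ≤
        C * (D.U * D.W) * D.M⁻¹ * (D.R ^ α)⁻¹ * (D.h X + D.h Y) * ‖X - Y‖ ^ α := by
  have hκ := isPiece_dyadicKernel i j
  obtain ⟨C₁, hC₁, H₁⟩ := exists_rieszCommutator_bounds hα0 hα1 hε0 hε1 hA i j k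
  have hex := fun l => exists_partialDeriv_rieszCommutator_bounds hα0 hα1 hε0 hε1 hA i j k l
  choose C₂ hC₂ H₂ using hex
  have hC₂' : ∀ l, C₂ l ≤ ∑ l, C₂ l := fun l =>
    Finset.single_le_sum (fun l _ => hC₂ l) (Finset.mem_univ l)
  have hC₂s : 0 ≤ ∑ l, C₂ l := Finset.sum_nonneg fun l _ => hC₂ l
  refine ⟨C₁ + ((n : ℝ) + 2) * ∑ l, C₂ l, by positivity, fun D => ?_⟩
  have hU := D.U_nonneg
  have hW := D.W_nonneg
  have hM := D.M_pos
  have hR := D.R_pos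
  have hd := differentiable_and_hasSum_partialDeriv (K := (∑ l, C₂ l) * (D.U * D.W) * (D.M⁻¹ * 1))
    hα0 (sub_pos.2 hα1) hR (by positivity) (D.hasSum_rieszCommutator hα0 i j k)
    (fun m Z => (hκ.differentiableAt_commOp (by positivity) D.u_diff (D.continuous_g hα0 k) Z).1)
    fun m l X => by
      have hX := D.h_pos X
      have hp := profile_nonneg α (1 - α) (q := 2 ^ m / D.R) (by positivity)
      refine ((H₂ l D).1 m X).trans ?_
      gcongr
      · exact hC₂' l
      · exact D.h_le_one X
  refine ⟨fun X => ?_, fun X => ?_, hd.1, fun X => ?_, fun X Y => ?_, fun X => ?_, fun X Y => ?_⟩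
  · obtain ⟨h1, l, -, h2⟩ := D.pv_g hα0 i j k X
    exact ⟨h1, l, h2⟩
  · obtain ⟨h1, l, -, h2⟩ := D.pv_u_mul_g hα0 i j k X
    exact ⟨h1, l, h2⟩
  · have hX := D.h_pos X
    refine ((H₁ D).1 X).trans ?_
    gcongr
    exact le_add_of_nonneg_right (by positivity)
  · have hX := D.h_pos X
    have hY := D.h_pos Y
    refine ((H₁ D).2 X Y).trans ?_
    gcongr
    exact le_add_of_nonneg_right (by positivity)
  · have hX := D.h_pos X
    refine (norm_le_of_abs_apply_basisVec_le _
      (B := (∑ l, C₂ l) * (D.U * D.W) * D.M⁻¹ * D.h X) (by positivity) fun l => ?_).trans ?_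
    · refine (((H₂ l D).2 (hd.2 l)).1 X).trans ?_
      gcongr
      exact hC₂' l
    · calc _ = (0 + ((n : ℝ) + 2) * ∑ l, C₂ l) * (D.U * D.W) * D.M⁻¹ * D.h X := by ring
        _ ≤ _ := by gcongr
  · have hX := D.h_pos X
    have hY := D.h_pos Y
    refine (norm_le_of_abs_apply_basisVec_le _
      (B := (∑ l, C₂ l) * (D.U * D.W) * D.M⁻¹ * (D.R ^ α)⁻¹ * (D.h X + D.h Y) * ‖X - Y‖ ^ α)
      (by positivity) fun l => ?_).trans ?_
    · refine (((H₂ l D).2 (hd.2 l)).2 X Y).trans ?_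
      gcongr
      exact hC₂' l
    · calc _ = (0 + ((n : ℝ) + 2) * ∑ l, C₂ l) * (D.U * D.W) * D.M⁻¹ * (D.R ^ α)⁻¹ *
            (D.h X + D.h Y) * ‖X - Y‖ ^ α := by ring
        _ ≤ _ := by gcongr

end CommData

/-! ### The product estimate -/

/-- The data of the estimate for `R_i R_j (u w)`: a function `b`, standing for `u w`, which is
controlled by the square of a weight `h ≤ q`. The weight is comparable to a constant at distances
`ρ`, and the averages of `h ^ 2` decay beyond the scale `ρ`. -/
structure ProductData (n : ℕ) (α ε A : ℝ) where
  ρ : ℝ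
  R : ℝ
  q : ℝ
  B : ℝ
  h : Space n → ℝ
  b : Space n → ℝ
  one_le_rho : 1 ≤ ρ
  R_pos : 0 < R
  R_le : R ≤ ρ
  q_le_one : q ≤ 1
  B_nonneg : 0 ≤ B
  h_pos : ∀ X, 0 < h X
  h_le : ∀ X, h X ≤ q
  h_meas : Measurable h
  h_int : ∀ X, Integrable fun Y => (1 + ‖X - Y‖) ^ (-((n : ℝ) + 2)) * h Y
  h_near : ∀ X Y, ‖X - Y‖ ≤ 2 * ρ → h Y ≤ A * h X
  avg : ∀ τ X, ρ ≤ τ → (τ ^ (n + 2))⁻¹ * ∫ Y in Metric.closedBall X (2 * τ), h Y * h Y ≤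
    A * q * (ρ / τ) ^ ε * h X
  b_le : ∀ X, |b X| ≤ B * (h X * h X)
  b_holder : ∀ X Y, |b X - b Y| ≤ B * (R ^ α)⁻¹ * (h X + h Y) ^ 2 * ‖X - Y‖ ^ α

namespace ProductData

variable {n : ℕ} {α ε A : ℝ} {κ : Space n → ℝ}

lemma rho_pos (D : ProductData n α ε A) : 0 < D.ρ := zero_lt_one.trans_le D.one_le_rho

lemma q_pos (D : ProductData n α ε A) : 0 < D.q := (D.h_pos 0).trans_le (D.h_le 0)

lemma one_le_rpow (D : ProductData n α ε A) (hα0 : 0 < α) : 1 ≤ (D.ρ / D.R) ^ α :=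
  Real.one_le_rpow ((one_le_div D.R_pos).2 D.R_le) hα0.le

lemma abs_b_sub_le (D : ProductData n α ε A) (X Y : Space n) :
    |D.b X - D.b Y| ≤ D.B * (D.R ^ α)⁻¹ * 4 * ‖X - Y‖ ^ α := by
  have hB := D.B_nonneg
  have hR := D.R_pos
  have hX := D.h_pos X
  have hY := D.h_pos Y
  have h1 := (D.h_le X).trans D.q_le_one
  have h2 := (D.h_le Y).trans D.q_le_one
  refine (D.b_holder X Y).trans ?_
  gcongr
  nlinarith

lemma continuous_b (D : ProductData n α ε A) (hα0 : 0 < α) : Continuous D.b :=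
  continuous_of_norm_sub_le_rpow hα0 D.abs_b_sub_le

/-- `b` at the scale `τ`: the Hölder bound and the cancellation of the kernel are used for
`τ ≤ ρ`, the averages of the weight for `τ ≥ ρ`. -/
lemma exists_abs_scaleOp_le (hα0 : 0 < α) (hα1 : α < 1) (hε0 : 0 < ε) (hκ : IsPiece κ)
    (h0 : ∫ Z, κ Z = 0) : ∃ C : ℝ, 0 ≤ C ∧ ∀ (D : ProductData n α ε A) (τ : ℝ) (X : Space n),
      0 < τ → |scaleOp τ κ D.b X| ≤
        C * (D.B * D.q * (D.ρ / D.R) ^ α) * D.h X * profile α ε (τ / D.ρ) := by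
  obtain ⟨C₁, hC₁, H₁⟩ := hκ.exists_abs_scaleOp_le
  obtain ⟨C₂, hC₂, H₂⟩ := hκ.exists_abs_scaleOp_le_average
  refine ⟨C₁ * (2 * (1 + |A|) ^ 2) + C₂ * |A|, by positivity, fun D τ X hτ => ?_⟩
  have hB := D.B_nonneg
  have hR := D.R_pos
  have hρ := D.rho_pos
  have hq := D.q_pos
  have hX := D.h_pos X
  have hΛ := D.one_le_rpow hα0
  rcases le_total τ D.ρ with hτρ | hτρ
  · have b1 := H₁ τ (D.B * (D.R ^ α)⁻¹ * ((1 + |A|) ^ 2 * (D.q * D.h X)) * (2 * τ ^ α))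
      (fun Y => D.b Y - D.b X) X hτ fun Y hY => by
        rw [abs_sub_comm]
        have hY0 := D.h_pos Y
        have h1 := (D.h_near X Y (by linarith)).trans
          (mul_le_mul_of_nonneg_right (le_abs_self A) hX.le)
        have h2 := CommData.rpow_two_mul_le hα0 hα1 hτ (norm_nonneg (X - Y)) hY
        have h3 := D.h_le X
        calc _ ≤ D.B * (D.R ^ α)⁻¹ * (D.h X + D.h Y) ^ 2 * ‖X - Y‖ ^ α := D.b_holder X Y
          _ ≤ D.B * (D.R ^ α)⁻¹ * (D.h X + |A| * D.h X) ^ 2 * (2 * τ ^ α) := by gcongr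
          _ = D.B * (D.R ^ α)⁻¹ * ((1 + |A|) ^ 2 * (D.h X * D.h X)) * (2 * τ ^ α) := by ring
          _ ≤ _ := by gcongr
    rw [hκ.scaleOp_sub_const hτ h0 (D.continuous_b hα0)] at b1
    rw [profile_eq_left hα0 hε0 (by positivity) ((div_le_one hρ).2 hτρ)]
    refine b1.trans ?_
    calc _ = (C₁ * (2 * (1 + |A|) ^ 2) + 0) * (D.B * D.q * (D.ρ / D.R) ^ α) * D.h X *
          (τ / D.ρ) ^ α := by
          rw [Real.div_rpow hτ.le hρ.le, Real.div_rpow hρ.le hR.le]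
          field_simp; ring
      _ ≤ _ := by gcongr; positivity
  · have hint : IntegrableOn (fun Y => D.h Y * D.h Y) (Metric.closedBall X (2 * τ)) := by
      refine (integrableOn_const (C := (1 : ℝ)) measure_closedBall_lt_top.ne).mono'
        (D.h_meas.mul D.h_meas).aestronglyMeasurable (Eventually.of_forall fun Y => ?_)
      have h1 := (D.h_le Y).trans D.q_le_one
      rw [Real.norm_of_nonneg (mul_pos (D.h_pos Y) (D.h_pos Y)).le]
      exact mul_le_one₀ h1 (D.h_pos Y).le h1
    have b2 := H₂ τ D.b (fun Y => D.B * (D.h Y * D.h Y)) X hτ (hint.const_mul _)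
      fun Y _ => D.b_le Y
    have havg := (D.avg τ X hτρ)
    have hq2 : 0 ≤ (D.ρ / τ) ^ ε := by positivity
    rw [integral_const_mul, mul_left_comm (τ ^ (n + 2))⁻¹] at b2
    have hp : profile α ε (τ / D.ρ) = (D.ρ / τ) ^ ε := by
      rw [profile_eq_right hα0 hε0 ((one_le_div hρ).2 hτρ), Real.rpow_neg (by positivity),
        ← Real.inv_rpow (by positivity), inv_div]
    rw [hp]
    calc _ ≤ C₂ * (D.B * (A * D.q * (D.ρ / τ) ^ ε * D.h X)) := b2.trans (by gcongr)
      _ ≤ C₂ * (D.B * (|A| * D.q * (D.ρ / τ) ^ ε * D.h X)) := by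
          gcongr; exact le_abs_self A
      _ = (0 + C₂ * |A|) * (D.B * D.q * 1) * D.h X * (D.ρ / τ) ^ ε := by ring
      _ ≤ _ := by gcongr; positivity

lemma pv_b (D : ProductData n α ε A) (hα0 : 0 < α) (i j : Fin (n + 2)) (X : Space n) :
    (∀ ε : ℝ, 0 < ε →
      IntegrableOn (fun Y => kernel i j (X - Y) * D.b Y) {Y : Space n | ε < ‖X - Y‖}) ∧
    ∃ l : ℝ, HasSum (fun m : ℤ => scaleOp (2 ^ m) (dyadicKernel i j) D.b X) l ∧
      Tendsto (truncated i j D.b X) (𝓝[>] 0) (𝓝 l) := by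
  have hb := D.continuous_b hα0
  have hB := D.B_nonneg
  have hk : Measurable fun Y : Space n => (1 + ‖X - Y‖) ^ (-((n : ℝ) + 2)) := by fun_prop
  refine hasSum_scaleOp_and_tendsto_truncated i j hb.measurable hα0
    (B := D.B * (D.R ^ α)⁻¹ * 4) ?_ fun Y => ?_
  · refine ((D.h_int X).const_mul D.B).mono'
      (hk.mul hb.measurable).aestronglyMeasurable (Eventually.of_forall fun Y => ?_)
    have hY := D.h_pos Y
    rw [norm_mul, Real.norm_of_nonneg (by positivity)]
    calc _ ≤ (1 + ‖X - Y‖) ^ (-((n : ℝ) + 2)) * (D.B * (1 * D.h Y)) := by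
          gcongr
          refine (D.b_le Y).trans ?_
          have := (D.h_le Y).trans D.q_le_one
          gcongr
      _ = _ := by ring
  · rw [abs_sub_comm]
    exact D.abs_b_sub_le X Y

/-- The estimate for `R_i R_j (u w)` in terms of pointwise bounds. -/
lemma exists_rieszRiesz_estimate (hα0 : 0 < α) (hα1 : α < 1) (hε0 : 0 < ε) (hA : 1 ≤ A)
    (i j : Fin (n + 2)) : ∃ C : ℝ, 0 ≤ C ∧ ∀ D : ProductData n α ε A,
      PVExists i j D.b ∧
      (∀ X, |rieszRiesz i j D.b X| ≤ C * (D.B * D.q * (D.ρ / D.R) ^ α) * D.h X) ∧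
      ∀ X Y, |rieszRiesz i j D.b X - rieszRiesz i j D.b Y| ≤
        C * (D.B * D.q * (D.ρ / D.R) ^ α) * (D.h X + D.h Y) * ‖X - Y‖ ^ α := by
  have hκ := isPiece_dyadicKernel i j
  have h0 := integral_dyadicKernel i j
  obtain ⟨C₁, hC₁, H₁⟩ := exists_abs_scaleOp_le (A := A) hα0 hα1 hε0 hκ h0
  have hex := fun l => exists_abs_scaleOp_le (A := A) hα0 hα1 hε0 (hκ.partialDeriv l)
    (hκ.integral_partialDeriv l)
  choose C₂ hC₂ H₂ using hex
  have hC₂' : ∀ l, C₂ l ≤ ∑ l, C₂ l := fun l =>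
    Finset.single_le_sum (fun l _ => hC₂ l) (Finset.mem_univ l)
  have hC₂s : 0 ≤ ∑ l, C₂ l := Finset.sum_nonneg fun l _ => hC₂ l
  obtain ⟨C₃, hC₃, H₃⟩ := exists_abs_le_of_hasSum hα0 hε0
  obtain ⟨C₄, hC₄, H₄⟩ := exists_abs_sub_le_of_hasSum_scales hα0 hα1 n hA
  set K := C₃ * C₁ + C₄ * (C₁ + ∑ l, C₂ l) with hK
  have hK0 : 0 ≤ K := by positivity
  refine ⟨K + 2, by positivity, fun D => ?_⟩
  have hB := D.B_nonneg
  have hR := D.R_pos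
  have hρ := D.rho_pos
  have hq := D.q_pos
  have hΛ := D.one_le_rpow hα0
  have hbc := D.continuous_b hα0
  set Λ := D.B * D.q * (D.ρ / D.R) ^ α with hΛdef
  have hΛ0 : 0 ≤ Λ := by positivity
  have hex := fun X => (D.pv_b hα0 i j X).2
  choose T hT hT' using hex
  have hTsup : ∀ X, |T X| ≤ C₃ * C₁ * Λ * D.h X := fun X => by
    have hX := D.h_pos X
    exact (H₃ D.ρ (C₁ * Λ * D.h X) _ _ hρ (by positivity) (hT X) fun m =>
      H₁ D (2 ^ m) X (by positivity)).trans (le_of_eq (by ring))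
  have hprof : ∀ m : ℤ, profile α ε (2 ^ m / D.ρ) ≤ (2 ^ m) ^ α := fun m => by
    refine (min_le_left _ _).trans (Real.rpow_le_rpow (by positivity) ?_ hα0.le)
    exact div_le_self (by positivity) D.one_le_rho
  have hThol : ∀ X Y, |T X - T Y| ≤ K * Λ * (D.h X + D.h Y) * ‖X - Y‖ ^ α := fun X Y => by
    have hX := D.h_pos X
    have hY := D.h_pos Y
    rcases le_total D.ρ ‖X - Y‖ with hle | hle
    · refine (abs_sub_le_of_one_le_norm hα0.le (by positivity) (fun Z => (D.h_pos Z).le) hTsup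
        (D.one_le_rho.trans hle)).trans ?_
      gcongr
      exact le_add_of_nonneg_right (by positivity)
    · refine (H₄ D.h D.ρ ((C₁ + ∑ l, C₂ l) * Λ)
        (fun m => scaleOp (2 ^ m) (dyadicKernel i j) D.b) T (fun X => (D.h_pos X).le) D.h_near
        (by positivity) hT (fun m Z => (hκ.differentiableAt_scaleOp (by positivity) hbc Z).1)
        (fun m Z => ?_) (fun m l Z => ?_) X Y hle).trans ?_
      · have hZ := D.h_pos Z
        calc _ ≤ C₁ * Λ * D.h Z * profile α ε (2 ^ m / D.ρ) := H₁ D (2 ^ m) Z (by positivity)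
          _ ≤ C₁ * Λ * D.h Z * (2 ^ m) ^ α := by gcongr; exact hprof m
          _ ≤ _ := by gcongr; exact le_add_of_nonneg_right hC₂s
      · have h2 : (0 : ℝ) < 2 ^ m := by positivity
        have hZ := D.h_pos Z
        have hc := hC₂ l
        rw [(hκ.differentiableAt_scaleOp h2 hbc Z).2 l, abs_mul, abs_of_pos (inv_pos.2 h2)]
        calc _ ≤ (2 ^ m)⁻¹ * (C₂ l * Λ * D.h Z * profile α ε (2 ^ m / D.ρ)) := by
              gcongr; exact H₂ l D (2 ^ m) Z h2
          _ ≤ (2 ^ m)⁻¹ * (C₂ l * Λ * D.h Z * (2 ^ m) ^ α) := by gcongr; exact hprof m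
          _ ≤ (2 ^ m)⁻¹ * ((C₁ + ∑ l, C₂ l) * Λ * D.h Z * (2 ^ m) ^ α) := by
              gcongr; exact (hC₂' l).trans (le_add_of_nonneg_left hC₁)
          _ = _ := by rw [Real.rpow_sub_one h2.ne']; field_simp
      · calc _ = C₄ * (C₁ + ∑ l, C₂ l) * Λ * (D.h X + D.h Y) * ‖X - Y‖ ^ α := by ring
          _ ≤ _ := by gcongr; exact le_add_of_nonneg_left (by positivity)
  set c : ℝ := if i = j then 1 / ((n : ℝ) + 2) else 0 with hc
  have hc1 : |c| ≤ 1 := by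
    rw [hc]
    split_ifs
    · have : (0 : ℝ) ≤ n := Nat.cast_nonneg n
      rw [abs_of_nonneg (by positivity), div_le_one (by positivity)]
      linarith
    · simp
  have e : ∀ X, rieszRiesz i j D.b X = -T X - c * D.b X := fun X => by
    rw [rieszRiesz, (hT' X).limUnder_eq]
  refine ⟨fun X => ?_, fun X => ?_, fun X Y => ?_⟩
  · obtain ⟨h1, l, -, h2⟩ := D.pv_b hα0 i j X
    exact ⟨h1, l, h2⟩
  · have hX := D.h_pos X
    rw [e]
    refine (abs_sub _ _).trans ?_
    rw [abs_neg, abs_mul]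
    calc _ ≤ C₃ * C₁ * Λ * D.h X + 1 * (D.B * (D.q * D.h X)) := by
          gcongr
          · exact hTsup X
          · refine (D.b_le X).trans ?_
            have := D.h_le X
            gcongr
      _ = C₃ * C₁ * Λ * D.h X + (D.B * D.q * 1) * D.h X := by ring
      _ ≤ K * Λ * D.h X + Λ * D.h X := by
          rw [hΛdef]
          gcongr
          exact le_add_of_nonneg_right (by positivity)
      _ ≤ (K + 2) * Λ * D.h X := by
          have : 0 ≤ Λ * D.h X := by positivity
          nlinarith
  · have hX := D.h_pos X
    have hY := D.h_pos Y
    have e2 : rieszRiesz i j D.b X - rieszRiesz i j D.b Y =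
        -(T X - T Y) - c * (D.b X - D.b Y) := by rw [e, e]; ring
    rw [e2]
    refine (abs_sub _ _).trans ?_
    rw [abs_neg, abs_mul]
    have h1 : (D.R ^ α)⁻¹ ≤ (D.ρ / D.R) ^ α := by
      rw [Real.div_rpow hρ.le hR.le, div_eq_mul_inv]
      exact le_mul_of_one_le_left (by positivity) (Real.one_le_rpow D.one_le_rho hα0.le)
    have h2 : (D.h X + D.h Y) ^ 2 ≤ 2 * D.q * (D.h X + D.h Y) := by
      rw [sq]
      have := D.h_le X
      have := D.h_le Y
      gcongr
      linarith
    calc _ ≤ K * Λ * (D.h X + D.h Y) * ‖X - Y‖ ^ α +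
          1 * (D.B * (D.ρ / D.R) ^ α * (2 * D.q * (D.h X + D.h Y)) * ‖X - Y‖ ^ α) := by
          gcongr
          · exact hThol X Y
          · exact (D.b_holder X Y).trans (by gcongr)
      _ = _ := by rw [hΛdef]; ring

end ProductData

end SingularIntegrals

/-! ### The weighted norms and the weights of the theorem -/

section Norms

variable {n : ℕ} {F : Type*} [NormedAddCommGroup F] {h : Space n → ℝ} {u : Space n → F}
  {α B R : ℝ}

lemma norm_le_of_supNorm_le (hh : ∀ X, 0 < h X) (hB : 0 ≤ B)
    (H : supNorm h u ≤ ENNReal.ofReal B) (X : Space n) : ‖u X‖ ≤ B * h X :=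
  (div_le_iff₀ (hh X)).1 ((ENNReal.ofReal_le_ofReal_iff hB).1
    ((le_iSup (fun X => ENNReal.ofReal (‖u X‖ / h X)) X).trans H))

lemma norm_sub_le_of_holderSeminorm_le (hh : ∀ X, 0 < h X) (hB : 0 ≤ B)
    (H : holderSeminorm α h u ≤ ENNReal.ofReal B) (X Y : Space n) :
    ‖u X - u Y‖ ≤ B * (h X + h Y) * ‖X - Y‖ ^ α := by
  have hX := hh X
  have hY := hh Y
  rcases eq_or_ne X Y with rfl | hne
  · rw [sub_self, norm_zero]
    positivity
  have hr : 0 < ‖X - Y‖ := norm_pos_iff.2 (sub_ne_zero.2 hne)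
  rw [mul_assoc]
  exact (div_le_iff₀ (by positivity)).1 ((ENNReal.ofReal_le_ofReal_iff hB).1
    ((le_iSup₂ (f := fun X Y => ENNReal.ofReal (‖u X - u Y‖ / ((h X + h Y) * ‖X - Y‖ ^ α)))
      X Y).trans H))

lemma supNorm_le (hh : ∀ X, 0 < h X) (H : ∀ X, ‖u X‖ ≤ B * h X) :
    supNorm h u ≤ ENNReal.ofReal B :=
  iSup_le fun X => ENNReal.ofReal_le_ofReal ((div_le_iff₀ (hh X)).2 (H X))

lemma holderSeminorm_le (hh : ∀ X, 0 < h X) (hB : 0 ≤ B)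
    (H : ∀ X Y, ‖u X - u Y‖ ≤ B * (h X + h Y) * ‖X - Y‖ ^ α) :
    holderSeminorm α h u ≤ ENNReal.ofReal B :=
  iSup₂_le fun X Y => ENNReal.ofReal_le_ofReal (div_le_of_le_mul₀
    (by have := hh X; have := hh Y; positivity) hB (by rw [← mul_assoc]; exact H X Y))

lemma le_ofReal_of_ofReal_mul_le {M N : ℝ} {s : ℝ≥0∞} (hM : 0 < M)
    (H : ENNReal.ofReal M * s ≤ ENNReal.ofReal N) : s ≤ ENNReal.ofReal (N * M⁻¹) := by
  rw [← div_eq_mul_inv, ENNReal.ofReal_div_of_pos hM]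
  refine (ENNReal.le_div_iff_mul_le (Or.inl (by simpa using hM)) (Or.inl (by simp))).2 ?_
  rwa [mul_comm]

lemma bounds_of_scaledNorm0_le (hh : ∀ X, 0 < h X) (hR : 0 < R) (hB : 0 ≤ B)
    (H : scaledNorm0 α h R u ≤ ENNReal.ofReal B) : (∀ X, ‖u X‖ ≤ B * h X) ∧
      ∀ X Y, ‖u X - u Y‖ ≤ B * (R ^ α)⁻¹ * (h X + h Y) * ‖X - Y‖ ^ α :=
  ⟨norm_le_of_supNorm_le hh hB (le_self_add.trans H),
    norm_sub_le_of_holderSeminorm_le hh (by positivity)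
      (le_ofReal_of_ofReal_mul_le (by positivity) (le_add_self.trans H))⟩

lemma norm0_le (hh : ∀ X, 0 < h X) (hB : 0 ≤ B) (H₁ : ∀ X, ‖u X‖ ≤ B * h X)
    (H₂ : ∀ X Y, ‖u X - u Y‖ ≤ B * (h X + h Y) * ‖X - Y‖ ^ α) :
    norm0 α h u ≤ ENNReal.ofReal (2 * B) := by
  rw [two_mul, ENNReal.ofReal_add hB hB]
  exact add_le_add (supNorm_le hh H₁) (holderSeminorm_le hh hB H₂)

lemma scaledNorm0_le (hh : ∀ X, 0 < h X) (hR : 0 < R) (hB : 0 ≤ B) (H₁ : ∀ X, ‖u X‖ ≤ B * h X)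
    (H₂ : ∀ X Y, ‖u X - u Y‖ ≤ B * (R ^ α)⁻¹ * (h X + h Y) * ‖X - Y‖ ^ α) :
    scaledNorm0 α h R u ≤ ENNReal.ofReal (2 * B) := by
  rw [two_mul, ENNReal.ofReal_add hB hB]
  refine add_le_add (supNorm_le hh H₁)
    ((mul_le_mul_right (holderSeminorm_le hh (by positivity) H₂) _).trans (le_of_eq ?_))
  rw [← ENNReal.ofReal_mul (by positivity)]
  congr 1
  field_simp

end Norms

section GradientNorms

variable {n : ℕ} {h u : Space n → ℝ} {α B R : ℝ}

lemma max_rpow_pos (hR : 0 < R) : 0 < max R (R ^ (1 - α)) := lt_max_of_lt_left hR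

lemma bounds_of_scaledNorm1_le (hh : ∀ X, 0 < h X) (hR : 0 < R) (hB : 0 ≤ B)
    (H : scaledNorm1 α h R u ≤ ENNReal.ofReal B) :
    (∀ X, |u X| ≤ B * h X) ∧ (∀ X Y, |u X - u Y| ≤ B * (h X + h Y) * ‖X - Y‖ ^ α) ∧
    (∀ X, ‖fderiv ℝ u X‖ ≤ B * (max R (R ^ (1 - α)))⁻¹ * h X) ∧
    ∀ X Y, ‖fderiv ℝ u X - fderiv ℝ u Y‖ ≤
      B * (max R (R ^ (1 - α)))⁻¹ * (R ^ α)⁻¹ * (h X + h Y) * ‖X - Y‖ ^ α := by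
  have hM := max_rpow_pos (α := α) hR
  have h1 : norm0 α h u ≤ ENNReal.ofReal B := le_self_add.trans H
  have h2 := bounds_of_scaledNorm0_le (u := fderiv ℝ u) hh hR (by positivity)
    (le_ofReal_of_ofReal_mul_le hM (le_add_self.trans H))
  exact ⟨norm_le_of_supNorm_le hh hB (le_self_add.trans h1),
    norm_sub_le_of_holderSeminorm_le hh hB (le_add_self.trans h1), h2⟩

lemma scaledNorm1_le (hh : ∀ X, 0 < h X) (hR : 0 < R) (hB : 0 ≤ B) (H₁ : ∀ X, |u X| ≤ B * h X)
    (H₂ : ∀ X Y, |u X - u Y| ≤ B * (h X + h Y) * ‖X - Y‖ ^ α)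
    (H₃ : ∀ X, ‖fderiv ℝ u X‖ ≤ B * (max R (R ^ (1 - α)))⁻¹ * h X)
    (H₄ : ∀ X Y, ‖fderiv ℝ u X - fderiv ℝ u Y‖ ≤
      B * (max R (R ^ (1 - α)))⁻¹ * (R ^ α)⁻¹ * (h X + h Y) * ‖X - Y‖ ^ α) :
    scaledNorm1 α h R u ≤ ENNReal.ofReal (4 * B) := by
  have hM := max_rpow_pos (α := α) hR
  rw [show 4 * B = 2 * B + 2 * B by ring, ENNReal.ofReal_add (by positivity) (by positivity)]
  refine add_le_add (norm0_le hh hB H₁ H₂)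
    ((mul_le_mul_right (scaledNorm0_le hh hR (by positivity) H₃ H₄) _).trans (le_of_eq ?_))
  rw [← ENNReal.ofReal_mul hM.le]
  congr 1
  field_simp

end GradientNorms

section Weights

variable {n : ℕ} {μ₁ t : ℝ}

lemma one_le_sqrt_one_add (hμ : 0 < μ₁) (ht : 0 < t) : 1 ≤ √(1 + μ₁ * t) :=
  Real.one_le_sqrt.2 (by have := mul_pos hμ ht; linarith)

lemma sqrt_one_add_sq (hμ : 0 < μ₁) (ht : 0 < t) : √(1 + μ₁ * t) ^ 2 = 1 + μ₁ * t :=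
  Real.sq_sqrt (by have := mul_pos hμ ht; linarith)

lemma exists_weightF1_comparable (n : ℕ) {δ : ℝ} (hδ0 : 0 < δ) (hδ1 : δ < 1) :
    ∃ c C : ℝ, 0 < c ∧ 0 < C ∧ ∀ μ₁ t : ℝ, 0 < μ₁ → 0 < t → ∀ X : Space n,
      c * modelWeight axisDist δ √(1 + μ₁ * t) X ≤ weightF1 δ μ₁ t X ∧
      weightF1 δ μ₁ t X ≤ C * modelWeight axisDist δ √(1 + μ₁ * t) X := by
  obtain ⟨c, C, hc, hC, H⟩ := exists_heatOp_phi0_comparable n hδ0 hδ1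
  refine ⟨c, C, hc, hC, fun μ₁ t hμ ht X => ?_⟩
  have h0 := mul_pos hμ ht
  have hs := sqrt_one_add_sq hμ ht
  exact H _ _ (zero_lt_one.trans_le (one_le_sqrt_one_add hμ ht)) (by rw [hs]; linarith)
    (by rw [hs]; linarith) X

lemma exists_weightFpm_comparable (n : ℕ) {δ : ℝ} (hδ0 : 0 < δ) (hδ1 : δ < 1) :
    ∃ c C : ℝ, 0 < c ∧ 0 < C ∧ ∀ σ μ₁ t : ℝ, 0 < μ₁ → 0 < t → ∀ X : Space n,
      c * modelWeight (planeDist ((σ * t) • basisVec 0)) (1 + δ) √(1 + μ₁ * t) X ≤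
        weightFpm σ δ μ₁ t X ∧
      weightFpm σ δ μ₁ t X ≤
        C * modelWeight (planeDist ((σ * t) • basisVec 0)) (1 + δ) √(1 + μ₁ * t) X := by
  obtain ⟨c, C, hc, hC, H⟩ := exists_heatOp_phi1_comparable n hδ0 hδ1
  refine ⟨c, C, hc, hC, fun σ μ₁ t hμ ht X => ?_⟩
  have h0 := mul_pos hμ ht
  have hs := sqrt_one_add_sq hμ ht
  have e : modelWeight (planeDist ((σ * t) • basisVec 0)) (1 + δ) √(1 + μ₁ * t) X =
      modelWeight (planeDist 0) (1 + δ) √(1 + μ₁ * t) (X + (σ * t) • basisVec 0) := by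
    simp [modelWeight, planeDist]
  rw [e]
  exact H _ _ (zero_lt_one.trans_le (one_le_sqrt_one_add hμ ht)) (by rw [hs]; linarith)
    (by rw [hs]; linarith) _

lemma max_rpow_le {α R ρ : ℝ} (hα0 : 0 < α) (hα1 : α < 1) (hR : 0 < R) (hρ : 1 ≤ ρ)
    (hRρ : R ≤ ρ) : max R (R ^ (1 - α)) ≤ ρ * R ^ (1 - α) := by
  refine max_le ?_ (le_mul_of_one_le_left (by positivity) hρ)
  have h1 : R ^ α ≤ ρ := by
    calc R ^ α ≤ ρ ^ α := Real.rpow_le_rpow hR.le hRρ hα0.le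
      _ ≤ ρ ^ (1 : ℝ) := Real.rpow_le_rpow_of_exponent_le hρ hα1.le
      _ = ρ := Real.rpow_one ρ
  calc R = R ^ α * R ^ (1 - α) := by rw [← Real.rpow_add hR]; simp
    _ ≤ _ := by gcongr

end Weights

/-- The commutator estimate for fixed indices. -/
lemma exists_scaledNorm1_rieszCommutator_le (n : ℕ) {α δ : ℝ} (hα0 : 0 < α) (hα1 : α < 1)
    (hδ0 : 0 < δ) (hδ1 : δ < 1 / 2) (i j k : Fin (n + 2)) :
    ∃ C : ℝ, 0 ≤ C ∧ ∀ (μ₁ t σ : ℝ) (u w : Space n → ℝ), 0 < μ₁ → 0 < t →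
      Differentiable ℝ u → Differentiable ℝ w →
      scaledNorm1 α (weightFpm σ δ μ₁ t) √(1 + μ₁ * t) u < ∞ →
      scaledNorm1 α (weightF1 δ μ₁ t) √(μ₁ * t) w < ∞ →
        PVExists i j (partialDeriv k w) ∧ PVExists i j (fun X => u X * partialDeriv k w X) ∧
        Differentiable ℝ (rieszCommutator i j u (partialDeriv k w)) ∧
        scaledNorm1 α (weightFpm σ δ μ₁ t) √(μ₁ * t) (rieszCommutator i j u (partialDeriv k w)) ≤
          ENNReal.ofReal C * scaledNorm1 α (weightFpm σ δ μ₁ t) √(1 + μ₁ * t) u *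
            scaledNorm1 α (weightF1 δ μ₁ t) √(μ₁ * t) w := by
  obtain ⟨c₁, C₁, hc₁, hC₁, H₁⟩ := exists_weightF1_comparable n hδ0 (by linarith)
  obtain ⟨c₂, C₂, hc₂, hC₂, H₂⟩ := exists_weightFpm_comparable n hδ0 (by linarith)
  obtain ⟨C₃, hC₃, H₃⟩ := exists_setIntegral_planeDist_le n hδ0 hδ1
  have h3A : (1 : ℝ) ≤ 3 ^ (1 + δ) := Real.one_le_rpow (by norm_num) (by linarith)
  set A := max (3 ^ (1 + δ)) C₃ with hA
  have hA1 : 1 ≤ A := h3A.trans (le_max_left _ _)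
  obtain ⟨C, hC, H⟩ := CommData.exists_commutator_estimate (ε := δ / 2) hα0 hα1 (by linarith)
    (by linarith) hA1 i j k
  refine ⟨4 * (C * C₁ * C₂ * c₂⁻¹), by positivity, fun μ₁ t σ u w hμ ht hu hw hun hwn => ?_⟩
  have hμt := mul_pos hμ ht
  have hρ1 := one_le_sqrt_one_add hμ ht
  have hR : 0 < √(μ₁ * t) := Real.sqrt_pos.2 hμt
  have hRρ : √(μ₁ * t) ≤ √(1 + μ₁ * t) := Real.sqrt_le_sqrt (by linarith)
  have hcomp₁ := H₁ μ₁ t hμ ht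
  have hcomp₂ := H₂ σ μ₁ t hμ ht
  set ρ := √(1 + μ₁ * t) with hρ
  set R := √(μ₁ * t) with hRdef
  set c : Space n := (σ * t) • basisVec 0 with hc
  have hc1 : c 1 = 0 := by simp [hc, basisVec]
  have hρ0 : 0 < ρ := zero_lt_one.trans_le hρ1
  have hp := isDistLike_planeDist c
  have hp₁ := isDistLike_axisDist (n := n)
  have hm := fun X => modelWeight_pos (a := 1 + δ) hp hρ0 X
  have hm₁ := fun X => modelWeight_pos (a := δ) hp₁ hρ0 X
  have hf : ∀ X, 0 < weightFpm σ δ μ₁ t X := fun X =>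
    (mul_pos hc₂ (hm X)).trans_le (hcomp₂ X).1
  have hf₁ : ∀ X : Space n, 0 < weightF1 δ μ₁ t X := fun X =>
    (mul_pos hc₁ (hm₁ X)).trans_le (hcomp₁ X).1
  have hmle : ∀ X, modelWeight (planeDist c) (1 + δ) ρ X ≤ c₂⁻¹ * weightFpm σ δ μ₁ t X :=
    fun X => by rw [inv_mul_eq_div, le_div_iff₀' hc₂]; exact (hcomp₂ X).1
  obtain ⟨N, hN0, hN⟩ : ∃ N : ℝ, 0 ≤ N ∧
      scaledNorm1 α (weightFpm σ δ μ₁ t) ρ u = ENNReal.ofReal N :=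
    ⟨_, ENNReal.toReal_nonneg, (ENNReal.ofReal_toReal hun.ne).symm⟩
  obtain ⟨N₁, hN₁0, hN₁⟩ : ∃ N : ℝ, 0 ≤ N ∧
      scaledNorm1 α (weightF1 δ μ₁ t) R w = ENNReal.ofReal N :=
    ⟨_, ENNReal.toReal_nonneg, (ENNReal.ofReal_toReal hwn.ne).symm⟩
  obtain ⟨u1, u2, u3, u4⟩ := bounds_of_scaledNorm1_le hf hρ0 hN0 hN.le
  obtain ⟨w1, w2, w3, w4⟩ := bounds_of_scaledNorm1_le hf₁ hR hN₁0 hN₁.le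
  -- as `ρ ≥ 1`, the factor `max(ρ, ρ^{1-α})` in the norm of `u` is `ρ`
  have hmaxρ : max ρ (ρ ^ (1 - α)) = ρ := max_eq_left <| by
    simpa using Real.rpow_le_rpow_of_exponent_le hρ1 (by linarith : 1 - α ≤ 1)
  rw [hmaxρ] at u3 u4
  have hM := max_rpow_pos (α := α) hR
  have hsum₂ : ∀ X Y, weightFpm σ δ μ₁ t X + weightFpm σ δ μ₁ t Y ≤
      C₂ * (modelWeight (planeDist c) (1 + δ) ρ X + modelWeight (planeDist c) (1 + δ) ρ Y) :=
    fun X Y => by linarith [(hcomp₂ X).2, (hcomp₂ Y).2]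
  have hsum₁ : ∀ X Y : Space n, weightF1 δ μ₁ t X + weightF1 δ μ₁ t Y ≤ C₁ * 2 := fun X Y => by
    have h1 := modelWeight_le_one hp₁ hδ0.le hρ1 X
    have h2 := modelWeight_le_one hp₁ hδ0.le hρ1 Y
    nlinarith [(hcomp₁ X).2, (hcomp₁ Y).2]
  -- the weights are replaced by the model weights, at the cost of constants
  let D : CommData n α (δ / 2) A :=
    { ρ := ρ
      R := R
      M := max R (R ^ (1 - α))
      U := N * C₂
      W := N₁ * C₁
      h := modelWeight (planeDist c) (1 + δ) ρ
      h₁ := modelWeight axisDist δ ρ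
      u := u
      w := w
      one_le_rho := hρ1
      R_pos := hR
      R_le := hRρ
      M_pos := hM
      M_le := max_rpow_le hα0 hα1 hR hρ1 hRρ
      U_nonneg := by positivity
      W_nonneg := by positivity
      h_pos := hm
      h_le_one := modelWeight_le_one hp (by linarith) hρ1
      h_meas := measurable_modelWeight hp
      h_near := fun X Y hXY => (modelWeight_le_of_near hp (by linarith) hρ0 hXY).trans
        (mul_le_mul_of_nonneg_right (le_max_left _ _) (hm X).le)
      h₁_pos := hm₁
      h₁_le_one := modelWeight_le_one hp₁ hδ0.le hρ1
      h₁_meas := measurable_modelWeight hp₁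
      h₁_int := fun X => integrable_kernel_mul_axisDist hδ0 (by linarith) hρ0 X
      avg := fun τ X hτ => by
        have hτ0 : 0 < τ := hρ0.trans_le hτ
        have hX := hm X
        have h1 : ρ ^ (-δ) ≤ 1 := Real.rpow_le_one_of_one_le_of_nonpos hρ1 (by linarith)
        rw [inv_mul_le_iff₀ (by positivity)]
        calc _ ≤ C₃ * τ ^ (n + 2) * ρ ^ (-δ) * (ρ / τ) ^ (δ / 2) *
              modelWeight (planeDist c) (1 + δ) ρ X := H₃ c ρ τ hc1 hρ0 hτ X
          _ ≤ A * τ ^ (n + 2) * 1 * (ρ / τ) ^ (δ / 2) *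
              modelWeight (planeDist c) (1 + δ) ρ X := by
              gcongr
              exact le_max_right _ _
          _ = _ := by ring
      u_diff := hu
      w_diff := hw
      u_le := fun X => by
        rw [mul_assoc]; exact (u1 X).trans (by gcongr; exact (hcomp₂ X).2)
      u_holder := fun X Y => (u2 X Y).trans (by
        rw [mul_assoc N C₂]; gcongr; exact hsum₂ X Y)
      du_le := fun X => (u3 X).trans (by
        calc _ ≤ N * ρ⁻¹ * (C₂ * modelWeight (planeDist c) (1 + δ) ρ X) := by
              gcongr; exact (hcomp₂ X).2
          _ = _ := by ring)
      du_holder := fun X Y => (u4 X Y).trans (by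
        calc _ ≤ N * ρ⁻¹ * (ρ ^ α)⁻¹ * (C₂ * (modelWeight (planeDist c) (1 + δ) ρ X +
              modelWeight (planeDist c) (1 + δ) ρ Y)) * ‖X - Y‖ ^ α := by
              gcongr; exact hsum₂ X Y
          _ = _ := by ring)
      w_le := fun X => by
        rw [mul_assoc]; exact (w1 X).trans (by gcongr; exact (hcomp₁ X).2)
      w_holder := fun X Y => (w2 X Y).trans (by
        calc _ ≤ N₁ * (C₁ * 2) * ‖X - Y‖ ^ α := by gcongr; exact hsum₁ X Y
          _ = _ := by ring)
      dw_le := fun X => (w3 X).trans (by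
        calc _ ≤ N₁ * (max R (R ^ (1 - α)))⁻¹ * (C₁ * modelWeight axisDist δ ρ X) := by
              gcongr; exact (hcomp₁ X).2
          _ = _ := by ring)
      dw_holder := fun X Y => (w4 X Y).trans (by
        calc _ ≤ N₁ * (max R (R ^ (1 - α)))⁻¹ * (R ^ α)⁻¹ * (C₁ * 2) * ‖X - Y‖ ^ α := by
              gcongr; exact hsum₁ X Y
          _ = _ := by ring) }
  obtain ⟨v1, v2, v3, v4, v5, v6, v7⟩ := H D
  refine ⟨v1, v2, v3, ?_⟩
  rw [hN, hN₁, ← ENNReal.ofReal_mul (by positivity), ← ENNReal.ofReal_mul (by positivity)]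
  have hsumm : ∀ X Y, modelWeight (planeDist c) (1 + δ) ρ X + modelWeight (planeDist c) (1 + δ) ρ Y
      ≤ c₂⁻¹ * (weightFpm σ δ μ₁ t X + weightFpm σ δ μ₁ t Y) :=
    fun X Y => by linarith [hmle X, hmle Y]
  refine (scaledNorm1_le (B := C * (N * C₂ * (N₁ * C₁)) * c₂⁻¹) hf hR (by positivity)
    (fun X => (v4 X).trans ?_) (fun X Y => (v5 X Y).trans ?_) (fun X => (v6 X).trans ?_)
    fun X Y => (v7 X Y).trans ?_).trans (le_of_eq (by ring_nf))
  · calc _ ≤ C * (N * C₂ * (N₁ * C₁)) * (c₂⁻¹ * weightFpm σ δ μ₁ t X) :=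
          mul_le_mul_of_nonneg_left (hmle X) (by positivity)
      _ = _ := by ring
  · calc _ ≤ C * (N * C₂ * (N₁ * C₁)) * (c₂⁻¹ * (weightFpm σ δ μ₁ t X + weightFpm σ δ μ₁ t Y)) *
            ‖X - Y‖ ^ α := mul_le_mul_of_nonneg_right
              (mul_le_mul_of_nonneg_left (hsumm X Y) (by positivity)) (by positivity)
      _ = _ := by ring
  · calc _ ≤ C * (N * C₂ * (N₁ * C₁)) * (max R (R ^ (1 - α)))⁻¹ *
            (c₂⁻¹ * weightFpm σ δ μ₁ t X) :=
          mul_le_mul_of_nonneg_left (hmle X) (by positivity)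
      _ = _ := by ring
  · calc _ ≤ C * (N * C₂ * (N₁ * C₁)) * (max R (R ^ (1 - α)))⁻¹ * (R ^ α)⁻¹ *
            (c₂⁻¹ * (weightFpm σ δ μ₁ t X + weightFpm σ δ μ₁ t Y)) * ‖X - Y‖ ^ α :=
          mul_le_mul_of_nonneg_right
              (mul_le_mul_of_nonneg_left (hsumm X Y) (by positivity)) (by positivity)
      _ = _ := by ring

/-- The product estimate for fixed indices. -/
lemma exists_norm0_rieszRiesz_le (n : ℕ) {α δ : ℝ} (hα0 : 0 < α) (hα1 : α < 1)
    (hδ0 : 0 < δ) (hδ1 : δ < 1 / 2) (i j : Fin (n + 2)) :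
    ∃ C : ℝ, 0 ≤ C ∧ ∀ (μ₁ t : ℝ) (u w : Space n → ℝ), 0 < μ₁ → 0 < t →
      scaledNorm0 α (weightF1 δ μ₁ t) √(μ₁ * t) u < ∞ →
      scaledNorm0 α (weightF1 δ μ₁ t) √(μ₁ * t) w < ∞ →
        PVExists i j (fun X => u X * w X) ∧
        norm0 α (weightF1 δ μ₁ t) (rieszRiesz i j (fun X => u X * w X)) ≤
          ENNReal.ofReal C *
            ENNReal.ofReal ((1 + μ₁ * t) ^ (-(δ / 2)) * (1 + (μ₁ * t) ^ (-(α / 2)))) *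
            scaledNorm0 α (weightF1 δ μ₁ t) √(μ₁ * t) u *
            scaledNorm0 α (weightF1 δ μ₁ t) √(μ₁ * t) w := by
  obtain ⟨c₁, C₁, hc₁, hC₁, H₁⟩ := exists_weightF1_comparable n hδ0 (by linarith)
  obtain ⟨C₃, hC₃, H₃⟩ := exists_setIntegral_axisDist_le n hδ0 hδ1
  have h3A : (1 : ℝ) ≤ 3 ^ δ := Real.one_le_rpow (by norm_num) hδ0.le
  set A := max (3 ^ δ) C₃ with hA
  have hA1 : 1 ≤ A := h3A.trans (le_max_left _ _)
  obtain ⟨C, hC, H⟩ := ProductData.exists_rieszRiesz_estimate (ε := δ / 2) hα0 hα1 (by linarith)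
    hA1 i j
  refine ⟨2 * (C * C₁ * C₁ * c₁⁻¹), by positivity, fun μ₁ t u w hμ ht hun hwn => ?_⟩
  have hμt := mul_pos hμ ht
  have hρ1 := one_le_sqrt_one_add hμ ht
  have hρsq := sqrt_one_add_sq hμ ht
  have hR : 0 < √(μ₁ * t) := Real.sqrt_pos.2 hμt
  have hRsq : √(μ₁ * t) ^ 2 = μ₁ * t := Real.sq_sqrt hμt.le
  have hRρ : √(μ₁ * t) ≤ √(1 + μ₁ * t) := Real.sqrt_le_sqrt (by linarith)
  have hcomp₁ := H₁ μ₁ t hμ ht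
  have hpow : ∀ x a : ℝ, 0 < x → x ^ (-(a / 2)) = √x ^ (-a) := fun x a hx => by
    rw [Real.sqrt_eq_rpow, ← Real.rpow_mul hx.le]
    ring_nf
  rw [hpow _ _ (by linarith), hpow _ _ hμt]
  set ρ := √(1 + μ₁ * t) with hρ
  set R := √(μ₁ * t) with hRdef
  have hρ0 : 0 < ρ := zero_lt_one.trans_le hρ1
  have hp₁ := isDistLike_axisDist (n := n)
  have hm₁ := fun X => modelWeight_pos (a := δ) hp₁ hρ0 X
  have hf₁ : ∀ X : Space n, 0 < weightF1 δ μ₁ t X := fun X =>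
    (mul_pos hc₁ (hm₁ X)).trans_le (hcomp₁ X).1
  have hmle : ∀ X : Space n, modelWeight axisDist δ ρ X ≤ c₁⁻¹ * weightF1 δ μ₁ t X :=
    fun X => by rw [inv_mul_eq_div, le_div_iff₀' hc₁]; exact (hcomp₁ X).1
  obtain ⟨N, hN0, hN⟩ : ∃ N : ℝ, 0 ≤ N ∧
      scaledNorm0 α (weightF1 δ μ₁ t) R u = ENNReal.ofReal N :=
    ⟨_, ENNReal.toReal_nonneg, (ENNReal.ofReal_toReal hun.ne).symm⟩
  obtain ⟨N₁, hN₁0, hN₁⟩ : ∃ N : ℝ, 0 ≤ N ∧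
      scaledNorm0 α (weightF1 δ μ₁ t) R w = ENNReal.ofReal N :=
    ⟨_, ENNReal.toReal_nonneg, (ENNReal.ofReal_toReal hwn.ne).symm⟩
  obtain ⟨u1, u2⟩ := bounds_of_scaledNorm0_le hf₁ hR hN0 hN.le
  obtain ⟨w1, w2⟩ := bounds_of_scaledNorm0_le hf₁ hR hN₁0 hN₁.le
  have hsum : ∀ X Y : Space n, weightF1 δ μ₁ t X + weightF1 δ μ₁ t Y ≤
      C₁ * (modelWeight axisDist δ ρ X + modelWeight axisDist δ ρ Y) :=
    fun X Y => by linarith [(hcomp₁ X).2, (hcomp₁ Y).2]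
  have bound : ∀ {N : ℝ} {v : Space n → ℝ}, 0 ≤ N → (∀ X, ‖v X‖ ≤ N * weightF1 δ μ₁ t X) →
      ∀ X, |v X| ≤ N * (C₁ * modelWeight axisDist δ ρ X) := fun hN hv X =>
    (hv X).trans (mul_le_mul_of_nonneg_left (hcomp₁ X).2 hN)
  have bound' : ∀ {N : ℝ} {v : Space n → ℝ}, 0 ≤ N → (∀ X Y, ‖v X - v Y‖ ≤
      N * (R ^ α)⁻¹ * (weightF1 δ μ₁ t X + weightF1 δ μ₁ t Y) * ‖X - Y‖ ^ α) → ∀ X Y, |v X - v Y| ≤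
      N * (R ^ α)⁻¹ * (C₁ * (modelWeight axisDist δ ρ X + modelWeight axisDist δ ρ Y)) *
        ‖X - Y‖ ^ α := fun hN hv X Y =>
    (hv X Y).trans (by gcongr; exact hsum X Y)
  -- the weights are replaced by the model weights, at the cost of constants
  let D : ProductData n α (δ / 2) A :=
    { ρ := ρ
      R := R
      q := ρ ^ (-δ)
      B := N * C₁ * (N₁ * C₁)
      h := modelWeight axisDist δ ρ
      b := fun X => u X * w X
      one_le_rho := hρ1
      R_pos := hR
      R_le := hRρ
      q_le_one := Real.rpow_le_one_of_one_le_of_nonpos hρ1 (by linarith)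
      B_nonneg := by positivity
      h_pos := hm₁
      h_le := modelWeight_le hp₁ hδ0.le hρ0
      h_meas := measurable_modelWeight hp₁
      h_int := fun X => integrable_kernel_mul_axisDist hδ0 (by linarith) hρ0 X
      h_near := fun X Y hXY => (modelWeight_le_of_near hp₁ hδ0.le hρ0 hXY).trans
        (mul_le_mul_of_nonneg_right (le_max_left _ _) (hm₁ X).le)
      avg := fun τ X hτ => by
        have hτ0 : 0 < τ := hρ0.trans_le hτ
        have hX := hm₁ X
        rw [inv_mul_le_iff₀ (by positivity)]
        calc _ ≤ C₃ * τ ^ (n + 2) * ρ ^ (-δ) * (ρ / τ) ^ (δ / 2) *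
              modelWeight axisDist δ ρ X := H₃ ρ τ hρ0 hτ X
          _ ≤ A * τ ^ (n + 2) * ρ ^ (-δ) * (ρ / τ) ^ (δ / 2) * modelWeight axisDist δ ρ X := by
              gcongr
              exact le_max_right _ _
          _ = _ := by ring
      b_le := fun X => by
        have hX := hm₁ X
        rw [abs_mul]
        calc _ ≤ (N * (C₁ * modelWeight axisDist δ ρ X)) * (N₁ * (C₁ * modelWeight axisDist δ ρ X)) :=
              mul_le_mul (bound hN0 u1 X) (bound hN₁0 w1 X) (abs_nonneg _) (by positivity)
          _ = _ := by ring
      b_holder := fun X Y => by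
        have hX := hm₁ X
        have hY := hm₁ Y
        have e : u X * w X - u Y * w Y = u X * (w X - w Y) + w Y * (u X - u Y) := by ring
        rw [e]
        refine (abs_add_le _ _).trans ?_
        rw [abs_mul, abs_mul]
        calc _ ≤ (N * (C₁ * modelWeight axisDist δ ρ X)) * (N₁ * (R ^ α)⁻¹ * (C₁ *
              (modelWeight axisDist δ ρ X + modelWeight axisDist δ ρ Y)) * ‖X - Y‖ ^ α) +
            (N₁ * (C₁ * modelWeight axisDist δ ρ Y)) * (N * (R ^ α)⁻¹ * (C₁ *
              (modelWeight axisDist δ ρ X + modelWeight axisDist δ ρ Y)) * ‖X - Y‖ ^ α) :=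
              add_le_add
                (mul_le_mul (bound hN0 u1 X) (bound' hN₁0 w2 X Y) (abs_nonneg _) (by positivity))
                (mul_le_mul (bound hN₁0 w1 Y) (bound' hN0 u2 X Y) (abs_nonneg _) (by positivity))
          _ = _ := by ring }
  obtain ⟨v1, v2, v3⟩ := H D
  refine ⟨v1, ?_⟩
  -- `ρ² = 1 + R²`, so that `ρ ≤ 1 + R`
  have hratio : (ρ / R) ^ α ≤ 1 + R ^ (-α) := by
    have h1 : ρ / R ≤ 1 + R⁻¹ := by
      rw [div_le_iff₀ hR, add_mul, inv_mul_cancel₀ hR.ne']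
      nlinarith
    calc (ρ / R) ^ α ≤ (1 + R⁻¹) ^ α := by gcongr
      _ ≤ 1 ^ α + R⁻¹ ^ α := Real.rpow_add_le_add_rpow zero_le_one (by positivity) hα0.le hα1.le
      _ = _ := by rw [Real.one_rpow, Real.inv_rpow hR.le, Real.rpow_neg hR.le]
  rw [hN, hN₁, ← ENNReal.ofReal_mul (by positivity), ← ENNReal.ofReal_mul (by positivity),
    ← ENNReal.ofReal_mul (by positivity)]
  have hK : C * (N * C₁ * (N₁ * C₁) * ρ ^ (-δ) * (ρ / R) ^ α) ≤
      C * (N * C₁ * (N₁ * C₁) * ρ ^ (-δ) * (1 + R ^ (-α))) := by gcongr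
  have hsumm : ∀ X Y : Space n, modelWeight axisDist δ ρ X + modelWeight axisDist δ ρ Y
      ≤ c₁⁻¹ * (weightF1 δ μ₁ t X + weightF1 δ μ₁ t Y) :=
    fun X Y => by linarith [hmle X, hmle Y]
  refine (norm0_le (B := C * (N * C₁ * (N₁ * C₁) * ρ ^ (-δ) * (1 + R ^ (-α))) * c₁⁻¹) hf₁
    (by positivity) (fun X => (v2 X).trans ?_) fun X Y => (v3 X Y).trans ?_).trans
    (le_of_eq (by ring_nf))
  · calc _ ≤ C * (N * C₁ * (N₁ * C₁) * ρ ^ (-δ) * (1 + R ^ (-α))) *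
            (c₁⁻¹ * weightF1 δ μ₁ t X) :=
          mul_le_mul hK (hmle X) (hm₁ X).le (by positivity)
      _ = _ := by ring
  · calc _ ≤ C * (N * C₁ * (N₁ * C₁) * ρ ^ (-δ) * (1 + R ^ (-α))) *
            (c₁⁻¹ * (weightF1 δ μ₁ t X + weightF1 δ μ₁ t Y)) * ‖X - Y‖ ^ α :=
          mul_le_mul_of_nonneg_right (mul_le_mul hK (hsumm X Y)
            (add_pos (hm₁ X) (hm₁ Y)).le (by positivity)) (by positivity)
      _ = _ := by ring

end WeightedRiesz

theorem proposition6p5 (n : ℕ) (α δ : ℝ) (hα₀ : 0 < α) (hα₁ : α < 1)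
    (hδ₀ : 0 < δ) (hδ₁ : δ < 1 / 2) :
    ∃ C : ℝ≥0, ∀ μ₁ t : ℝ, 0 < μ₁ → 0 < t → ∀ i j : Fin (n + 2),
      (∀ k : Fin (n + 2), ∀ σ : ℝ, σ = 1 ∨ σ = -1 → ∀ u w : Space n → ℝ,
        Differentiable ℝ u → Differentiable ℝ w →
        scaledNorm1 α (weightFpm σ δ μ₁ t) (Real.sqrt (1 + μ₁ * t)) u < ∞ →
        scaledNorm1 α (weightF1 δ μ₁ t) (Real.sqrt (μ₁ * t)) w < ∞ →
          PVExists i j (partialDeriv k w) ∧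
          PVExists i j (fun X => u X * partialDeriv k w X) ∧
          Differentiable ℝ (rieszCommutator i j u (partialDeriv k w)) ∧
          scaledNorm1 α (weightFpm σ δ μ₁ t) (Real.sqrt (μ₁ * t))
              (rieszCommutator i j u (partialDeriv k w)) ≤
            C * scaledNorm1 α (weightFpm σ δ μ₁ t) (Real.sqrt (1 + μ₁ * t)) u *
              scaledNorm1 α (weightF1 δ μ₁ t) (Real.sqrt (μ₁ * t)) w) ∧
      (∀ u w : Space n → ℝ,
        scaledNorm0 α (weightF1 δ μ₁ t) (Real.sqrt (μ₁ * t)) u < ∞ →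
        scaledNorm0 α (weightF1 δ μ₁ t) (Real.sqrt (μ₁ * t)) w < ∞ →
          PVExists i j (fun X => u X * w X) ∧
          norm0 α (weightF1 δ μ₁ t) (rieszRiesz i j (fun X => u X * w X)) ≤
            C * ENNReal.ofReal ((1 + μ₁ * t) ^ (-(δ / 2)) * (1 + (μ₁ * t) ^ (-(α / 2)))) *
              scaledNorm0 α (weightF1 δ μ₁ t) (Real.sqrt (μ₁ * t)) u *
              scaledNorm0 α (weightF1 δ μ₁ t) (Real.sqrt (μ₁ * t)) w) := by
  choose C₁ hC₁ H₁ using fun p : Fin (n + 2) × Fin (n + 2) × Fin (n + 2) =>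
    exists_scaledNorm1_rieszCommutator_le n hα₀ hα₁ hδ₀ hδ₁ p.1 p.2.1 p.2.2
  choose C₂ hC₂ H₂ using fun p : Fin (n + 2) × Fin (n + 2) =>
    exists_norm0_rieszRiesz_le n hα₀ hα₁ hδ₀ hδ₁ p.1 p.2
  have h1 : ∀ p, C₁ p ≤ ∑ p, C₁ p := fun p =>
    Finset.single_le_sum (fun p _ => hC₁ p) (Finset.mem_univ p)
  have h2 : ∀ p, C₂ p ≤ ∑ p, C₂ p := fun p =>
    Finset.single_le_sum (fun p _ => hC₂ p) (Finset.mem_univ p)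
  have h1s : 0 ≤ ∑ p, C₁ p := Finset.sum_nonneg fun p _ => hC₁ p
  have h2s : 0 ≤ ∑ p, C₂ p := Finset.sum_nonneg fun p _ => hC₂ p
  have h1' : ∀ p, ENNReal.ofReal (C₁ p) ≤ ((∑ p, C₁ p + ∑ p, C₂ p).toNNReal : ℝ≥0∞) := fun p =>
    ENNReal.ofReal_le_ofReal (by linarith [h1 p])
  have h2' : ∀ p, ENNReal.ofReal (C₂ p) ≤ ((∑ p, C₁ p + ∑ p, C₂ p).toNNReal : ℝ≥0∞) := fun p =>
    ENNReal.ofReal_le_ofReal (by linarith [h2 p])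
  refine ⟨(∑ p, C₁ p + ∑ p, C₂ p).toNNReal, fun μ₁ t hμ ht i j =>
    ⟨fun k σ _ u w hu hw hun hwn => ?_, fun u w hun hwn => ?_⟩⟩
  · obtain ⟨v1, v2, v3, v4⟩ := H₁ (i, j, k) μ₁ t σ u w hμ ht hu hw hun hwn
    refine ⟨v1, v2, v3, v4.trans ?_⟩
    gcongr
    exact h1' _
  · obtain ⟨v1, v2⟩ := H₂ (i, j) μ₁ t u w hμ ht hun hwn
    refine ⟨v1, v2.trans ?_⟩
    gcongr
    exact h2' _
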